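/- Conventions. All manifolds are smooth, Hausdorff and without boundary. Let $n\ge 0$ be an integer and let $M$ be a manifold with an $n$-codimensional regular distribution $C$, i.e. a linear subbundle $C\subset TM$ whose fibers have codimension $n$. The curvature of $C$ is the skew-symmetric $C^\infty(M)$-bilinear map $R:\Gamma(C)\times\Gamma(C)\to\Gamma(TM/C)$, $R(X,Y)=[X,Y] \bmod C$, and the characteristic distribution $D$ of $C$ consists of the tangent vectors $\zeta\in C$ with $R(\zeta,-)=0$. The distribution $C$ is pre-$n$-contact if $D$ has constant dimension, and $n$-contact if moreover $D=0$. A pre-$n$-plectic form on a manifold is a closed differential $(n+1)$-form $\omega$ such that $\ker\omega=\{\xi : i_\xi\omega=0\}$ has constant dimension; it is $n$-plectic if moreover $\ker\omega=0$. Let $\mathrm{pr}:\wedge^nT^*M\to M$ be the bundle of $n$-forms, $\theta_M$ the tautological $n$-form on $\wedge^nT^*M$, $(\theta_M)_\alpha=\mathrm{pr}^*\alpha$, and $\omega_M=d\theta_M$ the canonical form. Let $C$ be pre-$n$-contact, let $\widetilde M=\wedge^nC^0\smallsetminus 0\subset\wedge^nT^*M$ be the set of nonzero $n$-forms on tangent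 spaces $T_xM$, $x\in M$, that vanish as soon as one of their arguments lies in $C_x$, and let $\pi:\widetilde M\to M$ be the projection. A local section $A$ of $\widetilde M$ (a local $n$-form on $M$) is called $D$-flat if $L_ZA=0$ for all $Z\in\Gamma(D)$. Theorem. The set $\widetilde M$ is an embedded submanifold of $\wedge^nT^*M$ of dimension $\dim M+1$. For every $\alpha\in\widetilde M$, with $x=\pi(\alpha)$, there is a $D$-flat section $A$ of $\widetilde M$, defined around $x$, with $A_x=\alpha$, and the subspace $\widetilde D_\alpha:=A_*(D_x)\subset T_\alpha\widetilde M$ does not depend on the choice of $A$. The restriction $\widetilde\omega$ of $\omega_M$ to $\widetilde M$ is a pre-$n$-plectic form, and $$\ker\widetilde\omega=\widetilde D .$$ In particular, $\widetilde\omega$ is $n$-plectic if and only if $C$ is $n$-contact. -/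

import Mathlib

open Set Bundle Manifold VectorField
open scoped ContDiff

noncomputable section

namespace Multicontact

/-! ### Differential forms on manifolds -/

section Forms

variable {E : Type*} [NormedAddCommGroup E] [NormedSpace ℝ E]
  {H : Type*} [TopologicalSpace H] (I : ModelWithCorners ℝ E H)
  (M : Type*) [TopologicalSpace M] [ChartedSpace H M]

/-- A (not necessarily smooth) differential `k`-form on `M`. -/
abbrev Form (k : ℕ) : Type _ :=
  ∀ x : M, TangentSpace I x [⋀^Fin k]→L[ℝ] ℝ

/-- The total space of the bundle `∧ᵏ T*M` of `k`-forms over `M`. -/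
abbrev FormBundle (k : ℕ) : Type _ :=
  TotalSpace (E [⋀^Fin k]→L[ℝ] ℝ)
    (fun x : M => TangentSpace I x [⋀^Fin k]→L[ℝ] Bundle.Trivial M ℝ x)

/-- The model with corners of `∧ᵏ T*M`. -/
abbrev formModel (k : ℕ) :
    ModelWithCorners ℝ (E × (E [⋀^Fin k]→L[ℝ] ℝ)) (ModelProd H (E [⋀^Fin k]→L[ℝ] ℝ)) :=
  I.prod 𝓘(ℝ, E [⋀^Fin k]→L[ℝ] ℝ)

variable {I M}

/-- A form is smooth if it is a smooth section of `∧ᵏ T*M`. -/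
def IsSmoothForm [IsManifold I ∞ M] {k : ℕ} (μ : Form I M k) : Prop :=
  ContMDiff I (formModel I k) ∞ (fun x => (⟨x, μ x⟩ : FormBundle I M k))

/-- The coordinate expression of a form in the preferred chart at `x₀`: its pull-back along the
inverse of the chart. -/
def inChart {k : ℕ} (μ : Form I M k) (x₀ : M) (y : E) : E [⋀^Fin k]→L[ℝ] ℝ :=
  (μ ((extChartAt I x₀).symm y)).compContinuousLinearMap
    (mfderivWithin 𝓘(ℝ, E) I (extChartAt I x₀).symm (range I) y)

/-- The exterior differential: at `x` it is computed in the preferred chart at `x`, and the result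
is pulled back along that chart. -/
def extD {k : ℕ} (μ : Form I M k) : Form I M (k + 1) := fun x =>
  ContinuousAlternatingMap.compContinuousLinearMap
    (extDerivWithin (inChart μ x) (range I) (extChartAt I x x) : E [⋀^Fin (k + 1)]→L[ℝ] ℝ)
    (mfderiv I 𝓘(ℝ, E) (extChartAt I x) x)

/-- The insertion `i_Z μ` of a vector field into a form. -/
def insertion (Z : ∀ x : M, TangentSpace I x) {k : ℕ} (μ : Form I M (k + 1)) : Form I M k :=
  fun x => ContinuousAlternatingMap.curryLeft (E := E) (μ x) (Z x)

/-- The Lie derivative of a form along a vector field, `L_Z = i_Z d + d i_Z`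
(where `i_Z` vanishes on functions). -/
def lieDeriv (Z : ∀ x : M, TangentSpace I x) : {k : ℕ} → Form I M k → Form I M k
  | 0, μ => insertion Z (extD μ)
  | _ + 1, μ => fun x => insertion Z (extD μ) x + extD (insertion Z μ) x

/-- The kernel of a form at a point: `{ξ | i_ξ μ = 0}`. -/
def formKer {k : ℕ} (μ : Form I M (k + 1)) (x : M) : Submodule ℝ (TangentSpace I x) where
  carrier := {ξ | ∀ v : Fin k → TangentSpace I x, μ x (Matrix.vecCons ξ v) = 0}
  zero_mem' v := (μ x).map_coord_zero (0 : Fin (k + 1)) rfl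
  add_mem' {ξ η} hξ hη v := by
    have h := (μ x).toAlternatingMap.map_vecCons_add v ξ η
    exact h.trans (by simpa using congrArg₂ (· + ·) (hξ v) (hη v))
  smul_mem' c ξ hξ v := by
    have h := (μ x).toAlternatingMap.map_vecCons_smul v c ξ
    exact h.trans (by simpa using Or.inr (hξ v))

/-- A pre-`n`-plectic structure: a closed (smooth) `(n+1)`-form whose kernel has constant
dimension. -/
structure IsPrePlectic [IsManifold I ∞ M] (n : ℕ) (μ : Form I M (n + 1)) : Prop where
  smooth : IsSmoothForm μ
  closed : ∀ x, extD μ x = 0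
  ker_const : ∃ r : ℕ, ∀ x, Module.finrank ℝ (formKer μ x) = r

/-- An `n`-plectic structure: a pre-`n`-plectic structure with vanishing kernel. -/
structure IsPlectic [IsManifold I ∞ M] (n : ℕ) (μ : Form I M (n + 1)) : Prop
    extends IsPrePlectic n μ where
  ker_eq_bot : ∀ x, formKer μ x = ⊥

/-- The pull-back of a form along a map of manifolds. -/
def formPullback {E' : Type*} [NormedAddCommGroup E'] [NormedSpace ℝ E']
    {H' : Type*} [TopologicalSpace H'] {I' : ModelWithCorners ℝ E' H'}
    {M' : Type*} [TopologicalSpace M'] [ChartedSpace H' M']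
    {k : ℕ} (f : M' → M) (μ : Form I M k) : Form I' M' k :=
  fun x => (μ (f x)).compContinuousLinearMap (mfderiv I' I f x)

variable (I M)

/-- The tautological `n`-form on `∧ⁿ T*M`: `(θ_M)_α = pr^* α`. -/
def tautologicalForm [IsManifold I ∞ M] (n : ℕ) : Form (formModel I n) (FormBundle I M n) n :=
  fun α => ContinuousAlternatingMap.compContinuousLinearMap
    (α.2 : TangentSpace I α.1 [⋀^Fin n]→L[ℝ] ℝ)
    (mfderiv (formModel I n) I (TotalSpace.proj : FormBundle I M n → M) α)

/-- The canonical `(n+1)`-form `ω_M = dθ_M` on `∧ⁿ T*M`. -/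
def canonicalForm [IsManifold I ∞ M] (n : ℕ) :
    Form (formModel I n) (FormBundle I M n) (n + 1) :=
  extD (tautologicalForm I M n)

end Forms

/-! ### Distributions and (pre-)`n`-contact structures -/

section Distributions

variable {E : Type*} [NormedAddCommGroup E] [NormedSpace ℝ E]
  {M : Type*} [TopologicalSpace M] [ChartedSpace E M] [IsManifold 𝓘(ℝ, E) ∞ M]

/-- `X ∈ Γ(C)`: `X` is a smooth vector field on `M` with values in `C`. -/
structure IsSection (C : ∀ x : M, Submodule ℝ (TangentSpace 𝓘(ℝ, E) x))
    (X : ∀ x : M, TangentSpace 𝓘(ℝ, E) x) : Prop where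
  smooth : ContMDiff 𝓘(ℝ, E) 𝓘(ℝ, E).tangent ∞ (fun x => (⟨x, X x⟩ : TangentBundle 𝓘(ℝ, E) M))
  mem : ∀ x, X x ∈ C x

/-- `C` is an `n`-codimensional (regular) distribution: a linear subbundle of `TM`, given locally
by smooth frames, whose fibers have codimension `n`. -/
structure IsDistribution (n : ℕ) (C : ∀ x : M, Submodule ℝ (TangentSpace 𝓘(ℝ, E) x)) : Prop where
  codim : ∀ x, Module.finrank ℝ (TangentSpace 𝓘(ℝ, E) x ⧸ C x) = n
  exists_frame : ∀ x, ∃ U : Set M, IsOpen U ∧ x ∈ U ∧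
    ∃ (k : ℕ) (X : Fin k → ∀ y : M, TangentSpace 𝓘(ℝ, E) y),
      (∀ i, ContMDiffOn 𝓘(ℝ, E) 𝓘(ℝ, E).tangent ∞
        (fun y => (⟨y, X i y⟩ : TangentBundle 𝓘(ℝ, E) M)) U) ∧
      ∀ y ∈ U, LinearIndependent ℝ (fun i => X i y) ∧
        Submodule.span ℝ (range fun i => X i y) = C y

/-- The curvature `R(X, Y) = θ([X, Y])` of `C`, where `θ : TM → TM/C` is the projection. -/
def curvature (C : ∀ x : M, Submodule ℝ (TangentSpace 𝓘(ℝ, E) x))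
    (X Y : ∀ x : M, TangentSpace 𝓘(ℝ, E) x) (x : M) : TangentSpace 𝓘(ℝ, E) x ⧸ C x :=
  (C x).mkQ (mlieBracket 𝓘(ℝ, E) X Y x)

variable [FiniteDimensional ℝ E]

/-- The characteristic distribution `D` of `C`: the vectors `ζ ∈ C_x` with `R(ζ, -) = 0`.
Since `R` is `C^∞(M)`-bilinear on `Γ(C)`, `R(ζ, -)` is computed by extending `ζ` to a section. -/
def characteristic (C : ∀ x : M, Submodule ℝ (TangentSpace 𝓘(ℝ, E) x)) (x : M) :
    Submodule ℝ (TangentSpace 𝓘(ℝ, E) x) where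
  carrier := {ζ | ∃ X, IsSection C X ∧ X x = ζ ∧ ∀ Y, IsSection C Y → curvature C X Y x = 0}
  zero_mem' := by
    refine ⟨0, ⟨?_, fun x => (C x).zero_mem⟩, rfl, fun Y _ => ?_⟩
    · exact Bundle.contMDiff_zeroSection ℝ (TangentSpace 𝓘(ℝ, E))
    · simp [curvature]
  add_mem' := by
    rintro _ _ ⟨X, hX, rfl, hX'⟩ ⟨X₁, hX₁, rfl, hX₁'⟩
    refine ⟨X + X₁, ⟨hX.smooth.add_section hX₁.smooth,
      fun y => (C y).add_mem (hX.mem y) (hX₁.mem y)⟩, rfl, fun Y hY => ?_⟩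
    have h := hX' Y hY
    have h₁ := hX₁' Y hY
    simp only [curvature] at h h₁ ⊢
    rw [mlieBracket_add_left ((hX.smooth x).mdifferentiableAt (by simp))
      ((hX₁.smooth x).mdifferentiableAt (by simp)), map_add, h, h₁, add_zero]
  smul_mem' := by
    rintro c _ ⟨X, hX, rfl, hX'⟩
    refine ⟨c • X, ⟨hX.smooth.const_smul_section,
      fun y => (C y).smul_mem c (hX.mem y)⟩, rfl, fun Y hY => ?_⟩
    have h := hX' Y hY
    simp only [curvature] at h ⊢
    rw [mlieBracket_const_smul_left ((hX.smooth x).mdifferentiableAt (by simp)), map_smul, h,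
      smul_zero]

/-- A pre-`n`-contact structure: an `n`-codimensional distribution whose characteristic
distribution has constant dimension. -/
structure IsPreContact (n : ℕ) (C : ∀ x : M, Submodule ℝ (TangentSpace 𝓘(ℝ, E) x)) : Prop
    extends IsDistribution n C where
  char_const : ∃ r : ℕ, ∀ x, Module.finrank ℝ (characteristic C x) = r

/-- An `n`-contact structure: a pre-`n`-contact structure with `D = 0`. -/
structure IsContact (n : ℕ) (C : ∀ x : M, Submodule ℝ (TangentSpace 𝓘(ℝ, E) x)) : Prop
    extends IsPreContact n C where
  char_eq_bot : ∀ x, characteristic C x = ⊥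

end Distributions

/-! ### The (pre-)multisymplectization -/

section Multisymplectization

variable {E : Type*} [NormedAddCommGroup E] [NormedSpace ℝ E] [FiniteDimensional ℝ E]
  {M : Type*} [TopologicalSpace M] [ChartedSpace E M] [IsManifold 𝓘(ℝ, E) ∞ M]

/-- The subset `M̃ = ∧ⁿ C⁰ ∖ 0` of `∧ⁿ T*M`: the nonzero `n`-forms `α` on the spaces `T_x M` which
vanish as soon as one of their arguments is in `C_x`. -/
def tildeSet (n : ℕ) (C : ∀ x : M, Submodule ℝ (TangentSpace 𝓘(ℝ, E) x)) :
    Set (FormBundle 𝓘(ℝ, E) M n) :=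
  {α | α.2 ≠ 0 ∧
    ∀ v : Fin n → TangentSpace 𝓘(ℝ, E) α.1, (∃ i, v i ∈ C α.1) → α.2 v = 0}

/-- The space `M̃`, with the topology induced by `∧ⁿ T*M`. -/
abbrev Tilde (n : ℕ) (C : ∀ x : M, Submodule ℝ (TangentSpace 𝓘(ℝ, E) x)) : Type _ :=
  ↥(tildeSet n C)

variable {n : ℕ} {C : ∀ x : M, Submodule ℝ (TangentSpace 𝓘(ℝ, E) x)}

/-- The inclusion `M̃ → ∧ⁿ T*M`. -/
def tildeIncl (n : ℕ) (C : ∀ x : M, Submodule ℝ (TangentSpace 𝓘(ℝ, E) x)) :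
    Tilde n C → FormBundle 𝓘(ℝ, E) M n :=
  Subtype.val

/-- The projection `π : M̃ → M`. -/
def tildeProj (α : Tilde n C) : M := α.1.1

variable [ChartedSpace (E × ℝ) (Tilde n C)]

variable (n C) in
/-- The restriction `ω̃` of the canonical form `ω_M` to `M̃`. -/
def tildeForm : Form 𝓘(ℝ, E × ℝ) (Tilde n C) (n + 1) :=
  formPullback (tildeIncl n C) (canonicalForm 𝓘(ℝ, E) M n)

/-- `σ` is, over the open set `U`, a smooth section of `M̃ → M` which is `D`-flat: when regarded as
an `n`-form `A` on `U`, it satisfies `L_Z A = 0` for all `Z ∈ Γ(D)`. (The values of `σ` and `A`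
outside `U` are irrelevant.) -/
structure IsFlatSection (U : Set M) (A : Form 𝓘(ℝ, E) M n) (σ : M → Tilde n C) : Prop where
  isOpen : IsOpen U
  eq_form : ∀ x ∈ U, tildeIncl n C (σ x) = ⟨x, A x⟩
  smooth : ContMDiffOn 𝓘(ℝ, E) 𝓘(ℝ, E × ℝ) ∞ σ U
  flat : ∀ Z, IsSection (characteristic C) Z → ∀ x ∈ U, lieDeriv Z A x = 0

/-- `σ` is a `D`-flat section of `M̃`, locally defined around `π(α)`, with `σ (π α) = α`. -/
def IsFlatSectionThrough (α : Tilde n C) (σ : M → Tilde n C) : Prop :=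
  (∃ U A, IsFlatSection U A σ ∧ tildeProj α ∈ U) ∧ σ (tildeProj α) = α

/-- The subset `σ_*(D_x)` of `T_α M̃`, where `x = π(α)` and `σ x = α`. -/
def pushforward (α : Tilde n C) (σ : M → Tilde n C) : Set (TangentSpace 𝓘(ℝ, E × ℝ) α) :=
  {η | ∃ ζ ∈ characteristic C (tildeProj α),
    tangentMap 𝓘(ℝ, E) 𝓘(ℝ, E × ℝ) σ ⟨tildeProj α, ζ⟩ = ⟨α, η⟩}

/-- The lift `D̃` of `D`: `D̃_α` consists of the vectors `σ_* ζ`, where `σ` is a `D`-flat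
section through `α` and `ζ ∈ D_{π(α)}`. -/
def tildeDistribution (α : Tilde n C) : Set (TangentSpace 𝓘(ℝ, E × ℝ) α) :=
  {η | ∃ σ, IsFlatSectionThrough α σ ∧ η ∈ pushforward α σ}

end Multisymplectization

end Multicontact

end

open Multicontact

namespace Multicontact

open Filter Topology

section Superposition

set_option synthInstance.maxHeartbeats 200000

universe u

variable {T : Type*} [TopologicalSpace T] [CompactSpace T]

/-- Pointwise evaluation of a continuous family of operators on a continuous family of vectors. -/
noncomputable def pointwiseApply (T : Type*) [TopologicalSpace T] [CompactSpace T]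
    (X Z : Type*) [NormedAddCommGroup X] [NormedSpace ℝ X]
    [NormedAddCommGroup Z] [NormedSpace ℝ Z] :
    C(T, X →L[ℝ] Z) →L[ℝ] C(T, X) →L[ℝ] C(T, Z) :=
  LinearMap.mkContinuous₂
    (LinearMap.mk₂ ℝ (fun (f : C(T, X →L[ℝ] Z)) (h : C(T, X)) =>
        (⟨fun t => f t (h t), f.continuous.clm_apply h.continuous⟩ : C(T, Z)))
      (fun f g h => by ext t; simp) (fun c f h => by ext t; simp)
      (fun f g h => by ext t; simp) (fun c f h => by ext t; simp)) 1
    (fun f h => by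
      rw [ContinuousMap.norm_le _ (by positivity)]
      intro t
      simp only [LinearMap.mk₂_apply, ContinuousMap.coe_mk, one_mul]
      exact ((f t).le_opNorm _).trans (mul_le_mul (f.norm_coe_le_norm t) (h.norm_coe_le_norm t)
        (norm_nonneg (h t)) (norm_nonneg f)))

@[simp]
theorem pointwiseApply_apply {X Z : Type*} [NormedAddCommGroup X] [NormedSpace ℝ X]
    [NormedAddCommGroup Z] [NormedSpace ℝ Z] (f : C(T, X →L[ℝ] Z)) (h : C(T, X)) (t : T) :
    pointwiseApply T X Z f h t = f t (h t) := rfl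

/-- The superposition operator `u ↦ g ∘ u` on continuous maps is differentiable when `g` is `C^1`. -/
theorem hasFDerivAt_superposition {X Z : Type*} [NormedAddCommGroup X] [NormedSpace ℝ X]
    [NormedAddCommGroup Z] [NormedSpace ℝ Z] (g : C(X, Z)) (g' : C(X, X →L[ℝ] Z))
    (hg : ∀ x, HasFDerivAt g (g' x) x) (u : C(T, X)) :
    HasFDerivAt (fun v : C(T, X) => g.comp v) (pointwiseApply T X Z (g'.comp u)) u := by
  rw [hasFDerivAt_iff_isLittleO_nhds_zero, Asymptotics.isLittleO_iff]
  intro ε hε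
  have hcont : ContinuousAt (fun v : C(T, X) => g'.comp v) u :=
    (ContinuousMap.continuous_postcomp g').continuousAt
  obtain ⟨δ, hδ, H⟩ := (Metric.continuousAt_iff (α := C(T, X)) (β := C(T, X →L[ℝ] Z))).1 hcont ε hε
  filter_upwards [Metric.ball_mem_nhds (0 : C(T, X)) hδ] with h hh
  rw [mem_ball_zero_iff] at hh
  rw [ContinuousMap.norm_le _ (by positivity)]
  intro t
  have key : ∀ x ∈ segment ℝ (u t) (u t + h t), ‖g' x - g' (u t)‖ ≤ ε := by
    intro x hx
    rw [segment_eq_image'] at hx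
    obtain ⟨s, ⟨hs0, hs1⟩, rfl⟩ := hx
    have h1 : dist (u + s • h) u < δ := by
      rw [dist_eq_norm, add_sub_cancel_left, norm_smul, Real.norm_of_nonneg hs0]
      calc s * ‖h‖ ≤ 1 * ‖h‖ := by gcongr
        _ < δ := by simpa using hh
    have h2 := H h1
    have h3 := (ContinuousMap.dist_apply_le_dist (f := g'.comp (u + s • h)) (g := g'.comp u) t).trans
      h2.le
    simpa [dist_eq_norm] using h3
  have := Convex.norm_image_sub_le_of_norm_hasFDerivWithin_le' (𝕜 := ℝ) (f := g) (f' := g')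
    (φ := g' (u t)) (C := ε) (s := segment ℝ (u t) (u t + h t)) (x := u t) (y := u t + h t)
    (fun x _ => (hg x).hasFDerivWithinAt) key (convex_segment _ _)
    (left_mem_segment _ _ _) (right_mem_segment _ _ _)
  simp only [add_sub_cancel_left] at this
  refine this.trans ?_
  gcongr
  exact h.norm_coe_le_norm t

theorem contDiff_superposition_nat {X : Type u} [NormedAddCommGroup X] [NormedSpace ℝ X] (n : ℕ) :
    ∀ {Z : Type u} [NormedAddCommGroup Z] [NormedSpace ℝ Z] (g : C(X, Z)), ContDiff ℝ n g →
      ContDiff ℝ n (fun v : C(T, X) => g.comp v) := by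
  induction n with
  | zero =>
    intro Z _ _ g _
    exact contDiff_zero.2 (ContinuousMap.continuous_postcomp g)
  | succ n ih =>
    intro Z _ _ g hg
    have hg' := contDiff_succ_iff_hasFDerivAt.1 (by exact_mod_cast hg)
    obtain ⟨g', hg', hd⟩ := hg'
    have := contDiff_succ_iff_hasFDerivAt (𝕜 := ℝ) (f := fun v : C(T, X) => g.comp v) (n := n)
    rw [show ((n + 1 : ℕ) : ℕ∞ω) = (n : ℕ∞ω) + 1 by norm_cast, this]
    exact ⟨fun u => pointwiseApply T X Z ((⟨g', hg'.continuous⟩ : C(X, X →L[ℝ] Z)).comp u),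
      (ContinuousLinearMap.contDiff _).comp (ih ⟨g', hg'.continuous⟩ hg'),
      fun u => hasFDerivAt_superposition g ⟨g', hg'.continuous⟩ hd u⟩

/-- The superposition operator `u ↦ g ∘ u` on continuous maps is smooth when `g` is. -/
theorem contDiff_superposition {X Z : Type u} [NormedAddCommGroup X] [NormedSpace ℝ X]
    [NormedAddCommGroup Z] [NormedSpace ℝ Z] (g : C(X, Z)) (hg : ContDiff ℝ ∞ g) :
    ContDiff ℝ ∞ (fun v : C(T, X) => g.comp v) :=
  contDiff_infty.2 fun n => contDiff_superposition_nat n g (contDiff_infty.1 hg n)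

end Superposition

section InverseFunction

variable {E₁ : Type*} [NormedAddCommGroup E₁] [NormedSpace ℝ E₁] [CompleteSpace E₁]
  {E₂ : Type*} [NormedAddCommGroup E₂] [NormedSpace ℝ E₂] [CompleteSpace E₂]
  {F : Type*} [NormedAddCommGroup F] [NormedSpace ℝ F] [CompleteSpace F]

theorem eventually_isInvertible {E₁ F : Type*} [NormedAddCommGroup E₁] [NormedSpace ℝ E₁]
    [CompleteSpace E₁] [NormedAddCommGroup F] [NormedSpace ℝ F] {Y : Type*} [TopologicalSpace Y] {L : Y → E₁ →L[ℝ] F} {y : Y}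
    (hL : ContinuousAt L y) (h : (L y).IsInvertible) : ∀ᶠ z in 𝓝 y, (L z).IsInvertible := by
  obtain ⟨e, he⟩ := h
  have := ContinuousLinearEquiv.nhds e
  rw [he] at this
  filter_upwards [hL this] with z ⟨e', he'⟩
  exact ⟨e', he'⟩

/-- The implicit function theorem, with the partial differential of the equation kept invertible and
the implicit function smooth at all points of a neighbourhood. -/
theorem exists_smooth_implicitFunction {f : E₁ × E₂ → F} {u : E₁ × E₂}
    (hf : ∀ᶠ v in 𝓝 u, ContDiffAt ℝ ∞ f v)
    (hinv : (fderiv ℝ f u ∘L .inr ℝ E₁ E₂).IsInvertible) :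
    ∃ ψ : E₁ → E₂, ψ u.1 = u.2 ∧ ∀ᶠ x in 𝓝 u.1, f (x, ψ x) = f u ∧ ContDiffAt ℝ ∞ ψ x ∧
      ContDiffAt ℝ ∞ f (x, ψ x) ∧ (fderiv ℝ f (x, ψ x) ∘L .inr ℝ E₁ E₂).IsInvertible := by
  have hu := hf.self_of_nhds
  have pn : (∞ : ℕ∞ω) ≠ 0 := by simp
  set ψ := hu.implicitFunction pn hinv with hψ
  have h0 : ψ u.1 = u.2 := hu.implicitFunction_apply_self pn hinv
  have hψd : ContDiffAt ℝ ∞ ψ u.1 := hu.contDiffAt_implicitFunction pn hinv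
  have hψ1 : ∀ᶠ x in 𝓝 u.1, ContinuousAt ψ x := by
    have := (hψd.of_le (m := 1) (by simp)).eventually (by simp)
    exact this.mono fun x hx => hx.continuousAt
  have hg : ContinuousAt (fun x => (x, ψ x)) u.1 := continuousAt_id.prodMk hψd.continuousAt
  have hgu : Tendsto (fun x => (x, ψ x)) (𝓝 u.1) (𝓝 u) := by
    have := hg.tendsto
    simpa [h0] using this
  have hinv' : ∀ᶠ v in 𝓝 u, (fderiv ℝ f v ∘L .inr ℝ E₁ E₂).IsInvertible := by
    refine eventually_isInvertible ?_ hinv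
    have : ContinuousAt (fderiv ℝ f) u := (hu.fderiv_right (m := 0) (by simp)).continuousAt
    exact this.clm_comp continuousAt_const
  have heq : ∀ᶠ x in 𝓝 u.1, f (x, ψ x) = f u := hu.eventually_apply_implicitFunction pn hinv
  refine ⟨ψ, h0, ?_⟩
  filter_upwards [heq.eventually_nhds, hψ1, hgu.eventually hf, hgu.eventually hinv'] with
    x hx1 hx2 hx3 hx4
  refine ⟨hx1.self_of_nhds, ?_, hx3, hx4⟩
  have hgx : Tendsto (fun y => (y, ψ y)) (𝓝 x) (𝓝 (x, ψ x)) :=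
    (continuousAt_id.prodMk hx2).tendsto
  have h1 := hgx.eventually (hx3.eventually_apply_eq_iff_implicitFunction pn hx4)
  have h2 : ψ =ᶠ[𝓝 x] hx3.implicitFunction pn hx4 := by
    filter_upwards [h1, hx1] with y hy hy'
    exact (hy.1 (hy'.trans hx1.self_of_nhds.symm)).symm
  exact (hx3.contDiffAt_implicitFunction pn hx4).congr_of_eventuallyEq h2

/-- The inverse function theorem, with the inverse smooth at all points of a neighbourhood. -/
theorem exists_smooth_localInverse {G : E₁ → F} {x₀ : E₁}
    (hG : ∀ᶠ v in 𝓝 x₀, ContDiffAt ℝ ∞ G v) (hinv : (fderiv ℝ G x₀).IsInvertible) :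
    ∃ g : F → E₁, g (G x₀) = x₀ ∧ ∀ᶠ y in 𝓝 (G x₀), G (g y) = y ∧ ContDiffAt ℝ ∞ g y ∧
      (fderiv ℝ G (g y)).IsInvertible := by
  have key : ∀ v : F × E₁, ContDiffAt ℝ ∞ G v.2 →
      HasFDerivAt (fun p : F × E₁ => G p.2 - p.1)
        (fderiv ℝ G v.2 ∘L .snd ℝ F E₁ - .fst ℝ F E₁) v := by
    intro v hv
    exact ((hv.differentiableAt (by simp)).hasFDerivAt.comp v hasFDerivAt_snd).sub hasFDerivAt_fst
  have key' : ∀ v : F × E₁, ContDiffAt ℝ ∞ G v.2 →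
      fderiv ℝ (fun p : F × E₁ => G p.2 - p.1) v ∘L .inr ℝ F E₁ = fderiv ℝ G v.2 := by
    intro v hv
    rw [(key v hv).fderiv]
    ext x
    simp
  have h1 : ∀ᶠ v in 𝓝 (G x₀, x₀), ContDiffAt ℝ ∞ G v.2 :=
    (continuous_snd.tendsto' (G x₀, x₀) x₀ rfl).eventually hG
  obtain ⟨g, hg0, hg⟩ := exists_smooth_implicitFunction (f := fun p : F × E₁ => G p.2 - p.1)
    (u := (G x₀, x₀)) (h1.mono fun v hv => (hv.comp v contDiffAt_snd).sub contDiffAt_fst)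
    (by rw [key' _ hG.self_of_nhds]; exact hinv)
  refine ⟨g, hg0, ?_⟩
  have hg1 : Tendsto g (𝓝 (G x₀)) (𝓝 x₀) := by
    have := hg.self_of_nhds.2.1.continuousAt.tendsto
    simpa [hg0] using this
  filter_upwards [hg, hg1.eventually hG] with y hy hy'
  refine ⟨by simpa [sub_eq_zero] using hy.1, hy.2.1, ?_⟩
  have := hy.2.2.2
  rwa [key' _ hy'] at this

end InverseFunction

section Flow

open scoped unitInterval

universe u

/-- The primitive, vanishing at `0`, of (the constant extension of) a curve on `[0, 1]`. -/
noncomputable def curvePrimitive {W : Type*} [NormedAddCommGroup W] [NormedSpace ℝ W]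
    (c : C(I, W)) (s : ℝ) : W :=
  ∫ τ in (0 : ℝ)..s, c (projIcc 0 1 zero_le_one τ)

theorem continuous_comp_projIcc {W : Type*} [NormedAddCommGroup W] (c : C(I, W)) :
    Continuous fun τ : ℝ => c (projIcc 0 1 zero_le_one τ) :=
  c.continuous.comp continuous_projIcc

theorem hasDerivAt_curvePrimitive {W : Type*} [NormedAddCommGroup W] [NormedSpace ℝ W]
    [CompleteSpace W] (c : C(I, W)) (s : ℝ) :
    HasDerivAt (curvePrimitive c) (c (projIcc 0 1 zero_le_one s)) s :=
  intervalIntegral.integral_hasDerivAt_right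
    ((continuous_comp_projIcc c).intervalIntegrable _ _)
    ((continuous_comp_projIcc c).stronglyMeasurableAtFilter _ _)
    (continuous_comp_projIcc c).continuousAt

/-- Integration of curves `t ↦ ∫₀ᵗ c` as a continuous linear operator on `C([0, 1], W)`. -/
noncomputable def curveIntegral (W : Type*) [NormedAddCommGroup W] [NormedSpace ℝ W]
    [CompleteSpace W] : C(I, W) →L[ℝ] C(I, W) :=
  LinearMap.mkContinuous
    { toFun := fun c => ⟨fun t => curvePrimitive c t,
        (continuous_iff_continuousAt.2 fun s => (hasDerivAt_curvePrimitive c s).continuousAt).comp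
          continuous_subtype_val⟩
      map_add' := fun c d => by
        ext t
        exact intervalIntegral.integral_add ((continuous_comp_projIcc c).intervalIntegrable _ _)
          ((continuous_comp_projIcc d).intervalIntegrable _ _)
      map_smul' := fun a c => by
        ext t
        exact intervalIntegral.integral_smul a _ } 1
    (fun c => by
      rw [ContinuousMap.norm_le _ (by positivity)]
      intro t
      have h := intervalIntegral.norm_integral_le_of_norm_le_const (a := (0 : ℝ)) (b := t)
        (f := fun τ => c (projIcc 0 1 zero_le_one τ)) (C := ‖c‖) (fun x _ => c.norm_coe_le_norm _)
      refine h.trans ?_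
      rw [sub_zero, abs_of_nonneg t.2.1, one_mul]
      exact mul_le_of_le_one_right (norm_nonneg _) t.2.2)

@[simp]
theorem curveIntegral_apply {W : Type*} [NormedAddCommGroup W] [NormedSpace ℝ W]
    [CompleteSpace W] (c : C(I, W)) (t : I) : curveIntegral W c t = curvePrimitive c t := rfl

/-- The curve `t ↦ (k, u t)`. -/
noncomputable def pairCurve (K W : Type*) [NormedAddCommGroup K] [NormedSpace ℝ K]
    [NormedAddCommGroup W] [NormedSpace ℝ W] : K × C(I, W) →L[ℝ] C(I, K × W) :=
  (ContinuousLinearMap.inl ℝ K W).compLeftContinuous ℝ I ∘L ContinuousLinearMap.const ℝ I ∘L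
      .fst ℝ K C(I, W) +
    (ContinuousLinearMap.inr ℝ K W).compLeftContinuous ℝ I ∘L .snd ℝ K C(I, W)

@[simp]
theorem pairCurve_apply {K W : Type*} [NormedAddCommGroup K] [NormedSpace ℝ K]
    [NormedAddCommGroup W] [NormedSpace ℝ W] (p : K × C(I, W)) (t : I) :
    pairCurve K W p t = (p.1, p.2 t) := by
  simp [pairCurve]

/-- The joint flow `Φ (k, w)` at time one of the vector fields `S k`, `k ∈ K`, which are assumed to
commute near `w₀`: its differential in the direction of `κ ∈ K` is the vector field `S κ`. -/
theorem exists_commuting_flow_of_contDiff {K W : Type u} [NormedAddCommGroup K] [NormedSpace ℝ K]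
    [CompleteSpace K] [NormedAddCommGroup W] [NormedSpace ℝ W] [CompleteSpace W]
    {S : W → K →L[ℝ] W} (hS : ContDiff ℝ ∞ S) (w₀ : W)
    (hcomm : ∀ᶠ w in 𝓝 w₀, ∀ k κ, fderiv ℝ S w (S w k) κ = fderiv ℝ S w (S w κ) k) :
    ∃ Φ : K × W → W, (∀ᶠ w in 𝓝 w₀, Φ (0, w) = w) ∧
      ∀ᶠ p in 𝓝 ((0 : K), w₀), ContDiffAt ℝ ∞ Φ p ∧ ∀ κ, fderiv ℝ Φ p (κ, 0) = S (Φ p) κ := by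
  have hSd : ∀ w, HasFDerivAt S (fderiv ℝ S w) w := fun w =>
    (hS.differentiable (by simp) w).hasFDerivAt
  have hg0 : ContDiff ℝ ∞ (fun p : K × W => S p.2 p.1) :=
    (hS.comp contDiff_snd).clm_apply contDiff_fst
  set g : C(K × W, W) := ⟨fun p => S p.2 p.1, hg0.continuous⟩ with hg
  set g' : C(K × W, K × W →L[ℝ] W) := ⟨fderiv ℝ g, hg0.continuous_fderiv (by simp)⟩ with hg'
  have hgd : ∀ p, HasFDerivAt g (g' p) p := fun p =>
    (hg0.differentiable (by simp) p).hasFDerivAt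
  have hg'v : ∀ k w κ η, g' (k, w) (κ, η) = S w κ + fderiv ℝ S w η k := by
    intro k w κ η
    have h1 : HasFDerivAt g _ (k, w) :=
      HasFDerivAt.clm_apply ((hSd w).comp (k, w) (hasFDerivAt_snd (𝕜 := ℝ) (p := (k, w))))
        (hasFDerivAt_fst (𝕜 := ℝ) (p := (k, w)))
    rw [(hgd (k, w)).unique h1]
    simp
  set F : (K × W) × C(I, W) → C(I, W) := fun q =>
    q.2 - ContinuousLinearMap.const ℝ I q.1.2 -
      curveIntegral W (g.comp (pairCurve K W (q.1.1, q.2))) with hF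
  set P : (K × W) × C(I, W) →L[ℝ] K × C(I, W) :=
    (.fst ℝ K W ∘L .fst ℝ (K × W) C(I, W)).prod (.snd ℝ (K × W) C(I, W)) with hP
  set F' : (K × W) × C(I, W) → (K × W) × C(I, W) →L[ℝ] C(I, W) := fun q =>
    .snd ℝ (K × W) C(I, W) - ContinuousLinearMap.const ℝ I ∘L .snd ℝ K W ∘L
      .fst ℝ (K × W) C(I, W) - curveIntegral W ∘L
      (pointwiseApply I (K × W) W (g'.comp (pairCurve K W (q.1.1, q.2)))) ∘L pairCurve K W ∘L P
    with hF'
  have hFsmooth : ContDiff ℝ ∞ F := by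
    have h1 : ContDiff ℝ ∞ fun q : (K × W) × C(I, W) => g.comp (pairCurve K W (P q)) :=
      (contDiff_superposition g hg0).comp ((pairCurve K W).contDiff.comp P.contDiff)
    exact (contDiff_snd.sub ((ContinuousLinearMap.contDiff _).comp
      (contDiff_snd.comp contDiff_fst))).sub ((curveIntegral W).contDiff.comp h1)
  have hFd : ∀ q, HasFDerivAt F (F' q) q := by
    intro q
    have h1 : HasFDerivAt (fun q : (K × W) × C(I, W) => g.comp (pairCurve K W (P q)))
        (pointwiseApply I (K × W) W (g'.comp (pairCurve K W (P q))) ∘L pairCurve K W ∘L P) q :=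
      HasFDerivAt.comp (g := fun c : C(I, K × W) => g.comp c) q
        (hasFDerivAt_superposition g g' hgd (pairCurve K W (P q)))
        ((pairCurve K W).hasFDerivAt.comp q P.hasFDerivAt)
    exact (hasFDerivAt_snd.sub ((ContinuousLinearMap.hasFDerivAt _).comp q
      (hasFDerivAt_snd.comp q hasFDerivAt_fst))).sub ((curveIntegral W).hasFDerivAt.comp q h1)
  have hgzero : ∀ u : C(I, W), g.comp (pairCurve K W (0, u)) = 0 := by
    intro u; ext t; simp [hg]
  set u₀ : C(I, W) := ContinuousLinearMap.const ℝ I w₀ with hu₀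
  have hF0 : F ((0, w₀), u₀) = 0 := by simp [hF, hgzero, hu₀]
  have hinv : (fderiv ℝ F ((0, w₀), u₀) ∘L .inr ℝ (K × W) C(I, W)).IsInvertible := by
    have : fderiv ℝ F ((0, w₀), u₀) ∘L .inr ℝ (K × W) C(I, W) =
        ContinuousLinearMap.id ℝ C(I, W) := by
      have h1 : HasFDerivAt (fun u : C(I, W) => F ((0, w₀), u))
          (F' ((0, w₀), u₀) ∘L .inr ℝ (K × W) C(I, W)) u₀ :=
        (hFd ((0, w₀), u₀)).comp u₀ (hasFDerivAt_prodMk_right _ _)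
      have h2 : (fun u : C(I, W) => F ((0, w₀), u)) =
          fun u => u - ContinuousLinearMap.const ℝ I w₀ := by
        funext u; simp [hF, hgzero]
      rw [h2] at h1
      rw [(hFd _).fderiv]
      exact h1.unique ((hasFDerivAt_id u₀).sub_const _)
    rw [this]
    exact ⟨.refl ℝ _, rfl⟩
  obtain ⟨ψ, hψ0, hψ⟩ := exists_smooth_implicitFunction (f := F) (u := ((0, w₀), u₀))
    (.of_forall fun v => hFsmooth.contDiffAt) hinv
  simp only at hψ0 hψ
  rw [hF0] at hψ
  refine ⟨fun p => ψ p 1, ?_, ?_⟩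
  · have : Tendsto (fun w : W => ((0 : K), w)) (𝓝 w₀) (𝓝 (0, w₀)) :=
      (Continuous.prodMk_right (0 : K)).tendsto _
    filter_upwards [this.eventually hψ] with w hw
    have h1 := hw.1
    simp only [hF, hgzero, map_zero, sub_zero, sub_eq_zero] at h1
    rw [h1]
    rfl
  · have hcont : ContinuousAt ψ (0, w₀) := hψ.self_of_nhds.2.1.continuousAt
    have hnear : ∀ᶠ p in 𝓝 ((0 : K), w₀), ∀ t : I, ∀ k κ,
        fderiv ℝ S (ψ p t) (S (ψ p t) k) κ = fderiv ℝ S (ψ p t) (S (ψ p t) κ) k := by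
      obtain ⟨δ, hδ, H⟩ := Metric.eventually_nhds_iff.1 hcomm
      have : Tendsto ψ (𝓝 (0, w₀)) (𝓝 u₀) := by simpa [hψ0] using hcont.tendsto
      filter_upwards [this.eventually (Metric.ball_mem_nhds u₀ hδ)] with p hp t
      refine H (y := ψ p t) ?_
      exact (ContinuousMap.dist_apply_le_dist (f := ψ p) (g := u₀) t).trans_lt hp
    filter_upwards [hψ.eventually_nhds, hnear] with p hp hpc
    obtain ⟨h1, h2, -, h3⟩ := hp.self_of_nhds
    have h4 : ContDiffAt ℝ ∞ (ContinuousMap.evalCLM (M := W) ℝ (1 : I) ∘ ψ) p :=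
      (ContinuousMap.evalCLM (M := W) ℝ (1 : I)).contDiff.contDiffAt.comp p h2
    refine ⟨h4, fun κ => ?_⟩
    have hψp := (h2.differentiableAt (by simp)).hasFDerivAt
    have hΦ : HasFDerivAt (fun p => ψ p 1)
        ((ContinuousMap.evalCLM ℝ (1 : I)) ∘L fderiv ℝ ψ p) p :=
      (ContinuousMap.evalCLM (M := W) ℝ (1 : I)).hasFDerivAt.comp p hψp
    rw [hΦ.fderiv]
    simp only [ContinuousLinearMap.comp_apply]
    set u := ψ p with hu
    set v := fderiv ℝ ψ p (κ, 0) with hv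
    set L := pointwiseApply I (K × W) W (g'.comp (pairCurve K W (p.1, u))) with hL
    have hLt : ∀ (a : K) (b : C(I, W)) (t : I), L (pairCurve K W (a, b)) t =
        S (u t) a + fderiv ℝ S (u t) (b t) p.1 := by
      intro a b t; simp [hL, hg'v]
    have hv1 : v - curveIntegral W (L (pairCurve K W (κ, v))) = 0 := by
      have e1 : HasFDerivAt (fun q => F (q, ψ q))
          (F' (p, u) ∘L (ContinuousLinearMap.id ℝ (K × W)).prod (fderiv ℝ ψ p)) p :=
        (hFd (p, u)).comp p ((hasFDerivAt_id p).prodMk hψp)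
      have e2 : (fun q => F (q, ψ q)) =ᶠ[𝓝 p] fun _ => 0 := hp.mono fun q hq => hq.1
      have e3 := e1.unique ((hasFDerivAt_const (0 : C(I, W)) p).congr_of_eventuallyEq e2)
      have e4 := DFunLike.congr_fun e3 (κ, 0)
      simpa [hF', hP] using e4
    set w : C(I, W) := ⟨fun t => (t : ℝ) • S (u t) κ,
      continuous_subtype_val.smul ((hS.continuous.comp u.continuous).clm_apply continuous_const)⟩
      with hw
    have hw1 : w - curveIntegral W (L (pairCurve K W (κ, w))) = 0 := by
      set c := g.comp (pairCurve K W (p.1, u)) with hc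
      have hct : ∀ t, c t = S (u t) p.1 := by intro t; simp [hc, hg]
      set U : ℝ → W := fun s => p.2 + curvePrimitive c s with hU
      have hUd : ∀ s, HasDerivAt U (c (projIcc 0 1 zero_le_one s)) s := fun s =>
        (hasDerivAt_curvePrimitive c s).const_add _
      have hUu : ∀ t : I, U t = u t := by
        intro t
        have := DFunLike.congr_fun h1 t
        simp only [hF, ContinuousMap.sub_apply, ContinuousMap.zero_apply, sub_eq_zero] at this
        have e : u t - p.2 = curvePrimitive c t := this
        simp only [hU]
        rw [← e, add_sub_cancel]
      set d := L (pairCurve K W (κ, w)) with hd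
      have hder : ∀ s : ℝ, s ∈ Icc (0 : ℝ) 1 →
          HasDerivAt (fun s => s • S (U s) κ) (d (projIcc 0 1 zero_le_one s)) s := by
        intro s hs
        have a1 : HasDerivAt (fun s => S (U s) κ)
            (fderiv ℝ S (U s) (c (projIcc 0 1 zero_le_one s)) κ) s := by
          have := ((hSd (U s)).comp_hasDerivAt s (hUd s)).clm_apply (hasDerivAt_const s κ)
          simpa using this
        have a2 := (hasDerivAt_id s).smul a1
        refine a2.congr_deriv ?_
        rw [projIcc_of_mem zero_le_one hs]
        have e := hUu ⟨s, hs⟩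
        simp only at e
        rw [e, hct, hpc ⟨s, hs⟩, hd, hLt]
        simp [hw, add_comm]
      rw [sub_eq_zero]
      ext t
      have hint : ∫ s in (0 : ℝ)..t, d (projIcc 0 1 zero_le_one s) =
          (t : ℝ) • S (U t) κ - (0 : ℝ) • S (U 0) κ := by
        refine intervalIntegral.integral_eq_sub_of_hasDerivAt (f := fun s => s • S (U s) κ) ?_
          ((continuous_comp_projIcc d).intervalIntegrable _ _)
        intro s hs
        rw [uIcc_of_le t.2.1] at hs
        exact hder s ⟨hs.1, hs.2.trans t.2.2⟩
      rw [zero_smul, sub_zero, hUu] at hint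
      rw [curveIntegral_apply, curvePrimitive, hint]
      rfl
    have hz : (fderiv ℝ F (p, u) ∘L .inr ℝ (K × W) C(I, W)) (v - w) = 0 := by
      rw [(hFd _).fderiv]
      have e : pairCurve K W (0, v - w) = pairCurve K W (κ, v) - pairCurve K W (κ, w) := by
        rw [← map_sub]; simp
      have : (v - w) - curveIntegral W (L (pairCurve K W (0, v - w))) = 0 := by
        rw [e, map_sub, map_sub, ← sub_eq_zero.1 hv1, ← sub_eq_zero.1 hw1, sub_self]
      simpa [hF', hP] using this
    have hvw : v = w := sub_eq_zero.1 ((injective_iff_map_eq_zero _).1 h3.bijective.1 _ hz)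
    rw [hvw]
    simp [hw]

/-- A smooth function germ has a globally smooth representative. -/
theorem exists_contDiff_eventuallyEq {W Z : Type*} [NormedAddCommGroup W] [NormedSpace ℝ W]
    [FiniteDimensional ℝ W] [NormedAddCommGroup Z] [NormedSpace ℝ Z] {f : W → Z} {w₀ : W}
    (hf : ∀ᶠ w in 𝓝 w₀, ContDiffAt ℝ ∞ f w) :
    ∃ g : W → Z, ContDiff ℝ ∞ g ∧ g =ᶠ[𝓝 w₀] f := by
  obtain ⟨r, hr, H⟩ := Metric.eventually_nhds_iff.1 hf
  let b : ContDiffBump w₀ := ⟨r / 3, r / 2, by positivity, by linarith⟩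
  refine ⟨fun w => b w • f w, ?_, ?_⟩
  · rw [contDiff_iff_contDiffAt]
    intro w
    by_cases hw : dist w w₀ < r
    · exact b.contDiff.contDiffAt.smul (H hw)
    · have hw' : w ∉ tsupport b := by
        rw [b.tsupport_eq]
        simp only [Metric.mem_closedBall, not_le]
        change r / 2 < _
        linarith
      have : (fun w => b w • f w) =ᶠ[𝓝 w] fun _ => 0 := by
        filter_upwards [notMem_tsupport_iff_eventuallyEq.1 hw'] with y hy
        rw [hy]
        simp
      exact contDiffAt_const.congr_of_eventuallyEq this
  · filter_upwards [b.eventuallyEq_one] with w hw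
    rw [hw]
    simp

/-- The joint flow of vector fields which are defined and commute near `w₀`. -/
theorem exists_commuting_flow {K W : Type u} [NormedAddCommGroup K] [NormedSpace ℝ K]
    [CompleteSpace K] [NormedAddCommGroup W] [NormedSpace ℝ W] [FiniteDimensional ℝ W]
    {S : W → K →L[ℝ] W} {w₀ : W} (hS : ∀ᶠ w in 𝓝 w₀, ContDiffAt ℝ ∞ S w)
    (hcomm : ∀ᶠ w in 𝓝 w₀, ∀ k κ, fderiv ℝ S w (S w k) κ = fderiv ℝ S w (S w κ) k) :
    ∃ Φ : K × W → W, (∀ᶠ w in 𝓝 w₀, Φ (0, w) = w) ∧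
      ∀ᶠ p in 𝓝 ((0 : K), w₀), ContDiffAt ℝ ∞ Φ p ∧ ∀ κ, fderiv ℝ Φ p (κ, 0) = S (Φ p) κ := by
  have : CompleteSpace W := FiniteDimensional.complete ℝ W
  obtain ⟨S', hS', hSS'⟩ := exists_contDiff_eventuallyEq hS
  obtain ⟨Φ, h0, h⟩ := exists_commuting_flow_of_contDiff hS' w₀ (by
    filter_upwards [hcomm, hSS'.eventuallyEq_nhds] with w hw hw'
    rw [hw'.fderiv_eq, hw'.self_of_nhds]
    exact hw)
  refine ⟨Φ, h0, ?_⟩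
  have hΦ : Tendsto Φ (𝓝 (0, w₀)) (𝓝 w₀) := by
    have := h.self_of_nhds.1.continuousAt.tendsto
    rwa [h0.self_of_nhds] at this
  filter_upwards [h, hΦ.eventually hSS'] with p hp hp'
  refine ⟨hp.1, fun κ => ?_⟩
  rw [hp.2, hp']

end Flow

section Kernel

/-- The kernels of a smooth family of operators, if of constant dimension near `y₀`, are the ranges
of a smooth family of injective operators, normalised by a projection to the kernel at `y₀`. -/
theorem exists_smooth_kernel_frame {Y V Z : Type*} [NormedAddCommGroup Y] [NormedSpace ℝ Y]
    [NormedAddCommGroup V] [NormedSpace ℝ V] [FiniteDimensional ℝ V]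
    [NormedAddCommGroup Z] [NormedSpace ℝ Z] {L : Y → V →L[ℝ] Z} {y₀ : Y}
    {K : Submodule ℝ V} (hK : LinearMap.ker (L y₀ : V →ₗ[ℝ] Z) = K)
    (hL : ∀ᶠ y in 𝓝 y₀, ContDiffAt ℝ ∞ L y)
    (hr : ∀ᶠ y in 𝓝 y₀, Module.finrank ℝ (LinearMap.ker (L y : V →ₗ[ℝ] Z)) =
      Module.finrank ℝ K) :
    ∃ (P : V →L[ℝ] K) (S : Y → K →L[ℝ] V), (∀ k : K, P (k : V) = k) ∧ (∀ k, S y₀ k = k) ∧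
      ∀ᶠ y in 𝓝 y₀, ContDiffAt ℝ ∞ S y ∧ (∀ k, P (S y k) = k) ∧ (∀ k, L y (S y k) = 0) ∧
        ∀ v, L y v = 0 → S y (P v) = v := by
  have hKm : ∀ v, L y₀ v = 0 → v ∈ K := fun v hv => by rw [← hK]; exact hv
  have hKm' : ∀ v : K, L y₀ v = 0 := fun v => hK.ge v.2
  set R := LinearMap.range (L y₀ : V →ₗ[ℝ] Z) with hR
  have : CompleteSpace V := FiniteDimensional.complete ℝ V
  obtain ⟨P, hP⟩ : K.ClosedComplemented := .of_finiteDimensional K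
  obtain ⟨Q, hQ⟩ : R.ClosedComplemented := .of_finiteDimensional R
  set T : Y → V →L[ℝ] K × R := fun y => P.prod (Q ∘L L y) with hT
  have hT0 : (T y₀).IsInvertible := by
    have hinj : Function.Injective (T y₀ : V →ₗ[ℝ] K × R) := by
      refine (injective_iff_map_eq_zero _).2 fun v hv => ?_
      have h1 : P v = 0 := congrArg Prod.fst hv
      have h2 : Q (L y₀ v) = 0 := congrArg Prod.snd hv
      have h3 : Q (L y₀ v) = ⟨L y₀ v, v, rfl⟩ := hQ ⟨L y₀ v, v, rfl⟩
      have h4 : L y₀ v = 0 := by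
        rw [h2] at h3
        exact (congrArg Subtype.val h3).symm
      have h5 : P v = ⟨v, hKm v h4⟩ := hP ⟨v, hKm v h4⟩
      rw [h1] at h5
      exact (congrArg Subtype.val h5).symm
    have hdim : Module.finrank ℝ V = Module.finrank ℝ (K × R) := by
      rw [Module.finrank_prod, add_comm, ← hK]
      exact (LinearMap.finrank_range_add_finrank_ker (L y₀ : V →ₗ[ℝ] Z)).symm
    refine ⟨(LinearMap.linearEquivOfInjective _ hinj hdim).toContinuousLinearEquiv, ?_⟩
    ext v <;> rfl
  have hTs : ∀ᶠ y in 𝓝 y₀, ContDiffAt ℝ ∞ T y := by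
    filter_upwards [hL] with y hy
    have h1 : ContDiffAt ℝ ∞ (fun y => Q ∘L L y) y := contDiffAt_const.clm_comp hy
    have h2 : T = fun y => (ContinuousLinearMap.inl ℝ K R ∘L P) +
        (ContinuousLinearMap.inr ℝ K R ∘L (Q ∘L L y)) := by
      funext y; ext v <;> simp [hT]
    rw [h2]
    exact contDiffAt_const.add (contDiffAt_const.clm_comp h1)
  have hTi : ∀ᶠ y in 𝓝 y₀, (T y).IsInvertible :=
    eventually_isInvertible hTs.self_of_nhds.continuousAt hT0
  refine ⟨P, fun y => (T y).inverse ∘L .inl ℝ K R, hP, fun k => ?_, ?_⟩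
  · simp only [ContinuousLinearMap.comp_apply, ContinuousLinearMap.inl_apply]
    rw [hT0.inverse_apply_eq]
    simp [hT, hP, hKm']
  · filter_upwards [hTs, hTi, hr] with y h1 h2 h3
    have e1 : ∀ k : K, T y ((T y).inverse (k, 0)) = (k, 0) := fun k => h2.self_apply_inverse _
    have e2 : ∀ v, L y v = 0 → (T y).inverse (P v, 0) = v := by
      intro v hv
      rw [h2.inverse_apply_eq]
      simp [hT, hv]
    refine ⟨(h2.contDiffAt_map_inverse.comp y h1).clm_comp contDiffAt_const,
      fun k => congrArg Prod.fst (e1 k), fun k => ?_, e2⟩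
    set p : LinearMap.ker (L y : V →ₗ[ℝ] Z) →ₗ[ℝ] K :=
      (P : V →ₗ[ℝ] K) ∘ₗ (LinearMap.ker (L y : V →ₗ[ℝ] Z)).subtype with hp
    have hpi : Function.Injective p := by
      refine (injective_iff_map_eq_zero _).2 fun v hv => ?_
      have h4 := e2 v v.2
      have h5 : P (v : V) = 0 := hv
      rw [h5, Prod.mk_zero_zero, map_zero] at h4
      exact Subtype.ext h4.symm
    obtain ⟨v, rfl⟩ := (LinearMap.injective_iff_surjective_of_finrank_eq_finrank h3).1 hpi k
    have h6 : (T y).inverse (p v, 0) = v := e2 v v.2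
    simp only [ContinuousLinearMap.comp_apply, ContinuousLinearMap.inl_apply]
    rw [h6]
    exact v.2

end Kernel

section Bracket

variable {E : Type*} [NormedAddCommGroup E] [NormedSpace ℝ E]

theorem removeNth_succ_vecCons {α : Type*} {k : ℕ} (a : α) (v : Fin (k + 1) → α)
    (i : Fin (k + 1)) :
    (i.succ.removeNth (Matrix.vecCons a v) : Fin (k + 1) → α) =
      Matrix.vecCons a (i.removeNth v : Fin k → α) := by
  ext j
  refine Fin.cases ?_ (fun j => ?_) j
  · simp [Fin.removeNth]
  · simp [Fin.removeNth, Fin.succ_succAbove_succ]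

theorem removeNth_zero_vecCons {α : Type*} {k : ℕ} (a : α) (v : Fin k → α) :
    ((0 : Fin (k + 1)).removeNth (Matrix.vecCons a v) : Fin k → α) = v := by
  ext j
  simp [Fin.removeNth]

/-- If `i_X Ω = 0` near `x`, then `(D_u Ω) (X, v) = - Ω (D_u X, v)`. -/
theorem fderiv_apply_vecCons_of_insertion_eq_zero {k : ℕ} {Ω : E → E [⋀^Fin (k + 1)]→L[ℝ] ℝ}
    {X : E → E} {x : E} (hΩ : DifferentiableAt ℝ Ω x) (hX : DifferentiableAt ℝ X x)
    (h : ∀ᶠ y in 𝓝 x, ∀ v, Ω y (Matrix.vecCons (X y) v) = 0) (u : E) (v : Fin k → E) :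
    fderiv ℝ Ω x u (Matrix.vecCons (X x) v) = - Ω x (Matrix.vecCons (fderiv ℝ X x u) v) := by
  set g : Fin (k + 1) → E → E := Fin.cons X (fun j _ => v j) with hg
  have hgv : ∀ y, (fun i => g i y) = Matrix.vecCons (X y) v := by
    intro y; ext i
    refine Fin.cases ?_ (fun j => ?_) i <;> simp [hg]
  have hgd : ∀ i, DifferentiableAt ℝ (g i) x := by
    intro i
    refine Fin.cases ?_ (fun j => ?_) i
    · simpa [hg] using hX
    · simp [hg]
  have h1 := fderiv_continuousAlternatingMap_apply_apply hΩ hgd u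
  have h2 : (fun y => Ω y (fun i => g i y)) =ᶠ[𝓝 x] fun _ => 0 :=
    h.mono fun y hy => by simp only [hgv, hy]
  rw [h2.fderiv_eq, hgv, Fin.sum_univ_succ] at h1
  have h3 : ∑ i : Fin k, Ω x (Function.update (Matrix.vecCons (X x) v) i.succ
      (fderiv ℝ (g i.succ) x u)) = 0 := by
    refine Finset.sum_eq_zero fun i _ => ?_
    refine (Ω x).map_coord_zero i.succ ?_
    simp [hg]
  rw [h3] at h1
  have h4 : Function.update (Matrix.vecCons (X x) v) 0 (fderiv ℝ (g 0) x u) =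
      Matrix.vecCons (fderiv ℝ X x u) v := by
    ext i
    refine Fin.cases ?_ (fun j => ?_) i <;> simp [hg]
  rw [h4] at h1
  simp only [fderiv_fun_const, Pi.zero_apply, zero_apply, add_zero] at h1
  linarith

/-- Cartan's formula `dΩ (X, Y, v) = - Ω ([X, Y], v)` for vector fields `X` and `Y` such that `Ω`
vanishes as soon as one of its arguments is `X` or `Y`. -/
theorem extDeriv_apply_vecCons_vecCons {k : ℕ} {Ω : E → E [⋀^Fin (k + 1)]→L[ℝ] ℝ}
    {X Y : E → E} {x : E} (hΩ : DifferentiableAt ℝ Ω x) (hX : DifferentiableAt ℝ X x)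
    (hY : DifferentiableAt ℝ Y x)
    (hΩX : ∀ᶠ y in 𝓝 x, ∀ v i, v i = X y → Ω y v = 0)
    (hΩY : ∀ᶠ y in 𝓝 x, ∀ v i, v i = Y y → Ω y v = 0) (v : Fin k → E) :
    extDeriv Ω x (Matrix.vecCons (X x) (Matrix.vecCons (Y x) v)) =
      - Ω x (Matrix.vecCons (VectorField.lieBracket ℝ X Y x) v) := by
  have hX' : ∀ᶠ y in 𝓝 x, ∀ v, Ω y (Matrix.vecCons (X y) v) = 0 :=
    hΩX.mono fun y hy v => hy _ 0 rfl
  have hY' : ∀ᶠ y in 𝓝 x, ∀ v, Ω y (Matrix.vecCons (Y y) v) = 0 :=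
    hΩY.mono fun y hy v => hy _ 0 rfl
  rw [extDeriv, ContinuousAlternatingMap.alternatizeUncurryFin_apply, Fin.sum_univ_succ,
    Fin.sum_univ_succ]
  have h3 : ∑ i : Fin k, (-1 : ℤ) ^ ((i.succ.succ : Fin (k + 2)) : ℕ) •
      (fderiv ℝ Ω x (Matrix.vecCons (X x) (Matrix.vecCons (Y x) v) i.succ.succ))
        (i.succ.succ.removeNth (Matrix.vecCons (X x) (Matrix.vecCons (Y x) v))) = 0 := by
    refine Finset.sum_eq_zero fun i _ => ?_
    obtain ⟨k, rfl⟩ : ∃ m, k = m + 1 := ⟨k - 1, by have := i.2; omega⟩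
    rw [removeNth_succ_vecCons, removeNth_succ_vecCons,
      fderiv_apply_vecCons_of_insertion_eq_zero hΩ hX hX',
      hΩY.self_of_nhds _ 1 (by simp), neg_zero, smul_zero]
  rw [h3, removeNth_succ_vecCons, removeNth_zero_vecCons, removeNth_zero_vecCons]
  simp only [Matrix.cons_val_zero, Matrix.cons_val_succ]
  rw [fderiv_apply_vecCons_of_insertion_eq_zero hΩ hX hX',
    fderiv_apply_vecCons_of_insertion_eq_zero hΩ hY hY', VectorField.lieBracket_eq]
  have h5 := (Ω x).toAlternatingMap.map_vecCons_add v
    (fderiv ℝ Y x (X x) - fderiv ℝ X x (Y x)) (fderiv ℝ X x (Y x))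
  rw [sub_add_cancel] at h5
  change Ω x _ = Ω x _ + Ω x _ at h5
  rw [h5]
  simp
  ring

end Bracket

section FirstIntegral

universe u

theorem apply_eq_zero_of_curryLeft_eq_zero {E : Type*} [NormedAddCommGroup E] [NormedSpace ℝ E]
    {k : ℕ} {Ω : E [⋀^Fin (k + 1)]→L[ℝ] ℝ} {ζ : E} (h : Ω.curryLeft ζ = 0) (v : Fin (k + 1) → E)
    (i : Fin (k + 1)) (hi : v i = ζ) : Ω v = 0 := by
  have h1 := Ω.map_insertNth i ζ (i.removeNth v)
  have h2 : Ω (Matrix.vecCons ζ (i.removeNth v)) = 0 := by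
    rw [← ContinuousAlternatingMap.curryLeft_apply_apply, h]
    rfl
  have h3 : i.insertNth ζ (i.removeNth v : Fin k → E) = v := by
    rw [← hi]
    exact Fin.insertNth_self_removeNth i v
  rw [h2, smul_zero, h3] at h1
  exact h1

theorem curryLeft_eq_zero_iff {E : Type*} [NormedAddCommGroup E] [NormedSpace ℝ E]
    {k : ℕ} {Ω : E [⋀^Fin (k + 1)]→L[ℝ] ℝ} {ζ : E} :
    Ω.curryLeft ζ = 0 ↔ ∀ v, Ω (Matrix.vecCons ζ v) = 0 :=
  ⟨fun h v => by rw [← ContinuousAlternatingMap.curryLeft_apply_apply, h]; rfl,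
    fun h => by ext v; exact h v⟩

theorem contDiff_curryLeft {E : Type*} [NormedAddCommGroup E] [NormedSpace ℝ E] {k : ℕ} :
    ContDiff ℝ ∞ (ContinuousAlternatingMap.curryLeft :
      E [⋀^Fin (k + 1)]→L[ℝ] ℝ → E →L[ℝ] E [⋀^Fin k]→L[ℝ] ℝ) :=
  (IsLinearMap.with_bound (𝕜 := ℝ) ⟨fun f g => by ext; rfl, fun c f => by ext; rfl⟩ 1
    fun f => by rw [ContinuousAlternatingMap.norm_curryLeft, one_mul]).contDiff

/-- Frobenius' theorem for the kernel, if of constant dimension, of a closed form `Ω`: every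
covector at `w₀` which vanishes on the kernel is the differential of a first integral. -/
theorem exists_first_integral {W : Type u} [NormedAddCommGroup W] [NormedSpace ℝ W]
    [FiniteDimensional ℝ W] {k : ℕ} {Ω : W → W [⋀^Fin (k + 1)]→L[ℝ] ℝ} {w₀ : W}
    (hΩ : ∀ᶠ w in 𝓝 w₀, ContDiffAt ℝ ∞ Ω w) (hcl : ∀ᶠ w in 𝓝 w₀, extDeriv Ω w = 0)
    (hr : ∀ᶠ w in 𝓝 w₀, Module.finrank ℝ (LinearMap.ker ((Ω w).curryLeft : W →ₗ[ℝ] W [⋀^Fin k]→L[ℝ] ℝ)) =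
      Module.finrank ℝ (LinearMap.ker ((Ω w₀).curryLeft : W →ₗ[ℝ] W [⋀^Fin k]→L[ℝ] ℝ)))
    (l : W →L[ℝ] ℝ) (hl : ∀ v, (Ω w₀).curryLeft v = 0 → l v = 0) :
    ∃ h : W → ℝ, fderiv ℝ h w₀ = l ∧ ∀ᶠ w in 𝓝 w₀, ContDiffAt ℝ ∞ h w ∧
      ∀ v, (Ω w).curryLeft v = 0 → fderiv ℝ h w v = 0 := by
  have : CompleteSpace W := FiniteDimensional.complete ℝ W
  set L : W → W →L[ℝ] W [⋀^Fin k]→L[ℝ] ℝ := fun w => (Ω w).curryLeft with hLdef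
  have hL : ∀ᶠ w in 𝓝 w₀, ContDiffAt ℝ ∞ L w := by
    filter_upwards [hΩ] with w hw
    exact contDiff_curryLeft.contDiffAt.comp w hw
  obtain ⟨K, hK⟩ : ∃ K, LinearMap.ker (L w₀ : W →ₗ[ℝ] W [⋀^Fin k]→L[ℝ] ℝ) = K := ⟨_, rfl⟩
  have hKl : ∀ x : K, l x = 0 := fun x => hl _ (hK.ge x.2)
  obtain ⟨P, S, hP, hS0, hS⟩ := exists_smooth_kernel_frame hK hL (hr.mono fun w hw => hw.trans (by rw [← hK]))
  have : CompleteSpace K := FiniteDimensional.complete ℝ K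
  have hcomm : ∀ᶠ w in 𝓝 w₀, ∀ a b, fderiv ℝ S w (S w a) b = fderiv ℝ S w (S w b) a := by
    filter_upwards [hS.eventually_nhds, hΩ, hcl] with w hw hΩw hclw a b
    obtain ⟨h1, h2, h3, h4⟩ := hw.self_of_nhds
    have hSd := (h1.differentiableAt (by simp)).hasFDerivAt
    have hd : ∀ c : K, HasFDerivAt (fun y => S y c)
        ((ContinuousLinearMap.apply ℝ W c) ∘L fderiv ℝ S w) w := fun c =>
      (ContinuousLinearMap.apply ℝ W c).hasFDerivAt.comp w hSd
    have hv : ∀ c : K, ∀ᶠ y in 𝓝 w, ∀ v i, v i = S y c → Ω y v = 0 := fun c =>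
      hw.mono fun y hy v i hi => apply_eq_zero_of_curryLeft_eq_zero (hy.2.2.1 c) v i hi
    have hPz : ∀ u c, P (fderiv ℝ S w u c) = 0 := by
      intro u c
      have e1 := P.hasFDerivAt.comp w (hd c)
      have e2 : (P ∘ fun y => S y c) =ᶠ[𝓝 w] fun _ => c := hw.mono fun y hy => hy.2.1 c
      exact DFunLike.congr_fun (e1.unique ((hasFDerivAt_const c w).congr_of_eventuallyEq e2)) u
    have hbr : VectorField.lieBracket ℝ (fun y => S y a) (fun y => S y b) w =
        fderiv ℝ S w (S w a) b - fderiv ℝ S w (S w b) a := by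
      change fderiv ℝ (fun y => S y b) w (S w a) - fderiv ℝ (fun y => S y a) w (S w b) = _
      rw [(hd a).fderiv, (hd b).fderiv]
      rfl
    have hker : L w (VectorField.lieBracket ℝ (fun y => S y a) (fun y => S y b) w) = 0 := by
      refine curryLeft_eq_zero_iff.2 fun v => ?_
      have := extDeriv_apply_vecCons_vecCons (hΩw.differentiableAt (by simp))
        (hd a).differentiableAt (hd b).differentiableAt (hv a) (hv b) v
      rw [hclw] at this
      simpa using this.symm
    have := h4 _ hker
    rw [hbr, map_sub, hPz, hPz, sub_self, map_zero] at this
    exact sub_eq_zero.1 this.symm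
  obtain ⟨Φ, hΦ0, hΦ⟩ := exists_commuting_flow (hS.mono fun w hw => hw.1) hcomm
  set F := LinearMap.ker (P : W →ₗ[ℝ] K) with hF
  have : CompleteSpace F := FiniteDimensional.complete ℝ F
  have hPF : ∀ p : F, P (p : W) = 0 := fun p => p.2
  set j : K × F → K × W := fun q => (q.1, w₀ + q.2) with hj
  have hj' : ∀ q, HasFDerivAt j ((ContinuousLinearMap.fst ℝ K F).prod
      (F.subtypeL ∘L ContinuousLinearMap.snd ℝ K F)) q := fun q =>
    hasFDerivAt_fst.prodMk ((F.subtypeL.hasFDerivAt.comp q hasFDerivAt_snd).const_add w₀)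
  have hjs : ContDiff ℝ ∞ j :=
    contDiff_fst.prodMk (contDiff_const.add (F.subtypeL.contDiff.comp contDiff_snd))
  have hj0 : j 0 = (0, w₀) := by simp [hj]
  have hΦj : ∀ᶠ q in 𝓝 (0 : K × F), ContDiffAt ℝ ∞ Φ (j q) ∧
      ∀ κ, fderiv ℝ Φ (j q) (κ, 0) = S (Φ (j q)) κ := by
    have := hjs.continuous.tendsto 0
    rw [hj0] at this
    exact this.eventually hΦ
  set G : K × F → W := Φ ∘ j with hG
  have hG' : ∀ q, ContDiffAt ℝ ∞ Φ (j q) → ∀ x, fderiv ℝ G q x = fderiv ℝ Φ (j q) (x.1, x.2) := by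
    intro q hq x
    rw [hG, ((hq.differentiableAt (by simp)).hasFDerivAt.comp q (hj' q)).fderiv]
    rfl
  have hΦw : ∀ v, fderiv ℝ Φ (0, w₀) (0, v) = v := by
    intro v
    have e1 : HasFDerivAt (fun w => Φ (0, w)) _ w₀ :=
      ((hΦ.self_of_nhds.1.differentiableAt (by simp)).hasFDerivAt).comp w₀
        (hasFDerivAt_prodMk_right (𝕜 := ℝ) (0 : K) w₀)
    exact DFunLike.congr_fun (e1.unique ((hasFDerivAt_id w₀).congr_of_eventuallyEq hΦ0)) v
  have hG0 : G 0 = w₀ := by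
    simp only [hG, Function.comp_apply, hj0]
    exact hΦ0.self_of_nhds
  have hG'0 : ∀ x, fderiv ℝ G 0 x = (x.1 : W) + x.2 := by
    intro x
    rw [hG' 0 hΦj.self_of_nhds.1, hj0]
    have : ((x.1, (x.2 : W)) : K × W) = (x.1, 0) + (0, (x.2 : W)) := by simp
    rw [this, map_add, hΦw, hΦ.self_of_nhds.2, hΦ0.self_of_nhds, hS0]
  have hinv : (fderiv ℝ G 0).IsInvertible := by
    have hbij : Function.Bijective (fderiv ℝ G 0 : K × F →ₗ[ℝ] W) := by
      constructor
      · refine (injective_iff_map_eq_zero _).2 fun x hx => ?_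
        have h1 : (x.1 : W) + x.2 = 0 := (hG'0 x).symm.trans hx
        have h2 := congrArg P h1
        rw [map_add, hP, hPF, add_zero, map_zero] at h2
        rw [h2, ZeroMemClass.coe_zero, zero_add] at h1
        exact Prod.ext h2 (Subtype.ext h1)
      · intro v
        have hv : v - (P v : W) ∈ F := by
          change P _ = 0
          rw [map_sub, hP, sub_self]
        refine ⟨(P v, ⟨v - P v, hv⟩), (hG'0 _).trans ?_⟩
        simp
    refine ⟨(LinearEquiv.ofBijective _ hbij).toContinuousLinearEquiv, ?_⟩
    ext x <;> rfl
  obtain ⟨g, hg0, hg⟩ := exists_smooth_localInverse (G := G) (x₀ := 0)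
    (hΦj.mono fun q hq => hq.1.comp q hjs.contDiffAt) hinv
  rw [hG0] at hg0 hg
  have hgt : Tendsto g (𝓝 w₀) (𝓝 0) := by
    have := hg.self_of_nhds.2.1.continuousAt.tendsto
    rwa [hg0] at this
  set lam : K × F →L[ℝ] ℝ := l ∘L F.subtypeL ∘L ContinuousLinearMap.snd ℝ K F with hlam
  have hdg : ∀ᶠ w in 𝓝 w₀, HasFDerivAt g (fderiv ℝ g w) w ∧
      ∀ v, fderiv ℝ G (g w) (fderiv ℝ g w v) = v := by
    filter_upwards [hg.eventually_nhds, hgt.eventually hΦj] with w hw hw'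
    have e0 := (hw.self_of_nhds.2.1.differentiableAt (by simp)).hasFDerivAt
    refine ⟨e0, fun v => ?_⟩
    have e1 : HasFDerivAt G (fderiv ℝ G (g w)) (g w) :=
      ((hw'.1.comp _ hjs.contDiffAt).differentiableAt (by simp)).hasFDerivAt
    have e2 : (G ∘ g) =ᶠ[𝓝 w] id := hw.mono fun y hy => hy.1
    exact DFunLike.congr_fun ((e1.comp w e0).unique
      ((hasFDerivAt_id w).congr_of_eventuallyEq e2)) v
  refine ⟨lam ∘ g, ?_, ?_⟩
  · obtain ⟨e0, e1⟩ := hdg.self_of_nhds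
    rw [(lam.hasFDerivAt.comp w₀ e0).fderiv]
    ext v
    have e2 := e1 v
    rw [hg0, hG'0] at e2
    have e3 : l ((fderiv ℝ g w₀ v).1 : W) = 0 := hKl _
    conv_rhs => rw [← e2, map_add, e3, zero_add]
    rfl
  · filter_upwards [hg, hdg, hgt.eventually hΦj, hS] with w h1 h2 h3 h4
    refine ⟨lam.contDiff.contDiffAt.comp w h1.2.1, fun v hv => ?_⟩
    rw [(lam.hasFDerivAt.comp w h2.1).fderiv]
    have e1 : fderiv ℝ G (g w) (P v, 0) = v := by
      rw [hG' _ h3.1]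
      have : G (g w) = w := h1.1
      change fderiv ℝ Φ (j (g w)) (P v, (0 : W)) = v
      rw [h3.2, show Φ (j (g w)) = w from this]
      exact h4.2.2.2 v hv
    have e2 : fderiv ℝ g w v = (P v, 0) := h1.2.2.bijective.1 ((h2.2 v).trans e1.symm)
    simp [e2, hlam]

end FirstIntegral

section AlternatingSpace

variable {ι E : Type*} [Fintype ι] [NormedAddCommGroup E] [NormedSpace ℝ E] [FiniteDimensional ℝ E]
  {F : Type*} [NormedAddCommGroup F] [NormedSpace ℝ F]

instance finiteDimensional_continuousMultilinearMap :
    FiniteDimensional ℝ (ContinuousMultilinearMap ℝ (fun _ : ι => E) ℝ) :=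
  Module.Finite.of_injective
    (⟨⟨fun f => f.toMultilinearMap, fun _ _ => rfl⟩, fun _ _ => rfl⟩ :
      ContinuousMultilinearMap ℝ (fun _ : ι => E) ℝ →ₗ[ℝ] MultilinearMap ℝ (fun _ : ι => E) ℝ)
    ContinuousMultilinearMap.toMultilinearMap_injective

instance finiteDimensional_continuousAlternatingMap :
    FiniteDimensional ℝ (E [⋀^ι]→L[ℝ] ℝ) :=
  Module.Finite.of_injective
    (ContinuousAlternatingMap.toContinuousMultilinearMapCLM ℝ :
      (E [⋀^ι]→L[ℝ] ℝ) →L[ℝ] ContinuousMultilinearMap ℝ (fun _ : ι => E) ℝ).toLinearMap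
    ContinuousAlternatingMap.toContinuousMultilinearMap_injective

/-- The pull-back of an alternating map along a linear map depends smoothly on both of them. -/
theorem contDiff_compContinuousLinearMap {N : ℕ∞ω} :
    ContDiff ℝ N (fun p : (F [⋀^ι]→L[ℝ] ℝ) × (E →L[ℝ] F) => p.1.compContinuousLinearMap p.2) := by
  classical
  set T : (E [⋀^ι]→L[ℝ] ℝ) →L[ℝ] ContinuousMultilinearMap ℝ (fun _ : ι => E) ℝ :=
    ContinuousAlternatingMap.toContinuousMultilinearMapCLM ℝ
  obtain ⟨S, hS⟩ := T.toLinearMap.exists_leftInverse_of_injective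
    (LinearMap.ker_eq_bot.2 ContinuousAlternatingMap.toContinuousMultilinearMap_injective)
  have h1 : ContDiff ℝ N (fun p : (F [⋀^ι]→L[ℝ] ℝ) × (E →L[ℝ] F) =>
      ContinuousMultilinearMap.compContinuousLinearMapContinuousMultilinear ℝ
        (fun _ : ι => E) (fun _ : ι => F) ℝ (fun _ => p.2)
        (ContinuousAlternatingMap.toContinuousMultilinearMapCLM ℝ p.1)) :=
    ((ContinuousMultilinearMap.contDiff _).comp
      (contDiff_pi.2 fun _ => contDiff_snd)).clm_apply
      ((ContinuousLinearMap.contDiff _).comp contDiff_fst)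
  convert (LinearMap.toContinuousLinearMap S).contDiff.comp h1 using 2 with p
  exact (LinearMap.congr_fun hS (p.1.compContinuousLinearMap p.2)).symm

theorem _root_.ContDiffAt.compContinuousLinearMap_alternating {X : Type*} [NormedAddCommGroup X] [NormedSpace ℝ X]
    {N : ℕ∞ω} {A : X → F [⋀^ι]→L[ℝ] ℝ} {L : X → E →L[ℝ] F} {x : X}
    (hA : ContDiffAt ℝ N A x) (hL : ContDiffAt ℝ N L x) :
    ContDiffAt ℝ N (fun y => (A y).compContinuousLinearMap (L y)) x :=
  contDiff_compContinuousLinearMap.contDiffAt.comp x (hA.prodMk hL)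

end AlternatingSpace

section Annihilator

variable {n : ℕ} {E : Type*} [AddCommGroup E] [Module ℝ E]
  {C : Submodule ℝ E} {A B : E [⋀^Fin n]→ₗ[ℝ] ℝ}

theorem _root_.AlternatingMap.congr_of_sub_mem (hA : ∀ v, (∃ i, v i ∈ C) → A v = 0) {v w : Fin n → E}
    (h : ∀ i, v i - w i ∈ C) : A v = A w := by
  have h1 : v = w + (v - w) := by abel
  rw [h1]
  have := A.toMultilinearMap.map_add_univ w (v - w)
  change A (w + (v - w)) = _ at this
  rw [this, Finset.sum_eq_single Finset.univ]
  · simp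
  · intro s _ hs
    obtain ⟨i, hi⟩ : ∃ i, i ∉ s := by
      by_contra! h
      exact hs (Finset.eq_univ_iff_forall.2 h)
    exact hA _ ⟨i, by simpa [Finset.piecewise, hi] using h i⟩
  · simp

/-- Vectors which form a basis of the quotient by `C`. -/
theorem exists_transverse_family [FiniteDimensional ℝ E] (hC : Module.finrank ℝ (E ⧸ C) = n) :
    ∃ (e : Fin n → E) (a : E →ₗ[ℝ] Fin n → ℝ), ∀ v, v - ∑ j, a v j • e j ∈ C := by
  have b := Module.finBasisOfFinrankEq ℝ (E ⧸ C) hC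
  choose e he using fun i => C.mkQ_surjective (b i)
  refine ⟨e, b.equivFun.toLinearMap ∘ₗ C.mkQ, fun v => ?_⟩
  rw [← Submodule.Quotient.mk_eq_zero, ← Submodule.mkQ_apply, map_sub, map_sum]
  simp only [map_smul, he]
  have := b.sum_equivFun (C.mkQ v)
  simp only [LinearMap.comp_apply, LinearEquiv.coe_coe]
  rw [this, sub_self]

theorem eq_zero_of_transverse_family (hA : ∀ v, (∃ i, v i ∈ C) → A v = 0) {e : Fin n → E}
    {a : E →ₗ[ℝ] Fin n → ℝ} (he : ∀ v, v - ∑ j, a v j • e j ∈ C) (h : A e = 0) : A = 0 := by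
  ext v
  have h1 : A v = A (fun i => ∑ j, a (v i) j • e j) := A.congr_of_sub_mem hA fun i => he (v i)
  have h2 := (A.compLinearMap (Fintype.linearCombination ℝ e)).eq_smul_basis_det
    (Pi.basisFun ℝ (Fin n))
  have h3 : (A.compLinearMap (Fintype.linearCombination ℝ e)) (Pi.basisFun ℝ (Fin n)) = 0 := by
    rw [← h]
    simp [Fintype.linearCombination_apply_single]
  rw [h3, zero_smul] at h2
  have h4 := congrArg (fun f => f (fun i => a (v i))) h2
  rw [h1]
  simpa [Fintype.linearCombination_apply] using h4

/-- A nonzero form of maximal degree on a quotient is nondegenerate. -/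
theorem mem_of_insertion_eq_zero [FiniteDimensional ℝ E]
    (hC : Module.finrank ℝ (E ⧸ C) = n)
    (hA : ∀ v, (∃ i, v i ∈ C) → A v = 0) (h0 : A ≠ 0) {ζ : E}
    (hζ : ∀ v i, v i = ζ → A v = 0) : ζ ∈ C := by
  obtain ⟨e, a, he⟩ := exists_transverse_family hC
  have hne : A e ≠ 0 := fun h => h0 (eq_zero_of_transverse_family hA he h)
  have ha : a ζ = 0 := by
    ext j
    have h1 : A (Function.update e j ζ) = A (Function.update e j (∑ i, a ζ i • e i)) := by
      refine A.congr_of_sub_mem hA fun i => ?_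
      rcases eq_or_ne i j with rfl | hij
      · simpa using he ζ
      · simp [hij]
    rw [hζ _ j (by simp), A.map_update_sum, Finset.sum_eq_single j] at h1
    · simp only [AlternatingMap.map_update_smul, Function.update_eq_self, smul_eq_mul] at h1
      simpa [hne] using h1.symm
    · intro i _ hij
      rw [A.map_update_smul, A.map_update_self _ hij.symm, smul_zero]
    · simp
  simpa [ha] using he ζ

/-- The forms of maximal degree on a quotient are multiples of each other. -/
theorem exists_eq_smul_of_annihilates [FiniteDimensional ℝ E]
    (hC : Module.finrank ℝ (E ⧸ C) = n)
    (hA : ∀ v, (∃ i, v i ∈ C) → A v = 0) (h0 : A ≠ 0)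
    (hB : ∀ v, (∃ i, v i ∈ C) → B v = 0) : ∃ b : ℝ, B = b • A := by
  obtain ⟨e, a, he⟩ := exists_transverse_family hC
  have hne : A e ≠ 0 := fun h => h0 (eq_zero_of_transverse_family hA he h)
  refine ⟨B e / A e, sub_eq_zero.1 (eq_zero_of_transverse_family (fun v hv => ?_) he ?_)⟩
  · simp [hA v hv, hB v hv]
  · simp [hne]

end Annihilator

section AdaptedForm

variable {n : ℕ} {Y E : Type*} [NormedAddCommGroup Y] [NormedSpace ℝ Y]
  [NormedAddCommGroup E] [NormedSpace ℝ E] [FiniteDimensional ℝ E]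

/-- A smooth family of bases of subspaces is the image of the basis at a given point by a smooth
family of automorphisms. -/
theorem exists_smooth_straightening {k : ℕ} {X : Fin k → Y → E} {y₀ : Y}
    (hX : ∀ᶠ y in 𝓝 y₀, ∀ i, ContDiffAt ℝ ∞ (X i) y)
    (hl : LinearIndependent ℝ (fun i => X i y₀)) :
    ∃ G : Y → E →L[ℝ] E, G y₀ = .id ℝ E ∧ ∀ᶠ y in 𝓝 y₀, ContDiffAt ℝ ∞ G y ∧
      (G y).IsInvertible ∧ ∀ i, G y (X i y₀) = X i y := by
  have : CompleteSpace E := FiniteDimensional.complete ℝ E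
  obtain ⟨c, hc⟩ : ∃ c : E →ₗ[ℝ] Fin k → ℝ, ∀ i j, c (X i y₀) j = if i = j then 1 else 0 := by
    obtain ⟨c, hc⟩ := (Fintype.linearCombination ℝ (fun i => X i y₀)).exists_leftInverse_of_injective
      (LinearMap.ker_eq_bot.2 hl.fintypeLinearCombination_injective)
    refine ⟨c, fun i j => ?_⟩
    have := LinearMap.congr_fun hc (Pi.single i 1)
    simp only [LinearMap.comp_apply, Fintype.linearCombination_apply_single, one_smul] at this
    rw [this]
    simp [Pi.single_apply, eq_comm]
  set c' : Fin k → E →L[ℝ] ℝ := fun j => LinearMap.toContinuousLinearMap (LinearMap.proj j ∘ₗ c)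
  have hc' : ∀ v j, c' j v = c v j := fun _ _ => rfl
  set G : Y → E →L[ℝ] E := fun y => .id ℝ E + ∑ j, (c' j).smulRight (X j y - X j y₀) with hG
  have hG0 : G y₀ = .id ℝ E := by simp [hG]
  have hGs : ∀ᶠ y in 𝓝 y₀, ContDiffAt ℝ ∞ G y := by
    filter_upwards [hX] with y hy
    refine contDiffAt_const.add (ContDiffAt.sum fun j _ => ?_)
    exact (ContinuousLinearMap.smulRightL ℝ E E (c' j)).contDiff.contDiffAt.comp y
      ((hy j).sub contDiffAt_const)
  refine ⟨G, hG0, hGs.and ?_ |>.mono fun y hy => ⟨hy.1, hy.2, fun i => ?_⟩⟩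
  · refine eventually_isInvertible hGs.self_of_nhds.continuousAt ?_
    rw [hG0]
    exact ⟨.refl ℝ E, rfl⟩
  · simp [hG, hc', hc]

/-- A form annihilated by a smooth distribution extends to a smooth family of such forms. -/
theorem exists_smooth_annihilating_form {k : ℕ} {X : Fin k → Y → E} {y₀ : Y}
    (hX : ∀ᶠ y in 𝓝 y₀, ∀ i, ContDiffAt ℝ ∞ (X i) y)
    (hl : LinearIndependent ℝ (fun i => X i y₀)) {C : Y → Submodule ℝ E}
    (hC : ∀ᶠ y in 𝓝 y₀, Submodule.span ℝ (range fun i => X i y) = C y)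
    (α : E [⋀^Fin n]→L[ℝ] ℝ) (hα : ∀ v, (∃ i, v i ∈ C y₀) → α v = 0) (hα0 : α ≠ 0) :
    ∃ A : Y → E [⋀^Fin n]→L[ℝ] ℝ, A y₀ = α ∧ ∀ᶠ y in 𝓝 y₀, ContDiffAt ℝ ∞ A y ∧ A y ≠ 0 ∧
      ∀ v, (∃ i, v i ∈ C y) → A y v = 0 := by
  have : CompleteSpace E := FiniteDimensional.complete ℝ E
  obtain ⟨G, hG0, hG⟩ := exists_smooth_straightening hX hl
  refine ⟨fun y => α.compContinuousLinearMap (G y).inverse, ?_, ?_⟩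
  · ext v
    simp [hG0, ContinuousLinearMap.inverse_id]
  have hC0 := hC.self_of_nhds
  filter_upwards [hG, hC] with y ⟨hs, ⟨e, he⟩, hi⟩ hCy
  refine ⟨contDiffAt_const.compContinuousLinearMap_alternating ?_, ?_, ?_⟩
  · refine ContDiffAt.comp (g := ContinuousLinearMap.inverse) y ?_ hs
    rw [← he]
    exact contDiffAt_map_inverse e
  · intro h
    apply hα0
    ext v
    have := congrArg (fun f => f (fun i => e (v i))) h
    simpa [← he, ContinuousLinearMap.inverse_equiv, Function.comp_def] using this
  · rintro v ⟨i, hv⟩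
    refine hα _ ⟨i, ?_⟩
    rw [← hCy] at hv
    have h1 : Submodule.span ℝ (range fun i => X i y) ≤
        (C y₀).comap ((G y).inverse : E →ₗ[ℝ] E) := by
      rw [Submodule.span_le]
      rintro _ ⟨j, rfl⟩
      change (G y).inverse (X j y) ∈ C y₀
      rw [← hi j, ← he, ContinuousLinearMap.inverse_equiv]
      rw [← hC0]
      simpa using Submodule.subset_span (mem_range_self j)
    exact h1 hv

end AdaptedForm

section Cone

variable {n : ℕ} {E : Type*} [NormedAddCommGroup E] [NormedSpace ℝ E]

/-- The vectors `ζ` with `i_ζ A = 0` and `i_ζ B` proportional to `A`. -/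
def proportionalityKernel (A : E [⋀^Fin n]→L[ℝ] ℝ) (B : E [⋀^Fin (n + 1)]→L[ℝ] ℝ) :
    Submodule ℝ E where
  carrier := {ζ | (∀ v i, v i = ζ → A v = 0) ∧ ∃ b : ℝ, B.curryLeft ζ = b • A}
  zero_mem' := ⟨fun _ _ h => A.map_coord_zero _ h, 0, by simp⟩
  add_mem' := by
    rintro ζ η ⟨hζ, a, ha⟩ ⟨hη, b, hb⟩
    refine ⟨fun v i hi => ?_, a + b, by rw [map_add, ha, hb, add_smul]⟩
    have h := A.toAlternatingMap.map_update_add v i ζ η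
    rw [← hi, Function.update_eq_self] at h
    refine h.trans ?_
    rw [show A.toAlternatingMap (Function.update v i ζ) = 0 from hζ _ i (by simp),
      show A.toAlternatingMap (Function.update v i η) = 0 from hη _ i (by simp), add_zero]
  smul_mem' := by
    rintro c ζ ⟨hζ, a, ha⟩
    refine ⟨fun v i hi => ?_, c * a, by rw [map_smul, ha, mul_smul]⟩
    have h := A.toAlternatingMap.map_update_smul v i c ζ
    rw [← hi, Function.update_eq_self] at h
    refine h.trans ?_
    rw [show A.toAlternatingMap (Function.update v i ζ) = 0 from hζ _ i (by simp), smul_zero]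

theorem mem_proportionalityKernel {A : E [⋀^Fin n]→L[ℝ] ℝ} {B : E [⋀^Fin (n + 1)]→L[ℝ] ℝ} {ζ : E} :
    ζ ∈ proportionalityKernel A B ↔
      (∀ v i, v i = ζ → A v = 0) ∧ ∃ b : ℝ, B.curryLeft ζ = b • A := Iff.rfl

/-- The form `t A` on `E × ℝ`. -/
def coneForm (A : E → E [⋀^Fin n]→L[ℝ] ℝ) (p : E × ℝ) : (E × ℝ) [⋀^Fin n]→L[ℝ] ℝ :=
  p.2 • (A p.1).compContinuousLinearMap (.fst ℝ E ℝ)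

variable {A : E → E [⋀^Fin n]→L[ℝ] ℝ}

theorem minSmoothness_two_le_infty : minSmoothness ℝ 2 ≤ (∞ : ℕ∞ω) := by
  rw [minSmoothness_of_isRCLikeNormedField]
  exact WithTop.coe_le_coe.2 le_top

theorem contDiffAt_extDeriv {F : Type*} [NormedAddCommGroup F] [NormedSpace ℝ F]
    {Ω : F → F [⋀^Fin n]→L[ℝ] ℝ} {x : F} (h : ContDiffAt ℝ ∞ Ω x) :
    ContDiffAt ℝ ∞ (extDeriv Ω) x := by
  have h1 : extDeriv Ω = fun y =>
      ContinuousAlternatingMap.alternatizeUncurryFinCLM ℝ F ℝ (fderiv ℝ Ω y) := by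
    ext1 y
    rw [ContinuousAlternatingMap.alternatizeUncurryFinCLM_apply, extDeriv]
  rw [h1]
  exact (ContinuousLinearMap.contDiff _).contDiffAt.comp x (h.fderiv_right (m := ∞) (by simp))

theorem contDiffAt_coneForm {N : ℕ∞ω} {p : E × ℝ} (hA : ContDiffAt ℝ N A p.1) :
    ContDiffAt ℝ N (coneForm A) p :=
  contDiffAt_snd.smul ((ContinuousAlternatingMap.compContinuousLinearMapCLM
    (.fst ℝ E ℝ) : E [⋀^Fin n]→L[ℝ] ℝ →L[ℝ] _).contDiff.contDiffAt.comp p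
    (hA.comp p contDiffAt_fst))

theorem extDeriv_coneForm_apply {p : E × ℝ} (hA : DifferentiableAt ℝ A p.1)
    (v : Fin (n + 1) → E × ℝ) :
    extDeriv (coneForm A) p v =
      ∑ i : Fin (n + 1), (-1 : ℝ) ^ i.val * ((v i).2 * A p.1 (fun j => (i.removeNth v j).1)) +
        p.2 * extDeriv A p.1 (fun i => (v i).1) := by
  have hF : HasFDerivAt (fun q : E × ℝ => A q.1) (fderiv ℝ A p.1 ∘L .fst ℝ E ℝ) p :=
    hA.hasFDerivAt.comp p hasFDerivAt_fst
  have hF' := ((ContinuousAlternatingMap.compContinuousLinearMapCLM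
    (.fst ℝ E ℝ) : E [⋀^Fin n]→L[ℝ] ℝ →L[ℝ] _).hasFDerivAt.comp p hF)
  have h := (hasFDerivAt_snd (𝕜 := ℝ) (p := p)).smul hF'
  have h' : fderiv ℝ (coneForm A) p = _ := h.fderiv
  rw [extDeriv, ContinuousAlternatingMap.alternatizeUncurryFin_apply, h', extDeriv,
    ContinuousAlternatingMap.alternatizeUncurryFin_apply, Finset.mul_sum, ← Finset.sum_add_distrib]
  refine Finset.sum_congr rfl fun i _ => ?_
  change (-1 : ℤ) ^ i.val • (p.2 * fderiv ℝ A p.1 (v i).1 (fun j => (i.removeNth v j).1) +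
    (v i).2 * A p.1 (fun j => (i.removeNth v j).1)) = _ +
    p.2 * ((-1 : ℤ) ^ i.val • fderiv ℝ A p.1 (v i).1 (fun j => (i.removeNth v j).1))
  simp only [zsmul_eq_mul]
  push_cast
  ring

/-- The kernel of `d (t A)`. -/
theorem curryLeft_extDeriv_coneForm_eq_zero_iff {p : E × ℝ} (hA : DifferentiableAt ℝ A p.1)
    (ζ : E) (s : ℝ) :
    (extDeriv (coneForm A) p).curryLeft (ζ, s) = 0 ↔ (∀ v i, v i = ζ → A p.1 v = 0) ∧
      p.2 • (extDeriv A p.1).curryLeft ζ = -s • A p.1 := by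
  have key : ∀ v : Fin n → E × ℝ, extDeriv (coneForm A) p (Matrix.vecCons (ζ, s) v) =
      s * A p.1 (fun j => (v j).1) + ∑ i : Fin n, (-1 : ℝ) ^ (i.val + 1) *
        ((v i).2 * A p.1 (fun j => (i.succ.removeNth (Matrix.vecCons (ζ, s) v) j).1)) +
        p.2 * (extDeriv A p.1).curryLeft ζ (fun i => (v i).1) := by
    intro v
    rw [extDeriv_coneForm_apply hA, Fin.sum_univ_succ]
    congr 1
    · simp
    · rw [ContinuousAlternatingMap.curryLeft_apply_apply]
      congr 2
      ext i
      refine Fin.cases ?_ (fun j => ?_) i <;> rfl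
  rw [curryLeft_eq_zero_iff]
  constructor
  · intro h
    have h2 : p.2 • (extDeriv A p.1).curryLeft ζ = -s • A p.1 := by
      ext w
      have := key fun i => (w i, 0)
      simp only [h, zero_mul, mul_zero, Finset.sum_const_zero, add_zero] at this
      simp only [ContinuousAlternatingMap.smul_apply, smul_eq_mul]
      linarith
    refine ⟨fun v i hi => ?_, h2⟩
    obtain _ | m := n
    · exact i.elim0
    refine apply_eq_zero_of_curryLeft_eq_zero (curryLeft_eq_zero_iff.2 fun w => ?_) v i hi
    have := key (Matrix.vecCons (0, 1) fun i => (w i, 0))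
    rw [h, Fin.sum_univ_succ] at this
    have h3 : ∀ B : E [⋀^Fin (m + 1)]→L[ℝ] ℝ,
        B (fun j => (Matrix.vecCons ((0, 1) : E × ℝ) (fun i => (w i, 0)) j).1) = 0 := fun B =>
      B.map_coord_zero 0 rfl
    simp only [h3, Matrix.cons_val_zero, Matrix.cons_val_succ, mul_zero, zero_mul,
      Finset.sum_const_zero, removeNth_succ_vecCons] at this
    have h4 : (fun j => ((Matrix.vecCons (ζ, s) ((0 : Fin (m + 1)).removeNth
        (Matrix.vecCons ((0, 1) : E × ℝ) (fun i => (w i, 0)))) : Fin (m + 1) → E × ℝ) j).1) =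
        Matrix.vecCons ζ w := by
      ext j
      rw [removeNth_zero_vecCons]
      refine Fin.cases ?_ (fun j => ?_) j <;> rfl
    rw [h4] at this
    simpa using this
  · rintro ⟨h1, h2⟩ v
    rw [key, Finset.sum_eq_zero, add_zero]
    · have := congrArg (fun B => B (fun i => (v i).1)) h2
      simp only [ContinuousAlternatingMap.smul_apply, smul_eq_mul] at this
      linarith
    · intro i _
      obtain _ | m := n
      · exact i.elim0
      rw [h1 _ 0, mul_zero, mul_zero]
      rw [removeNth_succ_vecCons]
      rfl

theorem finrank_ker_extDeriv_coneForm {p : E × ℝ} (hA : DifferentiableAt ℝ A p.1) (h0 : A p.1 ≠ 0)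
    (ht : p.2 ≠ 0) :
    Module.finrank ℝ (LinearMap.ker
      ((extDeriv (coneForm A) p).curryLeft : E × ℝ →ₗ[ℝ] (E × ℝ) [⋀^Fin n]→L[ℝ] ℝ)) =
      Module.finrank ℝ (proportionalityKernel (A p.1) (extDeriv A p.1)) := by
  set K := LinearMap.ker
      ((extDeriv (coneForm A) p).curryLeft : E × ℝ →ₗ[ℝ] (E × ℝ) [⋀^Fin n]→L[ℝ] ℝ)
  have hK : ∀ q : E × ℝ, q ∈ K ↔ _ := fun q =>
    curryLeft_extDeriv_coneForm_eq_zero_iff hA q.1 q.2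
  have h1 : ∀ q : K, (LinearMap.fst ℝ E ℝ).domRestrict K q ∈
      proportionalityKernel (A p.1) (extDeriv A p.1) := fun q => by
    obtain ⟨h1, h2⟩ := (hK q).1 q.2
    refine ⟨h1, p.2⁻¹ * -(q : E × ℝ).2, ?_⟩
    rw [mul_smul, ← h2, smul_smul, inv_mul_cancel₀ ht, one_smul]
    rfl
  refine (LinearEquiv.ofBijective (((LinearMap.fst ℝ E ℝ).domRestrict K).codRestrict _ h1)
    ⟨?_, ?_⟩).finrank_eq
  · rw [← LinearMap.ker_eq_bot, LinearMap.ker_eq_bot']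
    rintro ⟨⟨ζ, s⟩, hq⟩ h
    obtain rfl : ζ = 0 := congrArg Subtype.val h
    have h2 := ((hK _).1 hq).2
    simp only [map_zero, smul_zero] at h2
    have := (smul_eq_zero.1 h2.symm).resolve_right h0
    simpa using this
  · rintro ⟨ζ, h1, b, hb⟩
    exact ⟨⟨(ζ, -(p.2 * b)), (hK _).2 ⟨h1, by simp only [hb, smul_smul, neg_neg]⟩⟩, rfl⟩

end Cone

section FlatMultiple

universe u

/-- A form has, locally, a multiple which is flat along its characteristic distribution. -/
theorem exists_flat_multiple {n : ℕ} {E : Type u} [NormedAddCommGroup E] [NormedSpace ℝ E]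
    [FiniteDimensional ℝ E] {A : E → E [⋀^Fin n]→L[ℝ] ℝ} {y₀ : E}
    (hA : ∀ᶠ y in 𝓝 y₀, ContDiffAt ℝ ∞ A y) (h0 : A y₀ ≠ 0)
    (hr : ∀ᶠ y in 𝓝 y₀, Module.finrank ℝ (proportionalityKernel (A y) (extDeriv A y)) =
      Module.finrank ℝ (proportionalityKernel (A y₀) (extDeriv A y₀))) :
    ∃ f : E → ℝ, f y₀ = 1 ∧ ∀ᶠ y in 𝓝 y₀, ContDiffAt ℝ ∞ f y ∧
      ∀ ζ ∈ proportionalityKernel (A y) (extDeriv A y),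
        (extDeriv (fun z => f z • A z) y).curryLeft ζ = 0 := by
  have : CompleteSpace E := FiniteDimensional.complete ℝ E
  have h0' : ∀ᶠ y in 𝓝 y₀, A y ≠ 0 := hA.self_of_nhds.continuousAt.eventually_ne h0
  set u : E × ℝ := (y₀, 1) with hu
  have hfst : Tendsto Prod.fst (𝓝 u) (𝓝 y₀) := continuous_fst.tendsto' _ _ rfl
  have hsnd : ∀ᶠ p : E × ℝ in 𝓝 u, p.2 ≠ 0 :=
    continuous_snd.continuousAt.eventually_ne one_ne_zero
  set Ω := extDeriv (coneForm A) with hΩ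
  have hcone : ∀ᶠ p in 𝓝 u, ContDiffAt ℝ ∞ (coneForm A) p :=
    (hfst.eventually hA).mono fun p hp => contDiffAt_coneForm hp
  have hΩs : ∀ᶠ p in 𝓝 u, ContDiffAt ℝ ∞ Ω p := hcone.mono fun p hp =>
    contDiffAt_extDeriv hp
  have hcl : ∀ᶠ p in 𝓝 u, extDeriv Ω p = 0 := hcone.mono fun p hp =>
    extDeriv_extDeriv_apply hp minSmoothness_two_le_infty
  have hrk : ∀ᶠ p in 𝓝 u, Module.finrank ℝ (LinearMap.ker
      ((Ω p).curryLeft : E × ℝ →ₗ[ℝ] (E × ℝ) [⋀^Fin n]→L[ℝ] ℝ)) = Module.finrank ℝ (LinearMap.ker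
      ((Ω u).curryLeft : E × ℝ →ₗ[ℝ] (E × ℝ) [⋀^Fin n]→L[ℝ] ℝ)) := by
    filter_upwards [hfst.eventually hA, hfst.eventually h0', hfst.eventually hr, hsnd]
      with p h1 h2 h3 h4
    rw [finrank_ker_extDeriv_coneForm (h1.differentiableAt (by simp)) h2 h4, h3,
      finrank_ker_extDeriv_coneForm (p := u) (hA.self_of_nhds.differentiableAt (by simp)) h0
      one_ne_zero]
  obtain ⟨l, hl1, hl⟩ : ∃ l : E × ℝ →L[ℝ] ℝ, l (0, 1) = 1 ∧
      ∀ v, (Ω u).curryLeft v = 0 → l v = 0 := by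
    have hmem : ((0, 1) : E × ℝ) ∉ LinearMap.ker
        ((Ω u).curryLeft : E × ℝ →ₗ[ℝ] (E × ℝ) [⋀^Fin n]→L[ℝ] ℝ) := fun h => by
      have h2 := ((curryLeft_extDeriv_coneForm_eq_zero_iff (p := u)
        (hA.self_of_nhds.differentiableAt (by simp)) _ _).1 h).2
      simp only [map_zero, smul_zero] at h2
      exact h0 (by simpa using h2.symm)
    obtain ⟨l, hl1, hl⟩ := Submodule.exists_le_ker_of_notMem hmem
    refine ⟨(l (0, 1))⁻¹ • LinearMap.toContinuousLinearMap l, ?_, fun v hv => ?_⟩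
    · exact inv_mul_cancel₀ hl1
    · have : l v = 0 := hl hv
      simp [this]
  obtain ⟨h, hh, hh'⟩ := exists_first_integral hΩs hcl hrk l hl
  obtain ⟨f, hf0, hf⟩ := exists_smooth_implicitFunction (f := h) (u := u)
    (hh'.mono fun p hp => hp.1) (by
      rw [hh]
      refine ⟨.refl ℝ ℝ, ?_⟩
      ext
      simpa using hl1.symm)
  refine ⟨f, hf0, ?_⟩
  have hfs := hf.self_of_nhds.2.1
  have hgt : Tendsto (fun y => (y, f y)) (𝓝 y₀) (𝓝 u) := by
    have := (continuousAt_id.prodMk hfs.continuousAt).tendsto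
    rwa [show (id y₀, f y₀) = u by rw [hu]; exact Prod.ext rfl hf0] at this
  filter_upwards [hf.eventually_nhds, hA, h0', hgt.eventually hh', hgt.eventually hsnd]
    with y hfy hAy h0y hhy hty
  obtain ⟨hf1, hf2, hf3, hf4⟩ := hfy.self_of_nhds
  refine ⟨hf2, ?_⟩
  rintro ζ ⟨hζ, b, hb⟩
  have hg : HasFDerivAt (fun y => (y, f y)) ((ContinuousLinearMap.id ℝ E).prod (fderiv ℝ f y)) y :=
    (hasFDerivAt_id y).prodMk (hf2.differentiableAt (by simp)).hasFDerivAt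
  have hker : (Ω (y, f y)).curryLeft (ζ, -(f y * b)) = 0 :=
    (curryLeft_extDeriv_coneForm_eq_zero_iff (hAy.differentiableAt (by simp)) _ _).2
      ⟨hζ, by simp only [hb, smul_smul, neg_neg]⟩
  have h1 : fderiv ℝ h (y, f y) (ζ, -(f y * b)) = 0 := hhy.2 _ hker
  have h2 : fderiv ℝ h (y, f y) (ζ, fderiv ℝ f y ζ) = 0 := by
    have hd := (hf3.differentiableAt (by simp)).hasFDerivAt.comp y hg
    have hc : (h ∘ fun y => (y, f y)) =ᶠ[𝓝 y] fun _ => h u := hfy.mono fun z hz => hz.1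
    have := hd.unique ((hasFDerivAt_const (h u) y).congr_of_eventuallyEq hc)
    exact DFunLike.congr_fun this ζ
  have h3 : fderiv ℝ f y ζ = -(f y * b) := by
    obtain ⟨e, he⟩ := hf4
    refine e.injective (?_ : (e : ℝ →L[ℝ] ℝ) _ = (e : ℝ →L[ℝ] ℝ) _)
    rw [he]
    have h4 := h2.trans h1.symm
    rw [← sub_eq_zero, ← map_sub] at h4 ⊢
    simpa using h4
  have hpull : extDeriv (fun z => (coneForm A (z, f z)).compContinuousLinearMap
      (fderiv ℝ (fun y => (y, f y)) z)) y = (extDeriv (coneForm A) (y, f y)).compContinuousLinearMap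
      (fderiv ℝ (fun y => (y, f y)) y) :=
    extDeriv_pullback (f := fun y => (y, f y)) (r := ∞)
      ((contDiffAt_coneForm hAy).differentiableAt (by simp)) (contDiffAt_id.prodMk hf2)
      minSmoothness_two_le_infty
  have heq : (fun z => f z • A z) =ᶠ[𝓝 y] fun z =>
      (coneForm A (z, f z)).compContinuousLinearMap (fderiv ℝ (fun y => (y, f y)) z) := by
    filter_upwards [hfy] with z hz
    have hz' : fderiv ℝ (fun y => (y, f y)) z = (ContinuousLinearMap.id ℝ E).prod (fderiv ℝ f z) :=
      ((hasFDerivAt_id z).prodMk (hz.2.1.differentiableAt (by simp)).hasFDerivAt).fderiv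
    rw [hz']
    rfl
  rw [heq.extDeriv_eq, hpull, hg.fderiv]
  rw [← h3] at hker
  rw [curryLeft_eq_zero_iff] at hker ⊢
  intro v
  rw [ContinuousAlternatingMap.compContinuousLinearMap_apply]
  refine apply_eq_zero_of_curryLeft_eq_zero (curryLeft_eq_zero_iff.2 hker) _ 0 rfl

/-- The characteristic distribution of a form, if of constant dimension, has smooth local sections
through each of its vectors. -/
theorem exists_smooth_section_proportionalityKernel {n : ℕ} {E : Type*} [NormedAddCommGroup E]
    [NormedSpace ℝ E] [FiniteDimensional ℝ E] {A : E → E [⋀^Fin n]→L[ℝ] ℝ} {y₀ : E}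
    (hA : ∀ᶠ y in 𝓝 y₀, ContDiffAt ℝ ∞ A y) (h0 : A y₀ ≠ 0)
    (hr : ∀ᶠ y in 𝓝 y₀, Module.finrank ℝ (proportionalityKernel (A y) (extDeriv A y)) =
      Module.finrank ℝ (proportionalityKernel (A y₀) (extDeriv A y₀)))
    {ζ : E} (hζ : ζ ∈ proportionalityKernel (A y₀) (extDeriv A y₀)) :
    ∃ Z : E → E, Z y₀ = ζ ∧ ∀ᶠ y in 𝓝 y₀, ContDiffAt ℝ ∞ Z y ∧
      Z y ∈ proportionalityKernel (A y) (extDeriv A y) := by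
  have h0' : ∀ᶠ y in 𝓝 y₀, A y ≠ 0 := hA.self_of_nhds.continuousAt.eventually_ne h0
  set L : E → E × ℝ →L[ℝ] (E × ℝ) [⋀^Fin n]→L[ℝ] ℝ := fun y =>
    (extDeriv (coneForm A) (y, 1)).curryLeft with hLdef
  have hL : ∀ᶠ y in 𝓝 y₀, ContDiffAt ℝ ∞ L y := by
    filter_upwards [hA] with y hy
    have h1 : ContDiffAt ℝ ∞ (fun z : E => extDeriv (coneForm A) (z, (1 : ℝ))) y :=
      ContDiffAt.comp (g := extDeriv (coneForm A)) (f := fun z => (z, (1 : ℝ))) y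
        (contDiffAt_extDeriv (contDiffAt_coneForm hy)) (contDiffAt_id.prodMk contDiffAt_const)
    exact contDiff_curryLeft.contDiffAt.comp y h1
  have hfr : ∀ y, ContDiffAt ℝ ∞ A y → A y ≠ 0 →
      Module.finrank ℝ (LinearMap.ker (L y : E × ℝ →ₗ[ℝ] (E × ℝ) [⋀^Fin n]→L[ℝ] ℝ)) =
      Module.finrank ℝ (proportionalityKernel (A y) (extDeriv A y)) := fun y h1 h2 =>
    finrank_ker_extDeriv_coneForm (p := (y, 1)) (h1.differentiableAt (by simp)) h2 one_ne_zero
  obtain ⟨K, hK⟩ : ∃ K, LinearMap.ker (L y₀ : E × ℝ →ₗ[ℝ] (E × ℝ) [⋀^Fin n]→L[ℝ] ℝ) = K :=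
    ⟨_, rfl⟩
  obtain ⟨P, S, -, hS0, hS⟩ := exists_smooth_kernel_frame hK hL (by
    filter_upwards [hA, h0', hr] with y h1 h2 h3
    rw [hfr y h1 h2, h3, ← hK, hfr y₀ hA.self_of_nhds h0])
  have hmem : ∀ y, ContDiffAt ℝ ∞ A y → ∀ q : E × ℝ, L y q = 0 →
      q.1 ∈ proportionalityKernel (A y) (extDeriv A y) := fun y h1 q hq => by
    obtain ⟨h2, h3⟩ := (curryLeft_extDeriv_coneForm_eq_zero_iff (p := (y, 1))
      (h1.differentiableAt (by simp)) q.1 q.2).1 hq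
    exact ⟨h2, -q.2, by simpa using h3⟩
  obtain ⟨h1, b, hb⟩ := hζ
  have hk : ((ζ, -b) : E × ℝ) ∈ K := by
    rw [← hK]
    exact (curryLeft_extDeriv_coneForm_eq_zero_iff (p := (y₀, 1))
      (hA.self_of_nhds.differentiableAt (by simp)) ζ (-b)).2 ⟨h1, by simp [hb]⟩
  refine ⟨fun y => (S y ⟨_, hk⟩).1, congrArg Prod.fst (hS0 _), ?_⟩
  filter_upwards [hS, hA] with y hy hAy
  exact ⟨contDiffAt_fst.comp y (hy.1.clm_apply contDiffAt_const), hmem y hAy _ (hy.2.2.1 _)⟩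

end FlatMultiple

section BundleStructure

variable {ι E F : Type*} [Fintype ι] [NormedAddCommGroup E] [NormedSpace ℝ E]
  [FiniteDimensional ℝ E] [NormedAddCommGroup F] [NormedSpace ℝ F] [FiniteDimensional ℝ F]

theorem contDiff_compContinuousLinearMapCLM {N : ℕ∞ω} :
    ContDiff ℝ N (fun L : E →L[ℝ] F => (ContinuousAlternatingMap.compContinuousLinearMapCLM L :
      (F [⋀^ι]→L[ℝ] ℝ) →L[ℝ] E [⋀^ι]→L[ℝ] ℝ)) :=
  contDiff_clm_apply_iff.2 fun _ => contDiff_compContinuousLinearMap.comp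
    (contDiff_const.prodMk contDiff_id)

end BundleStructure

section FormBundleManifold

variable {E : Type*} [NormedAddCommGroup E] [NormedSpace ℝ E] [FiniteDimensional ℝ E]
  {H : Type*} [TopologicalSpace H] {I : ModelWithCorners ℝ E H}
  {M : Type*} [TopologicalSpace M] [ChartedSpace H M] [IsManifold I ∞ M] {k : ℕ}

instance formBundle_vectorPrebundle_isContMDiff :
    (Bundle.ContinuousAlternatingMap.vectorPrebundle ℝ (Fin k) E (TangentSpace I : M → Type _) ℝ
      (Bundle.Trivial M ℝ)).IsContMDiff I ∞ where
  exists_contMDiffCoordChange := by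
    rintro _ ⟨e₁, e₂, he₁, he₂, rfl⟩ _ ⟨e₁', e₂', he₁', he₂', rfl⟩
    refine ⟨Pretrivialization.continuousAlternatingMapCoordChange ℝ (Fin k) e₁ e₁' e₂ e₂', ?_,
      Pretrivialization.continuousAlternatingMapCoordChange_apply⟩
    have h₁ := contMDiffOn_coordChangeL (IB := I) e₁' e₁ (n := ∞)
    have h₂ := contMDiffOn_coordChangeL (IB := I) e₂ e₂' (n := ∞)
    have h₃ : ContMDiffOn I 𝓘(ℝ, _) ∞ (fun b => (ContinuousAlternatingMap.compContinuousLinearMapCLM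
        (e₁'.coordChangeL ℝ e₁ b : E →L[ℝ] E) : (E [⋀^Fin k]→L[ℝ] ℝ) →L[ℝ] _)) _ :=
      contDiff_compContinuousLinearMapCLM.contMDiff.comp_contMDiffOn h₁
    have h₄ : ContMDiffOn I 𝓘(ℝ, ℝ) ∞ (fun b => (e₂.coordChangeL ℝ e₂' b : ℝ →L[ℝ] ℝ) 1) _ :=
      h₂.clm_apply contMDiffOn_const
    refine ((h₄.mono fun b hb => ⟨hb.1.2, hb.2.2⟩).smul
      (h₃.mono fun b hb => ⟨hb.2.1, hb.1.1⟩)).congr fun b _ => ?_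
    · ext A v
      change (e₂.coordChangeL ℝ e₂' b : ℝ →L[ℝ] ℝ) (A fun i => e₁'.coordChangeL ℝ e₁ b (v i)) =
        (e₂.coordChangeL ℝ e₂' b : ℝ →L[ℝ] ℝ) 1 * (A fun i => e₁'.coordChangeL ℝ e₁ b (v i))
      rw [mul_comm, ← smul_eq_mul, ← map_smul, smul_eq_mul, mul_one]

instance formBundle_contMDiffVectorBundle :
    ContMDiffVectorBundle ∞ (E [⋀^Fin k]→L[ℝ] ℝ)
      (fun x : M => TangentSpace I x [⋀^Fin k]→L[ℝ] Bundle.Trivial M ℝ x) I :=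
  (Bundle.ContinuousAlternatingMap.vectorPrebundle ℝ (Fin k) E (TangentSpace I : M → Type _) ℝ
      (Bundle.Trivial M ℝ)).contMDiffVectorBundle I

instance formBundle_isManifold : IsManifold (formModel I k) ∞ (FormBundle I M k) :=
  Bundle.TotalSpace.isManifold (n := ∞) (E [⋀^Fin k]→L[ℝ] ℝ)
    (fun x : M => TangentSpace I x [⋀^Fin k]→L[ℝ] Bundle.Trivial M ℝ x)

end FormBundleManifold

section ParametricForm

variable {E : Type*} [NormedAddCommGroup E] [NormedSpace ℝ E]
  {H : Type*} [TopologicalSpace H] {I : ModelWithCorners ℝ E H}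
  {M : Type*} [TopologicalSpace M] [ChartedSpace H M]
  {V : Type*} [NormedAddCommGroup V] [NormedSpace ℝ V] {k : ℕ}

/-- The pull-back of a form along a map from a normed space. -/
noncomputable def parametricForm (ψ : V → M) (μ : Form I M k) (v : V) : V [⋀^Fin k]→L[ℝ] ℝ :=
  formPullback (I' := 𝓘(ℝ, V)) ψ μ v

theorem parametricForm_apply (ψ : V → M) (μ : Form I M k) (v : V) (w : Fin k → V) :
    parametricForm ψ μ v w = μ (ψ v) (fun i => mfderiv 𝓘(ℝ, V) I ψ v (w i)) := rfl

theorem inChart_eq_parametricForm [I.Boundaryless] (μ : Form I M k) (x₀ : M) :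
    inChart μ x₀ = parametricForm (extChartAt I x₀).symm μ := by
  ext y w
  rw [parametricForm_apply, ← mfderivWithin_univ, ← I.range_eq_univ]
  rfl

theorem form_congr_apply (μ : Form I M k) {x x' : M} (h : x = x') (w : Fin k → E) :
    (μ x : E [⋀^Fin k]→L[ℝ] ℝ) w = (μ x' : E [⋀^Fin k]→L[ℝ] ℝ) w := by
  subst h; rfl

theorem inChart_extChartAt (μ : Form I M k) {x₀ x : M} (hx : x ∈ (extChartAt I x₀).source)
    (w : Fin k → E) :
    inChart μ x₀ (extChartAt I x₀ x) w = (μ x : E [⋀^Fin k]→L[ℝ] ℝ) (fun i =>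
      (mfderivWithin 𝓘(ℝ, E) I (extChartAt I x₀).symm (range I) (extChartAt I x₀ x) (w i) : E)) :=
  form_congr_apply μ ((extChartAt I x₀).left_inv hx) _

theorem inChart_extChartAt_mfderiv [IsManifold I 1 M] (μ : Form I M k) {x₀ x : M}
    (hx : x ∈ (extChartAt I x₀).source) (w : Fin k → TangentSpace I x) :
    inChart μ x₀ (extChartAt I x₀ x)
      (fun i => (mfderiv I 𝓘(ℝ, E) (extChartAt I x₀) x (w i) : E)) = μ x w := by
  refine (inChart_extChartAt μ hx _).trans ?_
  have h := mfderivWithin_extChartAt_symm_comp_mfderiv_extChartAt' hx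
  congr 1
  ext i
  exact DFunLike.congr_fun h (w i)

theorem parametricForm_eq_inChart [IsManifold I 1 M] (μ : Form I M k) {ψ : V → M} {v : V} {x₀ : M}
    (hψ : MDifferentiableAt 𝓘(ℝ, V) I ψ v) (hx : ψ v ∈ (extChartAt I x₀).source) :
    parametricForm ψ μ v = (inChart μ x₀ (extChartAt I x₀ (ψ v))).compContinuousLinearMap
      (fderiv ℝ (extChartAt I x₀ ∘ ψ) v) := by
  ext w
  rw [parametricForm_apply, ContinuousAlternatingMap.compContinuousLinearMap_apply,
    ← inChart_extChartAt_mfderiv μ hx]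
  congr 1
  ext i
  have h1 := mfderiv_comp v (mdifferentiableAt_extChartAt (I := I) (x := x₀) (y := ψ v)
    (by simpa using hx)) hψ
  rw [mfderiv_eq_fderiv] at h1
  exact (DFunLike.congr_fun h1 (w i)).symm

theorem contDiffAt_extChartAt_comp [IsManifold I ∞ M] {ψ : V → M} {v : V} {x₀ : M}
    (hψ : ContMDiffAt 𝓘(ℝ, V) I ∞ ψ v) (hx : ψ v ∈ (extChartAt I x₀).source) :
    ContDiffAt ℝ ∞ (extChartAt I x₀ ∘ ψ) v :=
  ((contMDiffAt_extChartAt' (by simpa using hx)).comp v hψ).contDiffAt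

theorem eventually_parametricForm_eq_inChart [IsManifold I ∞ M] (μ : Form I M k) {ψ : V → M}
    {v : V} {x₀ : M} (hψ : ContMDiffAt 𝓘(ℝ, V) I ∞ ψ v) (hx : ψ v ∈ (extChartAt I x₀).source) :
    parametricForm ψ μ =ᶠ[𝓝 v] fun z => (inChart μ x₀ ((extChartAt I x₀ ∘ ψ)
      z)).compContinuousLinearMap (fderiv ℝ (extChartAt I x₀ ∘ ψ) z) := by
  have : IsManifold I 1 M := .of_le (n := ∞) (by simp)
  have h1 : ∀ᶠ z in 𝓝 v, ContMDiffAt 𝓘(ℝ, V) I 1 ψ z :=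
    contMDiffAt_iff_contMDiffAt_nhds (by simp) |>.1 (hψ.of_le (by simp))
  filter_upwards [h1, hψ.continuousAt.eventually ((isOpen_extChartAt_source x₀).mem_nhds hx)]
    with z hz hz'
  exact parametricForm_eq_inChart μ (hz.mdifferentiableAt (by simp)) hz'

theorem contDiffAt_parametricForm [IsManifold I ∞ M] [FiniteDimensional ℝ V] {μ : Form I M k}
    {ψ : V → M} {v : V} {x₀ : M} (hψ : ContMDiffAt 𝓘(ℝ, V) I ∞ ψ v)
    (hx : ψ v ∈ (extChartAt I x₀).source)
    (hμ : ContDiffAt ℝ ∞ (inChart μ x₀) (extChartAt I x₀ (ψ v))) :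
    ContDiffAt ℝ ∞ (parametricForm ψ μ) v := by
  have h1 := contDiffAt_extChartAt_comp hψ hx
  refine ContDiffAt.congr_of_eventuallyEq ?_ (eventually_parametricForm_eq_inChart μ hψ hx)
  exact (hμ.comp v h1).compContinuousLinearMap_alternating (h1.fderiv_right (by simp))

theorem extDeriv_parametricForm [IsManifold I ∞ M] {μ : Form I M k}
    {ψ : V → M} {v : V} {x₀ : M} (hψ : ContMDiffAt 𝓘(ℝ, V) I ∞ ψ v)
    (hx : ψ v ∈ (extChartAt I x₀).source)
    (hμ : ContDiffAt ℝ ∞ (inChart μ x₀) (extChartAt I x₀ (ψ v))) :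
    extDeriv (parametricForm ψ μ) v = (extDeriv (inChart μ x₀)
      (extChartAt I x₀ (ψ v))).compContinuousLinearMap (fderiv ℝ (extChartAt I x₀ ∘ ψ) v) := by
  rw [(eventually_parametricForm_eq_inChart μ hψ hx).extDeriv_eq]
  exact extDeriv_pullback (hμ.differentiableAt (by simp)) (contDiffAt_extChartAt_comp hψ hx)
    minSmoothness_two_le_infty

/-- Smoothness of a form at a point, in the preferred chart. -/
def SmoothFormAt (μ : Form I M k) (x : M) : Prop :=
  ContDiffAt ℝ ∞ (inChart μ x) (extChartAt I x x)

theorem parametricForm_extD [IsManifold I ∞ M] [I.Boundaryless] {μ : Form I M k} {ψ : V → M} {v : V}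
    (hψ : ContMDiffAt 𝓘(ℝ, V) I ∞ ψ v) (hμ : SmoothFormAt μ (ψ v)) :
    parametricForm ψ (extD μ) v = extDeriv (parametricForm ψ μ) v := by
  rw [extDeriv_parametricForm hψ (mem_extChartAt_source _) hμ]
  ext w
  have h1 := mfderiv_comp v (mdifferentiableAt_extChartAt (I := I) (x := ψ v) (y := ψ v)
    (mem_chart_source H _)) (hψ.mdifferentiableAt (by simp))
  rw [mfderiv_eq_fderiv] at h1
  rw [ContinuousAlternatingMap.compContinuousLinearMap_apply, h1, ← extDerivWithin_univ,
    ← I.range_eq_univ]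
  rfl

theorem contMDiffAt_extChartAt_symm [IsManifold I ∞ M] [I.Boundaryless] {x₀ : M} {y : E}
    (hy : y ∈ (extChartAt I x₀).target) : ContMDiffAt 𝓘(ℝ, E) I ∞ (extChartAt I x₀).symm y :=
  (contMDiffOn_extChartAt_symm x₀).contMDiffAt ((isOpen_extChartAt_target x₀).mem_nhds hy)

theorem SmoothFormAt.contDiffAt_inChart [IsManifold I ∞ M] [I.Boundaryless] [FiniteDimensional ℝ E]
    {μ : Form I M k} {x₀ : M} {y : E} (hy : y ∈ (extChartAt I x₀).target)
    (hμ : SmoothFormAt μ ((extChartAt I x₀).symm y)) : ContDiffAt ℝ ∞ (inChart μ x₀) y := by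
  rw [inChart_eq_parametricForm]
  exact contDiffAt_parametricForm (contMDiffAt_extChartAt_symm hy) (mem_extChartAt_source _) hμ

theorem SmoothFormAt.contDiffAt_parametricForm [IsManifold I ∞ M]
    [FiniteDimensional ℝ V] {μ : Form I M k} {ψ : V → M} {v : V}
    (hψ : ContMDiffAt 𝓘(ℝ, V) I ∞ ψ v) (hμ : SmoothFormAt μ (ψ v)) :
    ContDiffAt ℝ ∞ (parametricForm ψ μ) v :=
  Multicontact.contDiffAt_parametricForm hψ (mem_extChartAt_source _) hμ

theorem inChart_extD [IsManifold I ∞ M] [I.Boundaryless] {μ : Form I M k} {x₀ : M} {y : E}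
    (hy : y ∈ (extChartAt I x₀).target) (hμ : SmoothFormAt μ ((extChartAt I x₀).symm y)) :
    inChart (extD μ) x₀ y = extDeriv (inChart μ x₀) y := by
  rw [inChart_eq_parametricForm, inChart_eq_parametricForm]
  exact parametricForm_extD (contMDiffAt_extChartAt_symm hy) hμ

theorem smoothFormAt_of_contDiffAt_inChart [IsManifold I ∞ M] [I.Boundaryless]
    [FiniteDimensional ℝ E] {μ : Form I M k} {x₀ x : M} (hx : x ∈ (extChartAt I x₀).source)
    (hμ : ContDiffAt ℝ ∞ (inChart μ x₀) (extChartAt I x₀ x)) : SmoothFormAt μ x := by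
  rw [SmoothFormAt, inChart_eq_parametricForm]
  have h1 : (extChartAt I x).symm (extChartAt I x x) = x := extChartAt_to_inv x
  refine Multicontact.contDiffAt_parametricForm (x₀ := x₀)
    (contMDiffAt_extChartAt_symm (mem_extChartAt_target x)) ?_ ?_
  · rwa [h1]
  · rwa [h1]

theorem eventually_nhds_chart [I.Boundaryless] {p : M → Prop} {x : M} (h : ∀ᶠ z in 𝓝 x, p z) :
    ∀ᶠ y in 𝓝 (extChartAt I x x), y ∈ (extChartAt I x).target ∧ p ((extChartAt I x).symm y) := by
  refine Filter.Eventually.and (extChartAt_target_mem_nhds x) ?_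
  have := (continuousAt_extChartAt_symm (I := I) x).tendsto
  rw [extChartAt_to_inv] at this
  exact this.eventually h

theorem smoothFormAt_extD [IsManifold I ∞ M] [I.Boundaryless] [FiniteDimensional ℝ E]
    {μ : Form I M k} {x : M} (hμ : ∀ᶠ z in 𝓝 x, SmoothFormAt μ z) : SmoothFormAt (extD μ) x := by
  have h1 : inChart (extD μ) x =ᶠ[𝓝 (extChartAt I x x)] extDeriv (inChart μ x) :=
    (eventually_nhds_chart hμ).mono fun y hy => inChart_extD hy.1 hy.2
  exact (contDiffAt_extDeriv hμ.self_of_nhds).congr_of_eventuallyEq h1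

theorem extD_congr [I.Boundaryless] {μ ν : Form I M k} {x : M} (h : ∀ᶠ z in 𝓝 x, μ z = ν z) :
    extD μ x = extD ν x := by
  have h1 : inChart μ x =ᶠ[𝓝 (extChartAt I x x)] inChart ν x :=
    (eventually_nhds_chart h).mono fun y hy => by rw [inChart, inChart, hy.2]
  rw [extD, extD, I.range_eq_univ, extDerivWithin_univ, extDerivWithin_univ, h1.extDeriv_eq]

section Pullback

variable {E' : Type*} [NormedAddCommGroup E'] [NormedSpace ℝ E']
  {H' : Type*} [TopologicalSpace H'] {I' : ModelWithCorners ℝ E' H'}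
  {M' : Type*} [TopologicalSpace M'] [ChartedSpace H' M']

theorem parametricForm_formPullback {f : M' → M} (μ : Form I M k) {ψ : V → M'} {v : V}
    (hψ : MDifferentiableAt 𝓘(ℝ, V) I' ψ v) (hf : MDifferentiableAt I' I f (ψ v)) :
    parametricForm ψ (formPullback (I' := I') f μ) v = parametricForm (f ∘ ψ) μ v := by
  ext w
  have h1 := mfderiv_comp v hf hψ
  rw [parametricForm_apply, parametricForm_apply, h1]
  rfl

theorem smoothFormAt_formPullback [IsManifold I ∞ M] [IsManifold I' ∞ M'] [I'.Boundaryless]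
    [FiniteDimensional ℝ E'] {f : M' → M} {μ : Form I M k} {x : M'} (hf : ContMDiff I' I ∞ f)
    (hμ : SmoothFormAt μ (f x)) : SmoothFormAt (formPullback (I' := I') f μ) x := by
  rw [SmoothFormAt, inChart_eq_parametricForm]
  have h1 : parametricForm (extChartAt I' x).symm (formPullback (I' := I') f μ)
      =ᶠ[𝓝 (extChartAt I' x x)] parametricForm (f ∘ (extChartAt I' x).symm) μ := by
    filter_upwards [extChartAt_target_mem_nhds (I := I') x] with y hy
    exact parametricForm_formPullback μ
      ((contMDiffAt_extChartAt_symm hy).mdifferentiableAt (by simp))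
      ((hf _).mdifferentiableAt (by simp))
  refine ContDiffAt.congr_of_eventuallyEq ?_ h1
  refine SmoothFormAt.contDiffAt_parametricForm ?_ ?_
  · exact (hf _).comp _ (contMDiffAt_extChartAt_symm (mem_extChartAt_target x))
  · rwa [Function.comp_apply, extChartAt_to_inv]

end Pullback

end ParametricForm

section FormCoordinates

variable {E : Type*} [NormedAddCommGroup E] [NormedSpace ℝ E]
  {H : Type*} [TopologicalSpace H] {I : ModelWithCorners ℝ E H}
  {M : Type*} [TopologicalSpace M] [ChartedSpace H M] [IsManifold I ∞ M]
  {V : Type*} [NormedAddCommGroup V] [NormedSpace ℝ V] {k : ℕ}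

/-- The fiber coordinate on `∧ᵏ T*M` defined by the preferred chart at `x₀`. -/
noncomputable def formCoord (x₀ : M) (α : FormBundle I M k) : E [⋀^Fin k]→L[ℝ] ℝ :=
  (trivializationAt (E [⋀^Fin k]→L[ℝ] ℝ)
    (fun x : M => TangentSpace I x [⋀^Fin k]→L[ℝ] Bundle.Trivial M ℝ x) x₀ α).2

theorem formCoord_apply {x₀ : M} {α : FormBundle I M k} (hα : α.1 ∈ (extChartAt I x₀).source)
    (w : Fin k → E) : formCoord x₀ α w = (α.2 : E [⋀^Fin k]→L[ℝ] ℝ) (fun i =>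
      (mfderivWithin 𝓘(ℝ, E) I (extChartAt I x₀).symm (range I) (extChartAt I x₀ α.1) (w i) : E)) := by
  have : IsManifold I 1 M := .of_le (n := ∞) (by simp)
  have h1 := TangentBundle.symmL_trivializationAt (I := I) (x₀ := x₀) (x := α.1) (by simpa using hα)
  have h2 : formCoord x₀ α w = (α.2 : E [⋀^Fin k]→L[ℝ] ℝ) (fun i =>
      ((trivializationAt E (TangentSpace I) x₀).symmL ℝ α.1 (w i) : E)) := by
    change ((trivializationAt ℝ (Bundle.Trivial M ℝ) x₀).continuousLinearMapAt ℝ α.1) _ = _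
    exact DFunLike.congr_fun
      (Bundle.Trivial.continuousLinearMapAt_trivialization ℝ M ℝ α.1) _
  rw [h2, h1]
  rfl

theorem formCoord_section (μ : Form I M k) {x₀ x : M} (hx : x ∈ (extChartAt I x₀).source) :
    formCoord x₀ (⟨x, μ x⟩ : FormBundle I M k) = inChart μ x₀ (extChartAt I x₀ x) := by
  ext w
  exact (formCoord_apply hx w).trans (inChart_extChartAt μ hx w).symm

theorem apply_eq_formCoord {x₀ : M} {α : FormBundle I M k} (hα : α.1 ∈ (extChartAt I x₀).source)
    (w : Fin k → TangentSpace I α.1) :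
    (α.2 : TangentSpace I α.1 [⋀^Fin k]→L[ℝ] ℝ) w = formCoord x₀ α
      (fun i => (mfderiv I 𝓘(ℝ, E) (extChartAt I x₀) α.1 (w i) : E)) := by
  have : IsManifold I 1 M := .of_le (n := ∞) (by simp)
  refine Eq.trans ?_ (formCoord_apply hα _).symm
  have h := mfderivWithin_extChartAt_symm_comp_mfderiv_extChartAt' (I := I) hα
  congr 1
  ext i
  exact (DFunLike.congr_fun h (w i)).symm

/-- The form on `T_x M` with a given fiber coordinate. -/
noncomputable def ofFormCoord (x₀ x : M) (β : E [⋀^Fin k]→L[ℝ] ℝ) : FormBundle I M k :=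
  ⟨x, ContinuousAlternatingMap.compContinuousLinearMap (M := TangentSpace I x) β
    (mfderiv I 𝓘(ℝ, E) (extChartAt I x₀) x)⟩

theorem formCoord_ofFormCoord {x₀ x : M} (hx : x ∈ (extChartAt I x₀).source)
    (β : E [⋀^Fin k]→L[ℝ] ℝ) : formCoord x₀ (ofFormCoord (I := I) x₀ x β) = β := by
  have : IsManifold I 1 M := .of_le (n := ∞) (by simp)
  ext w
  refine (formCoord_apply hx w).trans ?_
  have h := mfderiv_extChartAt_comp_mfderivWithin_extChartAt_symm' hx
  change β _ = β w
  congr 1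
  ext i
  exact DFunLike.congr_fun h (w i)

theorem ofFormCoord_formCoord {x₀ : M} {α : FormBundle I M k}
    (hα : α.1 ∈ (extChartAt I x₀).source) : ofFormCoord x₀ α.1 (formCoord x₀ α) = α := by
  obtain ⟨x, A⟩ := α
  have : (ofFormCoord x₀ x (formCoord x₀ ⟨x, A⟩) : FormBundle I M k).2 = A := by
    ext w
    exact (apply_eq_formCoord (α := ⟨x, A⟩) hα w).symm
  exact congrArg (TotalSpace.mk x) this

theorem formCoord_injective {x₀ : M} {α β : FormBundle I M k}
    (hα : α.1 ∈ (extChartAt I x₀).source) (h1 : α.1 = β.1) (h : formCoord x₀ α = formCoord x₀ β) :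
    α = β := by
  rw [← ofFormCoord_formCoord hα, h, h1, ofFormCoord_formCoord (h1 ▸ hα)]

theorem parametricForm_tautologicalForm {ψ : V → FormBundle I M k} {v : V} {x₀ : M}
    (hψ : MDifferentiableAt 𝓘(ℝ, V) (formModel I k) ψ v)
    (hv : (ψ v).1 ∈ (extChartAt I x₀).source) :
    parametricForm ψ (tautologicalForm I M k) v = (formCoord x₀ (ψ v)).compContinuousLinearMap
      (fderiv ℝ (fun z => extChartAt I x₀ (ψ z).1) v) := by
  have : IsManifold I 1 M := .of_le (n := ∞) (by simp)
  ext w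
  have hp : MDifferentiableAt (formModel I k) I
      (TotalSpace.proj : FormBundle I M k → M) (ψ v) :=
    (Bundle.contMDiffAt_proj (n := ∞)
      (fun x : M => TangentSpace I x [⋀^Fin k]→L[ℝ] Bundle.Trivial M ℝ x)).mdifferentiableAt
      (by simp)
  have h1 := mfderiv_comp v hp hψ
  have h2 := mfderiv_comp v (mdifferentiableAt_extChartAt (I := I) (x := x₀) (y := (ψ v).1)
    (by simpa using hv)) (hp.comp v hψ)
  rw [mfderiv_eq_fderiv] at h2
  have h3 := apply_eq_formCoord hv (fun i => mfderiv (formModel I k) I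
      (TotalSpace.proj : FormBundle I M k → M) (ψ v) (mfderiv 𝓘(ℝ, V) (formModel I k) ψ v (w i)))
  refine h3.trans ?_
  rw [ContinuousAlternatingMap.compContinuousLinearMap_apply]
  congr 1
  ext i
  refine (Eq.trans ?_ (DFunLike.congr_fun h2 (w i)).symm)
  have h4 := DFunLike.congr_fun h1 (w i)
  exact congrArg (mfderiv I 𝓘(ℝ, E) (extChartAt I x₀) (ψ v).1) h4.symm

variable [FiniteDimensional ℝ E]

theorem contMDiffAt_formBundle_iff {E' : Type*} [NormedAddCommGroup E'] [NormedSpace ℝ E']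
    {H' : Type*} [TopologicalSpace H'] {I' : ModelWithCorners ℝ E' H'}
    {M' : Type*} [TopologicalSpace M'] [ChartedSpace H' M'] {ψ : M' → FormBundle I M k} {v : M'}
    {x₀ : M} (hv : (ψ v).1 ∈ (extChartAt I x₀).source) :
    ContMDiffAt I' (formModel I k) ∞ ψ v ↔ ContMDiffAt I' I ∞ (fun z => (ψ z).1) v ∧
      ContMDiffAt I' 𝓘(ℝ, E [⋀^Fin k]→L[ℝ] ℝ) ∞ (fun z => formCoord x₀ (ψ z)) v := by
  refine Trivialization.contMDiffAt_iff (e := trivializationAt (E [⋀^Fin k]→L[ℝ] ℝ)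
    (fun x : M => TangentSpace I x [⋀^Fin k]→L[ℝ] Bundle.Trivial M ℝ x) x₀) ?_
  rw [FiberBundle.trivializationAt_continuousAlternatingMap_source]
  exact ⟨by simpa using hv, mem_univ _⟩

theorem contMDiffAt_section_iff_smoothFormAt [I.Boundaryless] {μ : Form I M k} {x : M} :
    ContMDiffAt I (formModel I k) ∞ (fun x => (⟨x, μ x⟩ : FormBundle I M k)) x ↔
      SmoothFormAt μ x := by
  rw [contMDiffAt_formBundle_iff (x₀ := x) (mem_extChartAt_source x)]
  refine (and_iff_right (contMDiffAt_id (M := M))).trans ?_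
  have h1 : (fun z => formCoord x (⟨z, μ z⟩ : FormBundle I M k)) =ᶠ[𝓝 x]
      inChart μ x ∘ extChartAt I x := by
    filter_upwards [extChartAt_source_mem_nhds (I := I) x] with z hz using formCoord_section μ hz
  rw [h1.contMDiffAt_iff]
  refine ⟨fun h => ?_, fun h => h.contMDiffAt.comp x contMDiffAt_extChartAt⟩
  have h2 := ContMDiffAt.comp (extChartAt I x x) (by rwa [extChartAt_to_inv])
    (contMDiffAt_extChartAt_symm (I := I) (mem_extChartAt_target x))
  refine h2.contDiffAt.congr_of_eventuallyEq ?_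
  filter_upwards [extChartAt_target_mem_nhds (I := I) x] with y hy
  rw [Function.comp_apply, Function.comp_apply, (extChartAt I x).right_inv hy]

theorem isSmoothForm_iff [I.Boundaryless] {μ : Form I M k} :
    IsSmoothForm μ ↔ ∀ x, SmoothFormAt μ x :=
  forall_congr' fun _ => contMDiffAt_section_iff_smoothFormAt

theorem smoothFormAt_tautologicalForm [I.Boundaryless] (α : FormBundle I M k) :
    SmoothFormAt (tautologicalForm I M k) α := by
  have hT : (extChartAt (formModel I k) α).target ∈ 𝓝 (extChartAt (formModel I k) α α) :=
    extChartAt_target_mem_nhds α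
  set ψ := (extChartAt (formModel I k) α).symm with hψdef
  have hs : ∀ y ∈ (extChartAt (formModel I k) α).target,
      ContMDiffAt 𝓘(ℝ, E × (E [⋀^Fin k]→L[ℝ] ℝ)) (formModel I k) ∞ ψ y := fun y hy =>
    contMDiffAt_extChartAt_symm hy
  have h0 : ψ (extChartAt (formModel I k) α α) = α := extChartAt_to_inv α
  have hα := hs _ (mem_extChartAt_target α)
  have hmem : (ψ (extChartAt (formModel I k) α α)).1 ∈ (extChartAt I α.1).source := by
    rw [h0]; exact mem_extChartAt_source _
  obtain ⟨h1, h2⟩ := (contMDiffAt_formBundle_iff hmem).1 hα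
  rw [SmoothFormAt, inChart_eq_parametricForm]
  have h3 : ContDiffAt ℝ ∞ (fun z => extChartAt I α.1 (ψ z).1) (extChartAt (formModel I k) α α) :=
    contDiffAt_extChartAt_comp h1 hmem
  have h4 : parametricForm ψ (tautologicalForm I M k) =ᶠ[𝓝 (extChartAt (formModel I k) α α)]
      fun v => (formCoord α.1 (ψ v)).compContinuousLinearMap
        (fderiv ℝ (fun z => extChartAt I α.1 (ψ z).1) v) := by
    filter_upwards [hT, h1.continuousAt.eventually ((isOpen_extChartAt_source α.1).mem_nhds hmem)]
      with v hv hv'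
    exact parametricForm_tautologicalForm ((hs v hv).mdifferentiableAt (by simp)) hv'
  exact (h2.contDiffAt.compContinuousLinearMap_alternating
    (h3.fderiv_right (by simp))).congr_of_eventuallyEq h4

end FormCoordinates

section VectorFields

variable {E : Type*} [NormedAddCommGroup E] [NormedSpace ℝ E]
  {M : Type*} [TopologicalSpace M] [ChartedSpace E M]

/-- The coordinate expression of a vector field in the preferred chart at `x₀`. -/
noncomputable def vecCoord (x₀ : M) (X : ∀ x : M, TangentSpace 𝓘(ℝ, E) x) (y : E) : E :=
  mfderiv 𝓘(ℝ, E) 𝓘(ℝ, E) (extChartAt 𝓘(ℝ, E) x₀) ((extChartAt 𝓘(ℝ, E) x₀).symm y)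
    (X ((extChartAt 𝓘(ℝ, E) x₀).symm y))

theorem vecCoord_extChartAt (X : ∀ x : M, TangentSpace 𝓘(ℝ, E) x) {x₀ x : M}
    (hx : x ∈ (extChartAt 𝓘(ℝ, E) x₀).source) : vecCoord x₀ X (extChartAt 𝓘(ℝ, E) x₀ x) =
      (mfderiv 𝓘(ℝ, E) 𝓘(ℝ, E) (extChartAt 𝓘(ℝ, E) x₀) x (X x) : E) := by
  rw [vecCoord, (extChartAt 𝓘(ℝ, E) x₀).left_inv hx]

/-- The vector field with a given coordinate expression in the preferred chart at `x₀`. -/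
noncomputable def ofVecCoord (x₀ : M) (Z : E → E) (x : M) : TangentSpace 𝓘(ℝ, E) x :=
  (mfderiv 𝓘(ℝ, E) 𝓘(ℝ, E) (extChartAt 𝓘(ℝ, E) x₀) x).inverse (Z (extChartAt 𝓘(ℝ, E) x₀ x))

variable [IsManifold 𝓘(ℝ, E) ∞ M]

theorem mfderiv_ofVecCoord (Z : E → E) {x₀ x : M} (hx : x ∈ (extChartAt 𝓘(ℝ, E) x₀).source) :
    (mfderiv 𝓘(ℝ, E) 𝓘(ℝ, E) (extChartAt 𝓘(ℝ, E) x₀) x (ofVecCoord x₀ Z x) : E) =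
      Z (extChartAt 𝓘(ℝ, E) x₀ x) := by
  have : IsManifold 𝓘(ℝ, E) 1 M := .of_le (n := ∞) (by simp)
  exact (isInvertible_mfderiv_extChartAt hx).self_apply_inverse _

theorem mfderiv_extChartAt_injective {x₀ x : M} (hx : x ∈ (extChartAt 𝓘(ℝ, E) x₀).source) :
    Function.Injective (mfderiv 𝓘(ℝ, E) 𝓘(ℝ, E) (extChartAt 𝓘(ℝ, E) x₀) x) := by
  have : IsManifold 𝓘(ℝ, E) 1 M := .of_le (n := ∞) (by simp)
  exact (isInvertible_mfderiv_extChartAt hx).injective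

theorem mfderiv_extChartAt_surjective {x₀ x : M} (hx : x ∈ (extChartAt 𝓘(ℝ, E) x₀).source) :
    Function.Surjective (mfderiv 𝓘(ℝ, E) 𝓘(ℝ, E) (extChartAt 𝓘(ℝ, E) x₀) x) := by
  have : IsManifold 𝓘(ℝ, E) 1 M := .of_le (n := ∞) (by simp)
  exact (isInvertible_mfderiv_extChartAt hx).surjective

theorem contMDiffAt_vectorField_iff {X : ∀ x : M, TangentSpace 𝓘(ℝ, E) x} {x₀ x : M}
    (hx : x ∈ (extChartAt 𝓘(ℝ, E) x₀).source) :
    ContMDiffAt 𝓘(ℝ, E) 𝓘(ℝ, E).tangent ∞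
      (fun x => (⟨x, X x⟩ : TangentBundle 𝓘(ℝ, E) M)) x ↔
    ContMDiffAt 𝓘(ℝ, E) 𝓘(ℝ, E) ∞ (fun z => (mfderiv 𝓘(ℝ, E) 𝓘(ℝ, E) (extChartAt 𝓘(ℝ, E) x₀) z
      (X z) : E)) x := by
  have : IsManifold 𝓘(ℝ, E) 1 M := .of_le (n := ∞) (by simp)
  have h1 := Trivialization.contMDiffAt_section_iff (IB := 𝓘(ℝ, E)) (n := ∞) (s := X) (x₀ := x)
    (trivializationAt E (TangentSpace 𝓘(ℝ, E)) x₀) (by simpa using hx)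
  refine h1.trans (Filter.EventuallyEq.contMDiffAt_iff ?_)
  filter_upwards [(isOpen_extChartAt_source (I := 𝓘(ℝ, E)) x₀).mem_nhds hx] with z hz
  refine Eq.trans ?_ (DFunLike.congr_fun
    (TangentBundle.continuousLinearMapAt_trivializationAt (I := 𝓘(ℝ, E)) (x₀ := x₀) (x := z)
      (by simpa using hz)) (X z))
  rw [Trivialization.continuousLinearMapAt_apply, Trivialization.linearMapAt_apply,
    if_pos (by simpa using hz)]

theorem contDiffAt_vecCoord {X : ∀ x : M, TangentSpace 𝓘(ℝ, E) x} {x₀ : M} {y : E}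
    (hy : y ∈ (extChartAt 𝓘(ℝ, E) x₀).target)
    (hX : ContMDiffAt 𝓘(ℝ, E) 𝓘(ℝ, E).tangent ∞ (fun x => (⟨x, X x⟩ : TangentBundle 𝓘(ℝ, E) M))
      ((extChartAt 𝓘(ℝ, E) x₀).symm y)) : ContDiffAt ℝ ∞ (vecCoord x₀ X) y := by
  rw [contMDiffAt_vectorField_iff ((extChartAt 𝓘(ℝ, E) x₀).map_target hy)] at hX
  exact (hX.comp y (contMDiffAt_extChartAt_symm hy)).contDiffAt

theorem contMDiffAt_ofVecCoord {Z : E → E} {x₀ x : M} (hx : x ∈ (extChartAt 𝓘(ℝ, E) x₀).source)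
    (hZ : ContDiffAt ℝ ∞ Z (extChartAt 𝓘(ℝ, E) x₀ x)) :
    ContMDiffAt 𝓘(ℝ, E) 𝓘(ℝ, E).tangent ∞
      (fun x => (⟨x, ofVecCoord x₀ Z x⟩ : TangentBundle 𝓘(ℝ, E) M)) x := by
  rw [contMDiffAt_vectorField_iff hx]
  refine (hZ.contMDiffAt.comp x (contMDiffAt_extChartAt' (by simpa using hx))).congr_of_eventuallyEq
    ?_
  filter_upwards [(isOpen_extChartAt_source (I := 𝓘(ℝ, E)) x₀).mem_nhds hx] with z hz
  exact mfderiv_ofVecCoord Z hz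

theorem mfderiv_mlieBracket (X Y : ∀ x : M, TangentSpace 𝓘(ℝ, E) x) (x : M) :
    (mfderiv 𝓘(ℝ, E) 𝓘(ℝ, E) (extChartAt 𝓘(ℝ, E) x) x (mlieBracket 𝓘(ℝ, E) X Y x) : E) =
      lieBracket ℝ (vecCoord x X) (vecCoord x Y) (extChartAt 𝓘(ℝ, E) x x) := by
  have : IsManifold 𝓘(ℝ, E) 1 M := .of_le (n := ∞) (by simp)
  have h1 : ∀ W : ∀ x : M, TangentSpace 𝓘(ℝ, E) x,
      mpullbackWithin 𝓘(ℝ, E) 𝓘(ℝ, E) (extChartAt 𝓘(ℝ, E) x).symm W (range 𝓘(ℝ, E))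
        =ᶠ[𝓝 (extChartAt 𝓘(ℝ, E) x x)] vecCoord x W := by
    intro W
    filter_upwards [extChartAt_target_mem_nhds (I := 𝓘(ℝ, E)) x] with y hy
    rw [mpullbackWithin_apply, vecCoord, ContinuousLinearMap.inverse_eq
      (mfderivWithin_extChartAt_symm_comp_mfderiv_extChartAt hy)
      (mfderiv_extChartAt_comp_mfderivWithin_extChartAt_symm hy)]
    rfl
  rw [← mlieBracketWithin_univ, mlieBracketWithin_apply]
  refine ((isInvertible_mfderiv_extChartAt (mem_extChartAt_source x)).self_apply_inverse _).trans ?_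
  rw [preimage_univ, univ_inter, 𝓘(ℝ, E).range_eq_univ]
  have h2 := h1 X
  have h3 := h1 Y
  rw [𝓘(ℝ, E).range_eq_univ] at h2 h3
  exact (congrFun (lieBracketWithin_univ (𝕜 := ℝ) (E := E)) _).trans
    (Filter.EventuallyEq.lieBracket_vectorField_eq (𝕜 := ℝ) (E := E) h2 h3)

section Extension

variable [FiniteDimensional ℝ E] [T2Space M] {C : ∀ x : M, Submodule ℝ (TangentSpace 𝓘(ℝ, E) x)}

/-- A local section of a distribution agrees, near a given point, with a global one. -/
theorem exists_isSection_eventuallyEq {X : ∀ x : M, TangentSpace 𝓘(ℝ, E) x} {x : M}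
    (hX : ∀ᶠ z in 𝓝 x, ContMDiffAt 𝓘(ℝ, E) 𝓘(ℝ, E).tangent ∞
      (fun x => (⟨x, X x⟩ : TangentBundle 𝓘(ℝ, E) M)) z ∧ X z ∈ C z) :
    ∃ X', IsSection C X' ∧ ∀ᶠ z in 𝓝 x, X' z = X z := by
  obtain ⟨U, hU, hUo, hxU⟩ := eventually_nhds_iff.1 hX
  obtain ⟨f, -, hf⟩ := (SmoothBumpFunction.nhds_basis_tsupport (I := 𝓘(ℝ, E)) x).mem_iff.1
    (hUo.mem_nhds hxU)
  refine ⟨fun z => f z • X z, ⟨?_, fun z => ?_⟩, ?_⟩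
  · exact ContMDiffOn.smul_section_of_tsupport f.contMDiff.contMDiffOn hUo hf
      fun z hz => (hU z hz).1.contMDiffWithinAt
  · by_cases hz : z ∈ U
    · exact (C z).smul_mem _ (hU z hz).2
    · have : f z = 0 := image_eq_zero_of_notMem_tsupport fun h => hz (hf h)
      rw [this, zero_smul]
      exact (C z).zero_mem
  · filter_upwards [f.eventuallyEq_one] with z hz
    rw [hz, Pi.one_apply, one_smul]

end Extension

end VectorFields

theorem extD_apply {E : Type*} [NormedAddCommGroup E] [NormedSpace ℝ E]
    {H : Type*} [TopologicalSpace H] {I : ModelWithCorners ℝ E H} [I.Boundaryless]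
    {M : Type*} [TopologicalSpace M] [ChartedSpace H M] {k : ℕ} (A : Form I M k) (x : M)
    (v : Fin (k + 1) → TangentSpace I x) : extD A x v =
      extDeriv (inChart A x) (extChartAt I x x)
        (fun i => (mfderiv I 𝓘(ℝ, E) (extChartAt I x) x (v i) : E)) := by
  rw [extD, I.range_eq_univ, extDerivWithin_univ]
  rfl

section CharacteristicDistribution

variable {E : Type*} [NormedAddCommGroup E] [NormedSpace ℝ E]
  {M : Type*} [TopologicalSpace M] [ChartedSpace E M] [IsManifold 𝓘(ℝ, E) ∞ M]
  {n k : ℕ} {C : ∀ x : M, Submodule ℝ (TangentSpace 𝓘(ℝ, E) x)}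

/-- The form `A` vanishes at `x` as soon as one of its arguments is in `C_x`. -/
def AnnihilatesAt (C : ∀ x : M, Submodule ℝ (TangentSpace 𝓘(ℝ, E) x)) (A : Form 𝓘(ℝ, E) M k)
    (x : M) : Prop :=
  ∀ v : Fin k → TangentSpace 𝓘(ℝ, E) x, (∃ i, v i ∈ C x) → A x v = 0

/-- A form annihilating `C` computes the curvature of `C`. -/
theorem extD_apply_vecCons_vecCons {A : Form 𝓘(ℝ, E) M (k + 1)} {x : M} (hA : SmoothFormAt A x)
    (hk : ∀ᶠ z in 𝓝 x, AnnihilatesAt C A z) {X Y : ∀ x : M, TangentSpace 𝓘(ℝ, E) x}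
    (hX : IsSection C X) (hY : IsSection C Y) (v : Fin k → TangentSpace 𝓘(ℝ, E) x) :
    extD A x (Matrix.vecCons (X x) (Matrix.vecCons (Y x) v)) =
      -A x (Matrix.vecCons (mlieBracket 𝓘(ℝ, E) X Y x) v) := by
  have : IsManifold 𝓘(ℝ, E) 1 M := .of_le (n := ∞) (by simp)
  have hsec : ∀ W, IsSection C W →
      DifferentiableAt ℝ (vecCoord x W) (extChartAt 𝓘(ℝ, E) x x) ∧
      ∀ᶠ y in 𝓝 (extChartAt 𝓘(ℝ, E) x x), ∀ (v : Fin (k + 1) → E) i, v i = vecCoord x W y →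
        inChart A x y v = 0 := by
    intro W hW
    refine ⟨(contDiffAt_vecCoord (mem_extChartAt_target x) (hW.smooth _)).differentiableAt
      (by simp), ?_⟩
    filter_upwards [eventually_nhds_chart (I := 𝓘(ℝ, E)) hk] with y ⟨hy, hy'⟩ w i hi
    refine hy' _ ⟨i, ?_⟩
    have h1 := mfderivWithin_extChartAt_symm_comp_mfderiv_extChartAt (I := 𝓘(ℝ, E)) hy
    have h2 := DFunLike.congr_fun h1 (W ((extChartAt 𝓘(ℝ, E) x).symm y))
    have h3 : mfderivWithin 𝓘(ℝ, E) 𝓘(ℝ, E) (extChartAt 𝓘(ℝ, E) x).symm (range 𝓘(ℝ, E)) y (w i) ∈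
        C ((extChartAt 𝓘(ℝ, E) x).symm y) := by
      rw [hi]
      exact h2.symm ▸ hW.mem _
    exact h3
  have key := extDeriv_apply_vecCons_vecCons (hA.differentiableAt (by simp)) (hsec X hX).1
    (hsec Y hY).1 (hsec X hX).2 (hsec Y hY).2
    (fun i => (mfderiv 𝓘(ℝ, E) 𝓘(ℝ, E) (extChartAt 𝓘(ℝ, E) x) x (v i) : E))
  rw [extD_apply, ← inChart_extChartAt_mfderiv A (mem_extChartAt_source x)]
  rw [vecCoord_extChartAt X (mem_extChartAt_source x),
    vecCoord_extChartAt Y (mem_extChartAt_source x), ← mfderiv_mlieBracket] at key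
  refine Eq.trans ?_ (key.trans ?_)
  · congr 1
    ext i
    refine Fin.cases rfl (fun i => Fin.cases rfl (fun i => rfl) i) i
  · congr 2
    ext i
    refine Fin.cases rfl (fun i => rfl) i

variable [FiniteDimensional ℝ E]

theorem IsDistribution.exists_isSection [T2Space M] (hC : IsDistribution n C) {x : M}
    {ζ : TangentSpace 𝓘(ℝ, E) x} (hζ : ζ ∈ C x) : ∃ X, IsSection C X ∧ X x = ζ := by
  obtain ⟨U, hU, hxU, k, X, hX, hXC⟩ := hC.exists_frame x
  rw [← (hXC x hxU).2, Submodule.mem_span_range_iff_exists_fun] at hζ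
  obtain ⟨c, hc⟩ := hζ
  obtain ⟨X', hX', hX''⟩ := exists_isSection_eventuallyEq (C := C) (x := x)
    (X := fun z => ∑ i, c i • X i z) (by
      filter_upwards [hU.mem_nhds hxU] with z hz
      refine ⟨ContMDiffAt.sum_section fun i _ =>
        ((hX i).contMDiffAt (hU.mem_nhds hz)).const_smul_section, ?_⟩
      rw [← (hXC z hz).2]
      exact Submodule.sum_mem _ fun i _ => Submodule.smul_mem _ _
        (Submodule.subset_span (mem_range_self i)))
  exact ⟨X', hX', hX''.self_of_nhds.trans hc⟩

theorem characteristic_le (x : M) : characteristic C x ≤ C x := by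
  rintro _ ⟨X, hX, rfl, -⟩
  exact hX.mem x

/-- The characteristic distribution in terms of a form annihilating the given distribution. -/
theorem mem_characteristic_iff_extD [T2Space M] (hC : IsDistribution n C) {A : Form 𝓘(ℝ, E) M n}
    {x : M} (hA : SmoothFormAt A x) (hk : ∀ᶠ z in 𝓝 x, AnnihilatesAt C A z) (h0 : A x ≠ 0)
    (ζ : TangentSpace 𝓘(ℝ, E) x) : ζ ∈ characteristic C x ↔
      (∀ v i, v i = ζ → A x v = 0) ∧ ∃ b : ℝ, ∀ v, extD A x (Matrix.vecCons ζ v) = b * A x v := by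
  obtain ⟨c, hc⟩ : ∃ c : Submodule ℝ E, c = C x := ⟨_, rfl⟩
  have hcod : Module.finrank ℝ (E ⧸ c) = n := by rw [hc]; exact hC.codim x
  have hk0 := hk.self_of_nhds
  obtain ⟨a, ha⟩ : ∃ a : E [⋀^Fin n]→L[ℝ] ℝ, a = A x := ⟨_, rfl⟩
  obtain ⟨d, hd⟩ : ∃ d : E [⋀^Fin (n + 1)]→L[ℝ] ℝ, d = extD A x := ⟨_, rfl⟩
  have ha0 : a.toAlternatingMap ≠ 0 := fun h => h0 <| by
    rw [← ha]
    exact ContinuousAlternatingMap.toAlternatingMap_injective h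
  have hak : ∀ v : Fin n → E, (∃ i, v i ∈ c) → a.toAlternatingMap v = 0 := by
    rw [ha, hc]; exact hk0
  rw [← ha, ← hd]
  constructor
  · intro hζ
    refine ⟨fun v i hi => hak v ⟨i, by rw [hi, hc]; exact characteristic_le x hζ⟩, ?_⟩
    obtain ⟨X, hX, rfl, hR⟩ := hζ
    obtain ⟨b, hb⟩ := exists_eq_smul_of_annihilates (B := (d.curryLeft (X x)).toAlternatingMap)
      hcod hak ha0 (by
        rintro v ⟨i, hi⟩
        rw [hc] at hi
        obtain ⟨Y, hY, hYx⟩ := hC.exists_isSection hi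
        obtain _ | m := n
        · exact i.elim0
        refine apply_eq_zero_of_curryLeft_eq_zero (curryLeft_eq_zero_iff.2 fun w => ?_) v i hYx.symm
        have h1 := extD_apply_vecCons_vecCons hA hk hX hY w
        rw [← hd, ← ha] at h1
        refine h1.trans (neg_eq_zero.2 (hak _ ⟨0, ?_⟩))
        rw [hc]
        exact (Submodule.Quotient.mk_eq_zero _).1 (hR Y hY))
    exact ⟨b, fun v => DFunLike.congr_fun hb v⟩
  · rintro ⟨h1, b, hb⟩
    obtain ⟨X, hX, rfl⟩ := hC.exists_isSection
      (hc ▸ mem_of_insertion_eq_zero hcod hak ha0 h1 : ζ ∈ C x)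
    refine ⟨X, hX, rfl, fun Y hY => ?_⟩
    refine (Submodule.Quotient.mk_eq_zero _).2 ?_
    change mlieBracket 𝓘(ℝ, E) X Y x ∈ C x
    rw [← hc]
    refine mem_of_insertion_eq_zero hcod hak ha0 fun v i hi => ?_
    obtain _ | m := n
    · exact i.elim0
    refine apply_eq_zero_of_curryLeft_eq_zero (curryLeft_eq_zero_iff.2 fun w => ?_) v i hi
    have h2 := extD_apply_vecCons_vecCons hA hk hX hY w
    rw [← hd, ← ha] at h2
    refine neg_eq_zero.1 (h2.symm.trans ((hb _).trans ?_))
    refine mul_eq_zero_of_right _ (hak _ ⟨0, by rw [hc]; exact hY.mem x⟩)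

end CharacteristicDistribution

section FlatForms

universe u

set_option linter.unusedSectionVars false

variable {E : Type u} [NormedAddCommGroup E] [NormedSpace ℝ E] [FiniteDimensional ℝ E]
  {M : Type*} [TopologicalSpace M] [ChartedSpace E M] [IsManifold 𝓘(ℝ, E) ∞ M]
  {n k : ℕ} {C : ∀ x : M, Submodule ℝ (TangentSpace 𝓘(ℝ, E) x)}

theorem inChart_ne_zero {A : Form 𝓘(ℝ, E) M k} {x₀ x : M}
    (hx : x ∈ (extChartAt 𝓘(ℝ, E) x₀).source) (h0 : A x ≠ 0) :
    inChart A x₀ (extChartAt 𝓘(ℝ, E) x₀ x) ≠ 0 := by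
  have : IsManifold 𝓘(ℝ, E) 1 M := .of_le (n := ∞) (by simp)
  intro h
  refine h0 (ContinuousAlternatingMap.ext fun v => ?_)
  rw [← inChart_extChartAt_mfderiv A hx, h]
  rfl

theorem extD_apply_inChart {A : Form 𝓘(ℝ, E) M k} {x₀ x : M}
    (hx : x ∈ (extChartAt 𝓘(ℝ, E) x₀).source) (hA : SmoothFormAt A x)
    (v : Fin (k + 1) → TangentSpace 𝓘(ℝ, E) x) :
    extD A x v = extDeriv (inChart A x₀) (extChartAt 𝓘(ℝ, E) x₀ x)
      (fun i => (mfderiv 𝓘(ℝ, E) 𝓘(ℝ, E) (extChartAt 𝓘(ℝ, E) x₀) x (v i) : E)) := by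
  have : IsManifold 𝓘(ℝ, E) 1 M := .of_le (n := ∞) (by simp)
  rw [← inChart_extChartAt_mfderiv (extD A) hx, inChart_extD]
  · exact (extChartAt 𝓘(ℝ, E) x₀).map_source hx
  · rwa [(extChartAt 𝓘(ℝ, E) x₀).left_inv hx]

/-- The characteristic distribution in the preferred chart at `x₀`. -/
theorem mem_characteristic_iff [T2Space M] (hC : IsDistribution n C) {A : Form 𝓘(ℝ, E) M n}
    {x₀ x : M} (hx : x ∈ (extChartAt 𝓘(ℝ, E) x₀).source) (hA : SmoothFormAt A x)
    (hk : ∀ᶠ z in 𝓝 x, AnnihilatesAt C A z) (h0 : A x ≠ 0) (ζ : TangentSpace 𝓘(ℝ, E) x) :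
    ζ ∈ characteristic C x ↔
      (mfderiv 𝓘(ℝ, E) 𝓘(ℝ, E) (extChartAt 𝓘(ℝ, E) x₀) x ζ : E) ∈ proportionalityKernel
        (inChart A x₀ (extChartAt 𝓘(ℝ, E) x₀ x))
        (extDeriv (inChart A x₀) (extChartAt 𝓘(ℝ, E) x₀ x)) := by
  have : IsManifold 𝓘(ℝ, E) 1 M := .of_le (n := ∞) (by simp)
  refine (mem_characteristic_iff_extD hC hA hk h0 ζ).trans
    (Iff.trans ?_ (mem_proportionalityKernel (E := E)).symm)
  obtain ⟨T, hT⟩ : ∃ T : TangentSpace 𝓘(ℝ, E) x → E,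
    T = mfderiv 𝓘(ℝ, E) 𝓘(ℝ, E) (extChartAt 𝓘(ℝ, E) x₀) x := ⟨_, rfl⟩
  have hinj : Function.Injective T := hT ▸ mfderiv_extChartAt_injective hx
  have hsurj : Function.Surjective T := hT ▸ mfderiv_extChartAt_surjective hx
  have hA1 : ∀ v, A x v = inChart A x₀ (extChartAt 𝓘(ℝ, E) x₀ x) (fun i => T (v i)) := fun v => by
    rw [hT]; exact (inChart_extChartAt_mfderiv A hx v).symm
  have hA2 : ∀ v, extD A x v = extDeriv (inChart A x₀) (extChartAt 𝓘(ℝ, E) x₀ x)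
      (fun i => T (v i)) := fun v => by
    rw [hT]; exact extD_apply_inChart hx hA v
  have hlift : ∀ {m : ℕ} (w : Fin m → E), ∃ v : Fin m → TangentSpace 𝓘(ℝ, E) x,
      (fun i => T (v i)) = w := fun w => by
    choose v hv using fun i => hsurj (w i)
    exact ⟨v, funext hv⟩
  have hcons : ∀ v : Fin n → TangentSpace 𝓘(ℝ, E) x, (fun i => T (Matrix.vecCons ζ v i)) =
      Matrix.vecCons (T ζ) (fun i => T (v i)) := fun v => by
    ext i
    exact Fin.cases rfl (fun i => rfl) i
  refine and_congr ⟨fun h w i hi => ?_, fun h v i hi => ?_⟩ (exists_congr fun b =>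
    ⟨fun h => ?_, fun h v => ?_⟩)
  · obtain ⟨v, rfl⟩ := hlift w
    rw [← hA1]
    exact h v i (hinj (hi.trans (by rw [hT])))
  · rw [hA1]
    exact h _ i (by rw [hi, hT])
  · ext w
    obtain ⟨v, rfl⟩ := hlift w
    have := h v
    rw [hA1, hA2, hcons] at this
    subst hT
    exact this
  · subst hT
    exact ((hA2 _).trans (congrArg _ (hcons v))).trans
      ((DFunLike.congr_fun h _).trans (congrArg (b * ·) (hA1 v).symm))

theorem finrank_characteristic [T2Space M] (hC : IsDistribution n C) {A : Form 𝓘(ℝ, E) M n}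
    {x₀ x : M} (hx : x ∈ (extChartAt 𝓘(ℝ, E) x₀).source) (hA : SmoothFormAt A x)
    (hk : ∀ᶠ z in 𝓝 x, AnnihilatesAt C A z) (h0 : A x ≠ 0) :
    Module.finrank ℝ (characteristic C x) = Module.finrank ℝ (proportionalityKernel
        (inChart A x₀ (extChartAt 𝓘(ℝ, E) x₀ x))
        (extDeriv (inChart A x₀) (extChartAt 𝓘(ℝ, E) x₀ x))) := by
  obtain ⟨T, hT⟩ : ∃ T : TangentSpace 𝓘(ℝ, E) x →ₗ[ℝ] E,
    ∀ v, T v = mfderiv 𝓘(ℝ, E) 𝓘(ℝ, E) (extChartAt 𝓘(ℝ, E) x₀) x v :=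
    ⟨(mfderiv 𝓘(ℝ, E) 𝓘(ℝ, E) (extChartAt 𝓘(ℝ, E) x₀) x).toLinearMap, fun _ => rfl⟩
  have hbij : Function.Bijective T := by
    rw [show (T : TangentSpace 𝓘(ℝ, E) x → E) = _ from funext hT]
    exact ⟨mfderiv_extChartAt_injective hx, mfderiv_extChartAt_surjective hx⟩
  have h1 : characteristic C x = (proportionalityKernel
      (inChart A x₀ (extChartAt 𝓘(ℝ, E) x₀ x))
      (extDeriv (inChart A x₀) (extChartAt 𝓘(ℝ, E) x₀ x))).comap
        (LinearEquiv.ofBijective T hbij : TangentSpace 𝓘(ℝ, E) x →ₗ[ℝ] E) := by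
    ext ζ
    rw [mem_characteristic_iff hC hx hA hk h0, ← hT]
    rfl
  rw [h1]
  exact ((LinearEquiv.ofBijective T hbij).ofSubmodule' _).finrank_eq

/-- The form with a given expression in the preferred chart at `x₀`. -/
noncomputable def ofInChart (x₀ : M) (B : E → E [⋀^Fin k]→L[ℝ] ℝ) : Form 𝓘(ℝ, E) M k := fun x =>
  (ofFormCoord x₀ x (B (extChartAt 𝓘(ℝ, E) x₀ x)) : FormBundle 𝓘(ℝ, E) M k).2

theorem ofInChart_apply (x₀ x : M) (B : E → E [⋀^Fin k]→L[ℝ] ℝ)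
    (v : Fin k → TangentSpace 𝓘(ℝ, E) x) : ofInChart x₀ B x v = B (extChartAt 𝓘(ℝ, E) x₀ x)
      (fun i => (mfderiv 𝓘(ℝ, E) 𝓘(ℝ, E) (extChartAt 𝓘(ℝ, E) x₀) x (v i) : E)) := rfl

theorem inChart_ofInChart (x₀ : M) (B : E → E [⋀^Fin k]→L[ℝ] ℝ) {y : E}
    (hy : y ∈ (extChartAt 𝓘(ℝ, E) x₀).target) : inChart (ofInChart x₀ B) x₀ y = B y := by
  have hx := (extChartAt 𝓘(ℝ, E) x₀).map_target hy
  have h1 := formCoord_section (ofInChart x₀ B) hx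
  rw [(extChartAt 𝓘(ℝ, E) x₀).right_inv hy] at h1
  rw [← h1]
  refine (formCoord_ofFormCoord hx _).trans ?_
  rw [(extChartAt 𝓘(ℝ, E) x₀).right_inv hy]

theorem smoothFormAt_ofInChart {x₀ x : M} {B : E → E [⋀^Fin k]→L[ℝ] ℝ}
    (hx : x ∈ (extChartAt 𝓘(ℝ, E) x₀).source)
    (hB : ContDiffAt ℝ ∞ B (extChartAt 𝓘(ℝ, E) x₀ x)) : SmoothFormAt (ofInChart x₀ B) x := by
  refine smoothFormAt_of_contDiffAt_inChart hx (hB.congr_of_eventuallyEq ?_)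
  filter_upwards [(isOpen_extChartAt_target x₀).mem_nhds ((extChartAt 𝓘(ℝ, E) x₀).map_source hx)]
    with y hy using inChart_ofInChart x₀ B hy

/-- Through every point of `M̃` passes a smooth local section of `M̃`. -/
theorem exists_annihilating_form (hC : IsDistribution n C) {α : FormBundle 𝓘(ℝ, E) M n}
    (hα : α ∈ tildeSet n C) : ∃ A : Form 𝓘(ℝ, E) M n, A α.1 = α.2 ∧
      ∀ᶠ z in 𝓝 α.1, SmoothFormAt A z ∧ A z ≠ 0 ∧ AnnihilatesAt C A z := by
  obtain ⟨x, a⟩ := α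
  obtain ⟨hα0, hαC⟩ := hα
  change a ≠ 0 at hα0
  obtain ⟨U, hU, hxU, k, X, hX, hXC⟩ := hC.exists_frame x
  have hUe : ∀ᶠ z in 𝓝 x, z ∈ U := hU.mem_nhds hxU
  have hUy := eventually_nhds_chart (I := 𝓘(ℝ, E)) hUe
  have hsp : ∀ z ∈ U, z ∈ (extChartAt 𝓘(ℝ, E) x).source → ∀ ζ ∈ C z,
      (mfderiv 𝓘(ℝ, E) 𝓘(ℝ, E) (extChartAt 𝓘(ℝ, E) x) z ζ : E) ∈
        Submodule.span ℝ (range fun i => vecCoord x (X i) (extChartAt 𝓘(ℝ, E) x z)) := by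
    intro z hz hz' ζ hζ
    rw [← (hXC z hz).2, Submodule.mem_span_range_iff_exists_fun] at hζ
    obtain ⟨c, rfl⟩ := hζ
    refine (Submodule.mem_span_range_iff_exists_fun (M := E) ℝ).2 ⟨c, ?_⟩
    refine Eq.trans ?_ (map_sum (mfderiv 𝓘(ℝ, E) 𝓘(ℝ, E) (extChartAt 𝓘(ℝ, E) x) z) _ _).symm
    refine Finset.sum_congr rfl fun i _ => ?_
    rw [vecCoord_extChartAt _ hz', map_smul]
    rfl
  have hx := mem_extChartAt_source (I := 𝓘(ℝ, E)) x
  have hla : LinearIndependent ℝ (fun i => vecCoord x (X i) (extChartAt 𝓘(ℝ, E) x x)) := by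
    have h1 := (hXC x hxU).1.map_injOn
      (mfderiv 𝓘(ℝ, E) 𝓘(ℝ, E) (extChartAt 𝓘(ℝ, E) x) x).toLinearMap
      (mfderiv_extChartAt_injective hx).injOn
    rw [show (fun i => vecCoord x (X i) (extChartAt 𝓘(ℝ, E) x x)) = fun i =>
      (mfderiv 𝓘(ℝ, E) 𝓘(ℝ, E) (extChartAt 𝓘(ℝ, E) x) x (X i x) : E) from
      funext fun i => vecCoord_extChartAt _ hx]
    exact h1
  set a' : E [⋀^Fin n]→L[ℝ] ℝ := formCoord x (⟨x, a⟩ : FormBundle 𝓘(ℝ, E) M n) with ha'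
  have haa : ∀ v : Fin n → TangentSpace 𝓘(ℝ, E) x, (a : TangentSpace 𝓘(ℝ, E) x [⋀^Fin n]→L[ℝ] ℝ) v
      = a' (fun i => (mfderiv 𝓘(ℝ, E) 𝓘(ℝ, E) (extChartAt 𝓘(ℝ, E) x) x (v i) : E)) := fun v =>
    apply_eq_formCoord (α := (⟨x, a⟩ : FormBundle 𝓘(ℝ, E) M n)) hx v
  have ha'0 : a' ≠ 0 := fun h => hα0 <| by
    refine ContinuousAlternatingMap.ext fun v => ?_
    refine (haa v).trans ?_
    rw [h]
    rfl
  have ha'k : ∀ v : Fin n → E, (∃ i, v i ∈ Submodule.span ℝ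
      (range fun i => vecCoord x (X i) (extChartAt 𝓘(ℝ, E) x x))) → a' v = 0 := by
    rintro w ⟨i, hi⟩
    choose v hv using fun i => mfderiv_extChartAt_surjective hx (w i)
    have hw : w = fun i => (mfderiv 𝓘(ℝ, E) 𝓘(ℝ, E) (extChartAt 𝓘(ℝ, E) x) x (v i) : E) :=
      funext fun i => (hv i).symm
    rw [hw, ← haa]
    refine hαC v ⟨i, ?_⟩
    rw [Submodule.mem_span_range_iff_exists_fun] at hi
    obtain ⟨c, hc⟩ := hi
    change v i ∈ C x
    rw [← (hXC x hxU).2, Submodule.mem_span_range_iff_exists_fun]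
    refine ⟨c, mfderiv_extChartAt_injective hx ?_⟩
    rw [hv, ← hc]
    refine (map_sum (mfderiv 𝓘(ℝ, E) 𝓘(ℝ, E) (extChartAt 𝓘(ℝ, E) x) x) _ _).trans ?_
    refine Finset.sum_congr rfl fun i _ => ?_
    rw [vecCoord_extChartAt _ hx, map_smul]
    rfl
  obtain ⟨B, hB0, hB⟩ := exists_smooth_annihilating_form (y₀ := extChartAt 𝓘(ℝ, E) x x)
    (X := fun i => vecCoord x (X i)) (by
      filter_upwards [hUy] with y hy i
      exact contDiffAt_vecCoord hy.1 ((hX i).contMDiffAt (hU.mem_nhds hy.2))) hla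
    (C := fun y => Submodule.span ℝ (range fun i => vecCoord x (X i) y))
    (Eventually.of_forall fun _ => rfl) a' ha'k ha'0
  refine ⟨ofInChart x B, ?_, ?_⟩
  · refine ContinuousAlternatingMap.ext fun v => ?_
    refine (ofInChart_apply x x B v).trans ?_
    rw [hB0]
    exact (haa v).symm
  · filter_upwards [(continuousAt_extChartAt (I := 𝓘(ℝ, E)) x).eventually hB, hUe,
      extChartAt_source_mem_nhds (I := 𝓘(ℝ, E)) x] with z ⟨hz1, hz2, hz3⟩ hzU hz
    refine ⟨smoothFormAt_ofInChart hz hz1, fun h => hz2 ?_, fun v ⟨i, hi⟩ => ?_⟩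
    · ext w
      choose v hv using fun i => mfderiv_extChartAt_surjective hz (w i)
      have hw : w = fun i => (mfderiv 𝓘(ℝ, E) 𝓘(ℝ, E) (extChartAt 𝓘(ℝ, E) x) z (v i) : E) :=
        funext fun i => (hv i).symm
      rw [hw, ← ofInChart_apply, h]
      rfl
    · rw [ofInChart_apply]
      exact hz3 _ ⟨i, hsp z hzU hz _ hi⟩

end FlatForms

section FlatSections

universe u

set_option linter.unusedSectionVars false

variable {E : Type u} [NormedAddCommGroup E] [NormedSpace ℝ E] [FiniteDimensional ℝ E]
  {M : Type*} [TopologicalSpace M] [ChartedSpace E M] [IsManifold 𝓘(ℝ, E) ∞ M]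
  {n k : ℕ} {C : ∀ x : M, Submodule ℝ (TangentSpace 𝓘(ℝ, E) x)}

theorem eventually_contDiffAt_inChart {A : Form 𝓘(ℝ, E) M n} {x : M}
    (hA : ∀ᶠ z in 𝓝 x, SmoothFormAt A z) :
    ∀ᶠ y in 𝓝 (extChartAt 𝓘(ℝ, E) x x), ContDiffAt ℝ ∞ (inChart A x) y := by
  filter_upwards [eventually_nhds_chart (I := 𝓘(ℝ, E)) hA] with y hy
  exact hy.2.contDiffAt_inChart hy.1

theorem IsPreContact.eventually_finrank_proportionalityKernel [T2Space M] (hC : IsPreContact n C)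
    {A : Form 𝓘(ℝ, E) M n} {x : M}
    (hA : ∀ᶠ z in 𝓝 x, SmoothFormAt A z ∧ A z ≠ 0 ∧ AnnihilatesAt C A z) :
    ∀ᶠ y in 𝓝 (extChartAt 𝓘(ℝ, E) x x),
      Module.finrank ℝ (proportionalityKernel (inChart A x y) (extDeriv (inChart A x) y)) =
      Module.finrank ℝ (proportionalityKernel (inChart A x (extChartAt 𝓘(ℝ, E) x x))
        (extDeriv (inChart A x) (extChartAt 𝓘(ℝ, E) x x))) := by
  obtain ⟨r, hr⟩ := hC.char_const
  have h1 : ∀ z ∈ (extChartAt 𝓘(ℝ, E) x).source,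
      (∀ᶠ w in 𝓝 z, SmoothFormAt A w ∧ A w ≠ 0 ∧ AnnihilatesAt C A w) →
      Module.finrank ℝ (proportionalityKernel (inChart A x (extChartAt 𝓘(ℝ, E) x z))
        (extDeriv (inChart A x) (extChartAt 𝓘(ℝ, E) x z))) = r := fun z hz hz' => by
    rw [← finrank_characteristic hC.toIsDistribution hz hz'.self_of_nhds.1
      (hz'.mono fun w hw => hw.2.2) hz'.self_of_nhds.2.1, hr]
  rw [h1 x (mem_extChartAt_source x) hA]
  filter_upwards [eventually_nhds_chart (I := 𝓘(ℝ, E)) (eventually_eventually_nhds.2 hA)] with y hy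
  have h2 := h1 _ ((extChartAt 𝓘(ℝ, E) x).map_target hy.1) hy.2
  rwa [(extChartAt 𝓘(ℝ, E) x).right_inv hy.1] at h2

/-- Through every point of `M̃` passes a smooth local section of `M̃` whose differential is
annihilated by the characteristic distribution. -/
theorem IsPreContact.exists_flat_form [T2Space M] (hC : IsPreContact n C)
    {α : FormBundle 𝓘(ℝ, E) M n} (hα : α ∈ tildeSet n C) : ∃ A : Form 𝓘(ℝ, E) M n, A α.1 = α.2 ∧
      ∀ᶠ z in 𝓝 α.1, SmoothFormAt A z ∧ A z ≠ 0 ∧ AnnihilatesAt C A z ∧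
        ∀ ζ ∈ characteristic C z, ∀ v, extD A z (Matrix.vecCons ζ v) = 0 := by
  have : IsManifold 𝓘(ℝ, E) 1 M := .of_le (n := ∞) (by simp)
  obtain ⟨A, hAα, hA⟩ := exists_annihilating_form hC.toIsDistribution hα
  obtain ⟨x, a⟩ := α
  dsimp only at hA hAα ⊢
  have hx := mem_extChartAt_source (I := 𝓘(ℝ, E)) x
  have hsm := eventually_contDiffAt_inChart (hA.mono fun z hz => hz.1)
  obtain ⟨f, hf1, hf⟩ := exists_flat_multiple hsm (inChart_ne_zero hx hA.self_of_nhds.2.1)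
    (hC.eventually_finrank_proportionalityKernel hA)
  set B : E → E [⋀^Fin n]→L[ℝ] ℝ := fun y => f y • inChart A x y with hB
  have hBA : ∀ z ∈ (extChartAt 𝓘(ℝ, E) x).source, ∀ v, ofInChart x B z v =
      f (extChartAt 𝓘(ℝ, E) x z) * A z v := fun z hz v => by
    rw [ofInChart_apply, ← inChart_extChartAt_mfderiv A hz]
    rfl
  refine ⟨ofInChart x B, ?_, ?_⟩
  · refine ContinuousAlternatingMap.ext fun v => ?_
    refine (hBA x hx v).trans ?_
    rw [hf1, one_mul]
    exact DFunLike.congr_fun hAα v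
  have hf0 : ∀ᶠ y in 𝓝 (extChartAt 𝓘(ℝ, E) x x), f y ≠ 0 :=
    hf.self_of_nhds.1.continuousAt.eventually_ne (by rw [hf1]; exact one_ne_zero)
  filter_upwards [(continuousAt_extChartAt (I := 𝓘(ℝ, E)) x).eventually ((hf.and hf0).and hsm),
    extChartAt_source_mem_nhds (I := 𝓘(ℝ, E)) x, hA, eventually_eventually_nhds.2 hA]
    with z ⟨⟨⟨hz1, hz2⟩, hz3⟩, hz4⟩ hz ⟨hz5, hz6, hz7⟩ hz8
  have hBz : SmoothFormAt (ofInChart x B) z := smoothFormAt_ofInChart hz (hz1.smul hz4)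
  refine ⟨hBz, fun h => hz6 ?_, fun v hv => ?_, fun ζ hζ v => ?_⟩
  · refine ContinuousAlternatingMap.ext fun v => ?_
    have h1 := hBA z hz v
    rw [h] at h1
    exact (mul_eq_zero.1 h1.symm).resolve_left hz3
  · rw [hBA z hz, hz7 v hv, mul_zero]
  · rw [mem_characteristic_iff hC.toIsDistribution hz hz5 (hz8.mono fun w hw => hw.2.2) hz6] at hζ
    have h1 := curryLeft_eq_zero_iff.1 (hz2 _ hζ)
      (fun i => (mfderiv 𝓘(ℝ, E) 𝓘(ℝ, E) (extChartAt 𝓘(ℝ, E) x) z (v i) : E))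
    rw [extD_apply_inChart hz hBz]
    have h2 : inChart (ofInChart x B) x =ᶠ[𝓝 (extChartAt 𝓘(ℝ, E) x z)] B := by
      filter_upwards [(isOpen_extChartAt_target x).mem_nhds
        ((extChartAt 𝓘(ℝ, E) x).map_source hz)] with y hy using inChart_ofInChart x B hy
    rw [h2.extDeriv_eq]
    refine Eq.trans (congrArg _ (funext fun i => ?_)) h1
    exact Fin.cases rfl (fun i => rfl) i

/-- The characteristic distribution of a pre-contact structure is spanned by smooth sections. -/
theorem IsPreContact.exists_isSection_characteristic [T2Space M] (hC : IsPreContact n C)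
    {A : Form 𝓘(ℝ, E) M n} {x : M}
    (hA : ∀ᶠ z in 𝓝 x, SmoothFormAt A z ∧ A z ≠ 0 ∧ AnnihilatesAt C A z)
    {ζ : TangentSpace 𝓘(ℝ, E) x} (hζ : ζ ∈ characteristic C x) :
    ∃ Z, IsSection (characteristic C) Z ∧ Z x = ζ := by
  have hx := mem_extChartAt_source (I := 𝓘(ℝ, E)) x
  have hsm := eventually_contDiffAt_inChart (hA.mono fun z hz => hz.1)
  have hmem : ∀ z ∈ (extChartAt 𝓘(ℝ, E) x).source,
      (∀ᶠ w in 𝓝 z, SmoothFormAt A w ∧ A w ≠ 0 ∧ AnnihilatesAt C A w) →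
      ∀ ζ : TangentSpace 𝓘(ℝ, E) z, ζ ∈ characteristic C z ↔ _ := fun z hz hz' ζ =>
    mem_characteristic_iff hC.toIsDistribution hz hz'.self_of_nhds.1
      (hz'.mono fun w hw => hw.2.2) hz'.self_of_nhds.2.1 ζ
  rw [hmem x hx hA] at hζ
  obtain ⟨Z, hZ0, hZ⟩ := exists_smooth_section_proportionalityKernel hsm
    (inChart_ne_zero hx hA.self_of_nhds.2.1) (hC.eventually_finrank_proportionalityKernel hA) hζ
  obtain ⟨Z', hZ', hZ''⟩ := exists_isSection_eventuallyEq (C := characteristic C) (x := x)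
    (X := ofVecCoord x Z) (by
      filter_upwards [(continuousAt_extChartAt (I := 𝓘(ℝ, E)) x).eventually hZ,
        extChartAt_source_mem_nhds (I := 𝓘(ℝ, E)) x, eventually_eventually_nhds.2 hA]
        with z hz1 hz hz2
      refine ⟨contMDiffAt_ofVecCoord hz hz1.1, ?_⟩
      rw [hmem z hz hz2, mfderiv_ofVecCoord Z hz]
      exact hz1.2)
  refine ⟨Z', hZ', hZ''.self_of_nhds.trans (mfderiv_extChartAt_injective hx ?_)⟩
  exact (mfderiv_ofVecCoord Z hx).trans hZ0

theorem lieDeriv_eq_insertion_extD {Z : ∀ x : M, TangentSpace 𝓘(ℝ, E) x} {A : Form 𝓘(ℝ, E) M k}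
    {x : M} (hA : ∀ᶠ z in 𝓝 x, AnnihilatesAt C A z) (hZ : ∀ᶠ z in 𝓝 x, Z z ∈ C z) :
    lieDeriv Z A x = insertion Z (extD A) x := by
  obtain _ | k := k
  · rfl
  have h1 : extD (insertion Z A) x = extD (0 : Form 𝓘(ℝ, E) M k) x := by
    refine extD_congr ?_
    filter_upwards [hA, hZ] with z hz hz'
    refine ContinuousAlternatingMap.ext fun v => ?_
    exact hz (Matrix.vecCons (Z z) v) ⟨0, hz'⟩
  have h2 : extD (0 : Form 𝓘(ℝ, E) M k) x = 0 := by
    have h3 : inChart (0 : Form 𝓘(ℝ, E) M k) x = 0 := by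
      funext y
      ext v
      rfl
    refine ContinuousAlternatingMap.ext fun v => ?_
    rw [extD_apply, h3]
    have h4 : extDeriv (0 : E → E [⋀^Fin k]→L[ℝ] ℝ) (extChartAt 𝓘(ℝ, E) x x) = 0 := by
      have h5 := extDeriv_smul (x := extChartAt 𝓘(ℝ, E) x x) (0 : ℝ) (0 : E → E [⋀^Fin k]→L[ℝ] ℝ)
      rwa [zero_smul, zero_smul] at h5
    rw [h4]
    rfl
  change insertion Z (extD A) x + extD (insertion Z A) x = _
  rw [h1, h2, add_zero]

/-- The fibres of `M̃` are nonempty. -/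
theorem IsDistribution.exists_mem_tildeSet (hC : IsDistribution n C) (x : M) :
    ∃ α : FormBundle 𝓘(ℝ, E) M n, α ∈ tildeSet n C ∧ α.1 = x := by
  obtain ⟨c, hc⟩ : ∃ c : Submodule ℝ E, c = C x := ⟨_, rfl⟩
  have hcod : Module.finrank ℝ (E ⧸ c) = n := by rw [hc]; exact hC.codim x
  let b : Module.Basis (Fin n) ℝ (E ⧸ c) := Module.finBasisOfFinrankEq ℝ _ hcod
  let a : E [⋀^Fin n]→ₗ[ℝ] ℝ := b.det.compLinearMap c.mkQ
  have ha : Continuous a := by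
    have h1 : ⇑a = fun v => (b.toMatrix fun j => c.mkQ (v j)).det :=
      funext fun v => b.det_apply fun j => c.mkQ (v j)
    rw [h1]
    refine Continuous.matrix_det (continuous_matrix fun i j => ?_)
    exact (((b.coord i).comp c.mkQ).continuous_of_finiteDimensional).comp (continuous_apply j)
  let a' : E [⋀^Fin n]→L[ℝ] ℝ := ⟨⟨a.toMultilinearMap, ha⟩, a.map_eq_zero_of_eq'⟩
  choose v hv using fun i => c.mkQ_surjective (b i)
  refine ⟨⟨x, a'⟩, ⟨fun h => ?_, fun w ⟨i, hi⟩ => ?_⟩, rfl⟩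
  · have h1 : a' v = 0 := DFunLike.congr_fun h v
    have h2 : a' v = b.det (fun i => c.mkQ (v i)) := rfl
    rw [h2, funext hv, b.det_self] at h1
    exact one_ne_zero h1
  · have h2 : a' w = b.det (fun i => c.mkQ (w i)) := rfl
    refine h2.trans (b.det.map_coord_zero i ?_)
    rw [← hc] at hi
    exact (Submodule.Quotient.mk_eq_zero c).2 hi

end FlatSections

section ConeParametrization

set_option linter.unusedSectionVars false

variable {E : Type*} [NormedAddCommGroup E] [NormedSpace ℝ E] [FiniteDimensional ℝ E]
  {M : Type*} [TopologicalSpace M] [ChartedSpace E M] [IsManifold 𝓘(ℝ, E) ∞ M]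
  {n : ℕ} {C : ∀ x : M, Submodule ℝ (TangentSpace 𝓘(ℝ, E) x)}

/-- The map `(y, t) ↦ t N(y)` into `∧ⁿ T*M`, in the preferred chart at `x₀`. -/
noncomputable def coneParam (x₀ : M) (N : E → E [⋀^Fin n]→L[ℝ] ℝ) (p : E × ℝ) :
    FormBundle 𝓘(ℝ, E) M n :=
  ofFormCoord x₀ ((extChartAt 𝓘(ℝ, E) x₀).symm p.1) (p.2 • N p.1)

theorem formCoord_coneParam {x₀ : M} {N : E → E [⋀^Fin n]→L[ℝ] ℝ} {p : E × ℝ}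
    (hp : p.1 ∈ (extChartAt 𝓘(ℝ, E) x₀).target) :
    formCoord x₀ (coneParam x₀ N p) = p.2 • N p.1 :=
  formCoord_ofFormCoord ((extChartAt 𝓘(ℝ, E) x₀).map_target hp) _

theorem extChartAt_coneParam {x₀ : M} {N : E → E [⋀^Fin n]→L[ℝ] ℝ} {p : E × ℝ}
    (hp : p.1 ∈ (extChartAt 𝓘(ℝ, E) x₀).target) :
    extChartAt 𝓘(ℝ, E) x₀ (coneParam x₀ N p).1 = p.1 :=
  (extChartAt 𝓘(ℝ, E) x₀).right_inv hp

theorem coneParam_eq {x₀ : M} {N : E → E [⋀^Fin n]→L[ℝ] ℝ} {β : FormBundle 𝓘(ℝ, E) M n} {t : ℝ}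
    (hβ : β.1 ∈ (extChartAt 𝓘(ℝ, E) x₀).source)
    (h : formCoord x₀ β = t • N (extChartAt 𝓘(ℝ, E) x₀ β.1)) :
    coneParam x₀ N (extChartAt 𝓘(ℝ, E) x₀ β.1, t) = β := by
  have hy := (extChartAt 𝓘(ℝ, E) x₀).map_source hβ
  refine (formCoord_injective hβ ?_ ?_).symm
  · exact ((extChartAt 𝓘(ℝ, E) x₀).left_inv hβ).symm
  · rw [formCoord_coneParam hy, h]

theorem contMDiffAt_ofFormCoord {E' : Type*} [NormedAddCommGroup E'] [NormedSpace ℝ E']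
    {H' : Type*} [TopologicalSpace H'] {I' : ModelWithCorners ℝ E' H'}
    {M' : Type*} [TopologicalSpace M'] [ChartedSpace H' M'] {x₀ : M} {f : M' → E}
    {g : M' → E [⋀^Fin n]→L[ℝ] ℝ} {p : M'} (hp : f p ∈ (extChartAt 𝓘(ℝ, E) x₀).target)
    (hf : ContMDiffAt I' 𝓘(ℝ, E) ∞ f p) (hg : ContMDiffAt I' 𝓘(ℝ, E [⋀^Fin n]→L[ℝ] ℝ) ∞ g p) :
    ContMDiffAt I' (formModel 𝓘(ℝ, E) n) ∞
      (fun z => (ofFormCoord x₀ ((extChartAt 𝓘(ℝ, E) x₀).symm (f z)) (g z) :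
        FormBundle 𝓘(ℝ, E) M n)) p := by
  have hps := (extChartAt 𝓘(ℝ, E) x₀).map_target hp
  refine (contMDiffAt_formBundle_iff (x₀ := x₀) hps).2
    ⟨(contMDiffAt_extChartAt_symm hp).comp p hf, hg.congr_of_eventuallyEq ?_⟩
  filter_upwards [hf.continuousAt.preimage_mem_nhds
    ((isOpen_extChartAt_target x₀).mem_nhds hp)] with z hz
  exact formCoord_ofFormCoord ((extChartAt 𝓘(ℝ, E) x₀).map_target hz) _

theorem contMDiffAt_coneParam {x₀ : M} {N : E → E [⋀^Fin n]→L[ℝ] ℝ} {p : E × ℝ}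
    (hp : p.1 ∈ (extChartAt 𝓘(ℝ, E) x₀).target) (hN : ContDiffAt ℝ ∞ N p.1) :
    ContMDiffAt 𝓘(ℝ, E × ℝ) (formModel 𝓘(ℝ, E) n) ∞ (coneParam (M := M) x₀ N) p :=
  contMDiffAt_ofFormCoord hp contDiffAt_fst.contMDiffAt
    (contDiffAt_snd.smul (hN.comp p contDiffAt_fst)).contMDiffAt

theorem contMDiffAt_formCoord {x₀ : M} {β : FormBundle 𝓘(ℝ, E) M n}
    (hβ : β.1 ∈ (extChartAt 𝓘(ℝ, E) x₀).source) :
    ContMDiffAt (formModel 𝓘(ℝ, E) n) 𝓘(ℝ, E [⋀^Fin n]→L[ℝ] ℝ) ∞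
      (formCoord x₀ : FormBundle 𝓘(ℝ, E) M n → _) β :=
  ((contMDiffAt_formBundle_iff (x₀ := x₀) (ψ := fun β : FormBundle 𝓘(ℝ, E) M n => β) hβ).1
    contMDiffAt_id).2

theorem contMDiffAt_extChartAt_proj {x₀ : M} {β : FormBundle 𝓘(ℝ, E) M n}
    (hβ : β.1 ∈ (extChartAt 𝓘(ℝ, E) x₀).source) :
    ContMDiffAt (formModel 𝓘(ℝ, E) n) 𝓘(ℝ, E) ∞
      (fun β : FormBundle 𝓘(ℝ, E) M n => extChartAt 𝓘(ℝ, E) x₀ β.1) β :=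
  (contMDiffAt_extChartAt' (by simpa using hβ)).comp β
    ((contMDiffAt_formBundle_iff (x₀ := x₀) (ψ := fun β : FormBundle 𝓘(ℝ, E) M n => β) hβ).1
      contMDiffAt_id).1

/-- The form `N(y)` is, in the preferred chart at `x₀`, an element of `M̃`, and `N` is smooth
at `y`. -/
structure IsFrameAt (C : ∀ x : M, Submodule ℝ (TangentSpace 𝓘(ℝ, E) x)) (x₀ : M)
    (N : E → E [⋀^Fin n]→L[ℝ] ℝ) (y : E) : Prop where
  mem_target : y ∈ (extChartAt 𝓘(ℝ, E) x₀).target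
  contDiffAt : ContDiffAt ℝ ∞ N y
  mem_tildeSet : (ofFormCoord x₀ ((extChartAt 𝓘(ℝ, E) x₀).symm y) (N y) :
    FormBundle 𝓘(ℝ, E) M n) ∈ tildeSet n C

theorem IsFrameAt.coneParam_mem_tildeSet {x₀ : M} {N : E → E [⋀^Fin n]→L[ℝ] ℝ} {p : E × ℝ}
    (hN : IsFrameAt C x₀ N p.1) (ht : p.2 ≠ 0) : coneParam x₀ N p ∈ tildeSet n C := by
  obtain ⟨-, -, h0, hk⟩ := hN
  have h1 : ∀ v : Fin n → TangentSpace 𝓘(ℝ, E) ((extChartAt 𝓘(ℝ, E) x₀).symm p.1),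
      ((coneParam x₀ N p : FormBundle 𝓘(ℝ, E) M n).2 :
        TangentSpace 𝓘(ℝ, E) ((extChartAt 𝓘(ℝ, E) x₀).symm p.1) [⋀^Fin n]→L[ℝ] ℝ) v =
      p.2 * ((ofFormCoord x₀ ((extChartAt 𝓘(ℝ, E) x₀).symm p.1) (N p.1) :
        FormBundle 𝓘(ℝ, E) M n).2 :
        TangentSpace 𝓘(ℝ, E) ((extChartAt 𝓘(ℝ, E) x₀).symm p.1) [⋀^Fin n]→L[ℝ] ℝ) v := fun v => rfl
  refine ⟨fun h => h0 (ContinuousAlternatingMap.ext fun v => ?_), fun v hv => ?_⟩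
  · exact (mul_eq_zero.1 ((h1 v).symm.trans (DFunLike.congr_fun h v))).resolve_left ht
  · exact (h1 v).trans (mul_eq_zero_of_right _ (hk v hv))

theorem IsFrameAt.exists_formCoord_eq_smul (hC : IsDistribution n C) {x₀ : M}
    {N : E → E [⋀^Fin n]→L[ℝ] ℝ} {β : FormBundle 𝓘(ℝ, E) M n} (hβ : β ∈ tildeSet n C)
    (hβs : β.1 ∈ (extChartAt 𝓘(ℝ, E) x₀).source)
    (hN : IsFrameAt C x₀ N (extChartAt 𝓘(ℝ, E) x₀ β.1)) :
    ∃ b : ℝ, b ≠ 0 ∧ formCoord x₀ β = b • N (extChartAt 𝓘(ℝ, E) x₀ β.1) := by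
  obtain ⟨-, -, h0, hk⟩ := hN
  have hl : (extChartAt 𝓘(ℝ, E) x₀).symm (extChartAt 𝓘(ℝ, E) x₀ β.1) = β.1 :=
    (extChartAt 𝓘(ℝ, E) x₀).left_inv hβs
  rw [hl] at h0 hk
  obtain ⟨c, hc⟩ : ∃ c : Submodule ℝ E, c = C β.1 := ⟨_, rfl⟩
  have hcod : Module.finrank ℝ (E ⧸ c) = n := by rw [hc]; exact hC.codim β.1
  obtain ⟨a, ha⟩ : ∃ a : E [⋀^Fin n]→L[ℝ] ℝ, a =
    (ofFormCoord x₀ β.1 (N (extChartAt 𝓘(ℝ, E) x₀ β.1)) : FormBundle 𝓘(ℝ, E) M n).2 := ⟨_, rfl⟩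
  obtain ⟨b, hb⟩ : ∃ b : E [⋀^Fin n]→L[ℝ] ℝ, b = β.2 := ⟨_, rfl⟩
  have ha0 : a.toAlternatingMap ≠ 0 := fun h => h0 <| by
    rw [← ha]
    exact ContinuousAlternatingMap.toAlternatingMap_injective h
  obtain ⟨t, ht⟩ := exists_eq_smul_of_annihilates (A := a.toAlternatingMap)
    (B := b.toAlternatingMap) hcod (by rw [ha, hc]; exact hk) ha0 (by rw [hb, hc]; exact hβ.2)
  have hba : b = t • a := ContinuousAlternatingMap.toAlternatingMap_injective ht
  refine ⟨t, fun h => hβ.1 ?_, ?_⟩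
  · rw [h, zero_smul] at hba
    exact hb.symm.trans hba
  · have h1 := formCoord_ofFormCoord (I := 𝓘(ℝ, E)) hβs (N (extChartAt 𝓘(ℝ, E) x₀ β.1))
    rw [← h1]
    ext w
    refine (formCoord_apply hβs w).trans ?_
    refine Eq.trans ?_ (congrArg (t * ·) (formCoord_apply (I := 𝓘(ℝ, E)) (x₀ := x₀)
      (α := ofFormCoord x₀ β.1 (N (extChartAt 𝓘(ℝ, E) x₀ β.1))) hβs w).symm)
    have h2 := fun v => DFunLike.congr_fun hba v
    rw [hb, ha] at h2
    exact h2 _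

/-- The local expression of a smooth form with values in `M̃`. -/
theorem eventually_isFrameAt {A : Form 𝓘(ℝ, E) M n} {x : M}
    (hA : ∀ᶠ z in 𝓝 x, SmoothFormAt A z ∧ A z ≠ 0 ∧ AnnihilatesAt C A z) :
    ∀ᶠ y in 𝓝 (extChartAt 𝓘(ℝ, E) x x), IsFrameAt C x (inChart A x) y := by
  filter_upwards [eventually_nhds_chart (I := 𝓘(ℝ, E)) hA] with y ⟨hy, h1, h2, h3⟩
  refine ⟨hy, h1.contDiffAt_inChart hy, ?_⟩
  have hz := (extChartAt 𝓘(ℝ, E) x).map_target hy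
  have h4 := formCoord_section A hz
  rw [(extChartAt 𝓘(ℝ, E) x).right_inv hy] at h4
  have h5 := ofFormCoord_formCoord (x₀ := x) (α := (⟨_, A ((extChartAt 𝓘(ℝ, E) x).symm y)⟩ :
    FormBundle 𝓘(ℝ, E) M n)) hz
  rw [h4] at h5
  rw [h5]
  exact ⟨h2, h3⟩

end ConeParametrization

section Kernel

variable {E : Type*} [NormedAddCommGroup E] [NormedSpace ℝ E]
  {H : Type*} [TopologicalSpace H] {I : ModelWithCorners ℝ E H}
  {M : Type*} [TopologicalSpace M] [ChartedSpace H M]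
  {V : Type*} [NormedAddCommGroup V] [NormedSpace ℝ V] {k : ℕ}

theorem mem_formKer_congr (μ : Form I M (k + 1)) {x x' : M} (h : x = x') (η : E) :
    (η : TangentSpace I x) ∈ formKer μ x ↔ (η : TangentSpace I x') ∈ formKer μ x' := by
  subst h; rfl

theorem mfderiv_mem_formKer_iff (μ : Form I M (k + 1)) {ψ : V → M} {v : V}
    (hψ : Function.Surjective (mfderiv 𝓘(ℝ, V) I ψ v)) (q : V) :
    mfderiv 𝓘(ℝ, V) I ψ v q ∈ formKer μ (ψ v) ↔ (parametricForm ψ μ v).curryLeft q = 0 := by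
  rw [curryLeft_eq_zero_iff]
  have h1 : ∀ w : Fin k → V, parametricForm ψ μ v (Matrix.vecCons q w) =
      μ (ψ v) (Matrix.vecCons (mfderiv 𝓘(ℝ, V) I ψ v q)
        (fun i => mfderiv 𝓘(ℝ, V) I ψ v (w i))) := fun w => by
    rw [parametricForm_apply]
    refine congrArg _ (funext fun i => ?_)
    exact Fin.cases rfl (fun i => rfl) i
  refine ⟨fun h w => (h1 w).trans (h _), fun h w => ?_⟩
  choose u hu using fun i => hψ (w i)
  have h2 := (h1 u).symm.trans (h u)
  rwa [show (fun i => mfderiv 𝓘(ℝ, V) I ψ v (u i)) = w from funext hu] at h2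

theorem extD_formPullback_extD [IsManifold I ∞ M] [I.Boundaryless] {E' : Type*}
    [NormedAddCommGroup E'] [NormedSpace ℝ E'] [FiniteDimensional ℝ E'] {H' : Type*}
    [TopologicalSpace H'] {I' : ModelWithCorners ℝ E' H'} [I'.Boundaryless]
    {M' : Type*} [TopologicalSpace M'] [ChartedSpace H' M'] [IsManifold I' ∞ M'] {f : M' → M}
    {μ : Form I M k} (hf : ContMDiff I' I ∞ f) (hμ : ∀ x, SmoothFormAt μ x) (x : M') :
    extD (formPullback (I' := I') f (extD μ)) x = 0 := by
  have hs : ∀ {y}, y ∈ (extChartAt I' x).target →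
      ContMDiffAt 𝓘(ℝ, E') I ∞ (f ∘ (extChartAt I' x).symm) y := fun hy =>
    (hf _).comp _ (contMDiffAt_extChartAt_symm hy)
  have h1 : inChart (formPullback (I' := I') f (extD μ)) x =ᶠ[𝓝 (extChartAt I' x x)]
      extDeriv (parametricForm (f ∘ (extChartAt I' x).symm) μ) := by
    filter_upwards [extChartAt_target_mem_nhds (I := I') x] with y hy
    rw [inChart_eq_parametricForm, parametricForm_formPullback _
      ((contMDiffAt_extChartAt_symm hy).mdifferentiableAt (by simp))
      ((hf _).mdifferentiableAt (by simp)), parametricForm_extD (hs hy) (hμ _)]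
  rw [extD, I'.range_eq_univ, extDerivWithin_univ, h1.extDeriv_eq]
  rw [extDeriv_extDeriv_apply (SmoothFormAt.contDiffAt_parametricForm
    (hs (mem_extChartAt_target x)) (hμ _)) minSmoothness_two_le_infty]
  rfl

end Kernel

section Lift

set_option linter.unusedSectionVars false

variable {E : Type*} [NormedAddCommGroup E] [NormedSpace ℝ E] [FiniteDimensional ℝ E]
  {M : Type*} [TopologicalSpace M] [ChartedSpace E M] [IsManifold 𝓘(ℝ, E) ∞ M]
  {n : ℕ} {C : ∀ x : M, Submodule ℝ (TangentSpace 𝓘(ℝ, E) x)}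
  [ChartedSpace (E × ℝ) (Tilde n C)] [IsManifold 𝓘(ℝ, E × ℝ) ∞ (Tilde n C)]

theorem contMDiffAt_tilde_iff
    (hι : IsSmoothEmbedding 𝓘(ℝ, E × ℝ) (formModel 𝓘(ℝ, E) n) ∞ (tildeIncl n C))
    {E' : Type*} [NormedAddCommGroup E'] [NormedSpace ℝ E']
    {H' : Type*} [TopologicalSpace H'] {I' : ModelWithCorners ℝ E' H'}
    {M' : Type*} [TopologicalSpace M'] [ChartedSpace H' M'] [IsManifold I' ∞ M']
    {T : M' → Tilde n C} {p : M'} :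
    ContMDiffAt I' 𝓘(ℝ, E × ℝ) ∞ T p ↔
      ContMDiffAt I' (formModel 𝓘(ℝ, E) n) ∞ (tildeIncl n C ∘ T) p := by
  rw [ContMDiffAt.iff_comp_isImmersionAt (hι.isImmersion.isImmersionAt (T p))]
  exact and_iff_right_of_imp fun h => hι.isEmbedding.isInducing.continuousAt_iff.2 h.continuousAt

theorem parametricForm_tildeForm
    (hι : IsSmoothEmbedding 𝓘(ℝ, E × ℝ) (formModel 𝓘(ℝ, E) n) ∞ (tildeIncl n C))
    {T : E × ℝ → Tilde n C} {p₀ : E × ℝ} {x₀ : M} {N : E → E [⋀^Fin n]→L[ℝ] ℝ}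
    (hT : ∀ᶠ p in 𝓝 p₀, p.1 ∈ (extChartAt 𝓘(ℝ, E) x₀).target ∧
      ContMDiffAt 𝓘(ℝ, E × ℝ) 𝓘(ℝ, E × ℝ) ∞ T p ∧ tildeIncl n C (T p) = coneParam x₀ N p) :
    parametricForm T (tildeForm n C) p₀ = extDeriv (coneForm N) p₀ := by
  have hs : ∀ {p}, ContMDiffAt 𝓘(ℝ, E × ℝ) 𝓘(ℝ, E × ℝ) ∞ T p →
      ContMDiffAt 𝓘(ℝ, E × ℝ) (formModel 𝓘(ℝ, E) n) ∞ (tildeIncl n C ∘ T) p := fun h =>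
    (contMDiffAt_tilde_iff hι).1 h
  have h1 := parametricForm_formPullback (canonicalForm 𝓘(ℝ, E) M n)
    (hT.self_of_nhds.2.1.mdifferentiableAt (by simp))
    ((hι.contMDiff _).mdifferentiableAt (by simp))
  refine h1.trans ?_
  refine (parametricForm_extD (hs hT.self_of_nhds.2.1) (smoothFormAt_tautologicalForm _)).trans ?_
  refine Filter.EventuallyEq.extDeriv_eq ?_
  filter_upwards [eventually_eventually_nhds.2 hT] with p hp
  obtain ⟨hp1, hp2, hp3⟩ := hp.self_of_nhds
  have hsrc : ((tildeIncl n C ∘ T) p).1 ∈ (extChartAt 𝓘(ℝ, E) x₀).source := by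
    rw [Function.comp_apply, hp3]
    exact (extChartAt 𝓘(ℝ, E) x₀).map_target hp1
  rw [parametricForm_tautologicalForm (x₀ := x₀) ((hs hp2).mdifferentiableAt (by simp)) hsrc]
  have h2 : (fun z => extChartAt 𝓘(ℝ, E) x₀ ((tildeIncl n C ∘ T) z).1) =ᶠ[𝓝 p] Prod.fst := by
    filter_upwards [hp] with q hq
    rw [Function.comp_apply, hq.2.2]
    exact extChartAt_coneParam hq.1
  rw [h2.fderiv_eq, fderiv_fst, Function.comp_apply, hp3, formCoord_coneParam hp1]
  rfl

theorem exists_coneParam_lift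
    (hι : IsSmoothEmbedding 𝓘(ℝ, E × ℝ) (formModel 𝓘(ℝ, E) n) ∞ (tildeIncl n C))
    {α : Tilde n C} {N : E → E [⋀^Fin n]→L[ℝ] ℝ}
    (hN : ∀ᶠ y in 𝓝 (extChartAt 𝓘(ℝ, E) (tildeProj α) (tildeProj α)),
      IsFrameAt C (tildeProj α) N y)
    (hα : formCoord (tildeProj α) α.1 = N (extChartAt 𝓘(ℝ, E) (tildeProj α) (tildeProj α))) :
    ∃ T : E × ℝ → Tilde n C, T (extChartAt 𝓘(ℝ, E) (tildeProj α) (tildeProj α), 1) = α ∧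
      (∀ᶠ p in 𝓝 (extChartAt 𝓘(ℝ, E) (tildeProj α) (tildeProj α), (1 : ℝ)),
        p.1 ∈ (extChartAt 𝓘(ℝ, E) (tildeProj α)).target ∧
        ContMDiffAt 𝓘(ℝ, E × ℝ) 𝓘(ℝ, E × ℝ) ∞ T p ∧
        tildeIncl n C (T p) = coneParam (tildeProj α) N p) ∧
      Function.Bijective (mfderiv 𝓘(ℝ, E × ℝ) 𝓘(ℝ, E × ℝ) T
        (extChartAt 𝓘(ℝ, E) (tildeProj α) (tildeProj α), 1)) := by
  classical
  have hx := mem_extChartAt_source (I := 𝓘(ℝ, E)) (tildeProj α)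
  set x : M := tildeProj α with hxdef
  set y₀ : E := extChartAt 𝓘(ℝ, E) x x with hy₀
  let T : E × ℝ → Tilde n C := fun p => if h : coneParam x N p ∈ tildeSet n C then ⟨_, h⟩ else α
  have hfr : ∀ᶠ p : E × ℝ in 𝓝 (y₀, (1 : ℝ)), IsFrameAt C x N p.1 ∧ p.2 ≠ 0 :=
    (continuousAt_fst.eventually hN).and (continuousAt_snd.eventually_ne one_ne_zero)
  have hTp : ∀ p : E × ℝ, IsFrameAt C x N p.1 ∧ p.2 ≠ 0 →
      tildeIncl n C (T p) = coneParam x N p := fun p hp => by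
    simp only [T]
    rw [dif_pos (hp.1.coneParam_mem_tildeSet hp.2)]
    rfl
  have hev : ∀ᶠ p in 𝓝 (y₀, (1 : ℝ)), p.1 ∈ (extChartAt 𝓘(ℝ, E) x).target ∧
      ContMDiffAt 𝓘(ℝ, E × ℝ) 𝓘(ℝ, E × ℝ) ∞ T p ∧ tildeIncl n C (T p) = coneParam x N p := by
    filter_upwards [eventually_eventually_nhds.2 hfr] with p hp
    refine ⟨hp.self_of_nhds.1.mem_target, ?_, hTp p hp.self_of_nhds⟩
    rw [contMDiffAt_tilde_iff hι]
    refine (contMDiffAt_coneParam hp.self_of_nhds.1.mem_target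
      hp.self_of_nhds.1.contDiffAt).congr_of_eventuallyEq ?_
    filter_upwards [hp] with q hq using hTp q hq
  have hT0 : T (y₀, 1) = α := by
    refine hι.isEmbedding.injective ?_
    rw [hTp _ hfr.self_of_nhds]
    exact coneParam_eq hx (by rw [one_smul]; exact hα)
  refine ⟨T, hT0, hev, ?_⟩
  have hN0 : N y₀ ≠ 0 := fun h => by
    have h1 := formCoord_injective (I := 𝓘(ℝ, E)) (x₀ := x) (α := α.1)
      (β := ofFormCoord x x 0) hx rfl (by rw [formCoord_ofFormCoord hx, hα, h])
    refine α.2.1 ?_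
    rw [h1]
    exact ContinuousAlternatingMap.ext fun v => rfl
  obtain ⟨m, hm⟩ := SeparatingDual.exists_eq_one (R := ℝ) hN0
  let Q : Tilde n C → E × ℝ := fun β =>
    (extChartAt 𝓘(ℝ, E) x (tildeIncl n C β).1, m (formCoord x (tildeIncl n C β)))
  have hQ : ContMDiffAt 𝓘(ℝ, E × ℝ) 𝓘(ℝ, E × ℝ) ∞ Q (T (y₀, 1)) := by
    rw [hT0]
    exact ((contMDiffAt_extChartAt_proj (x₀ := x) (β := tildeIncl n C α) hx).comp α
      (hι.contMDiff α)).prodMk_space (m.contDiff.contMDiff.contMDiffAt.comp α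
        ((contMDiffAt_formCoord (x₀ := x) (β := tildeIncl n C α) hx).comp α (hι.contMDiff α)))
  have hQT : Q ∘ T =ᶠ[𝓝 (y₀, (1 : ℝ))] fun p => (p.1, p.2 * m (N p.1)) := by
    filter_upwards [hev] with p ⟨hp1, hp2, hp3⟩
    simp only [Function.comp_apply, Q]
    rw [hp3, extChartAt_coneParam hp1, formCoord_coneParam hp1, map_smul, smul_eq_mul]
  have hNd : HasFDerivAt (fun p : E × ℝ => m (N p.1)) (m.comp ((fderiv ℝ N y₀).comp
      (ContinuousLinearMap.fst ℝ E ℝ))) (y₀, (1 : ℝ)) :=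
    m.hasFDerivAt.comp _ (HasFDerivAt.comp (y₀, (1 : ℝ)) (f := Prod.fst)
      (hN.self_of_nhds.contDiffAt.differentiableAt (by simp)).hasFDerivAt hasFDerivAt_fst)
  have hd : HasFDerivAt (fun p : E × ℝ => (p.1, p.2 * m (N p.1))) _ (y₀, (1 : ℝ)) :=
    hasFDerivAt_fst.prodMk (hasFDerivAt_snd.mul hNd)
  have hc := mfderiv_comp (y₀, (1 : ℝ)) (hQ.mdifferentiableAt (by simp))
    (hev.self_of_nhds.2.1.mdifferentiableAt (by simp))
  rw [hQT.mfderiv_eq, mfderiv_eq_fderiv, hd.fderiv] at hc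
  obtain ⟨L, hL⟩ : ∃ L : E × ℝ →ₗ[ℝ] E × ℝ, ∀ q, L q =
      mfderiv 𝓘(ℝ, E × ℝ) 𝓘(ℝ, E × ℝ) T (y₀, 1) q :=
    ⟨(mfderiv 𝓘(ℝ, E × ℝ) 𝓘(ℝ, E × ℝ) T (y₀, 1)).toLinearMap, fun _ => rfl⟩
  have hinj : Function.Injective L := by
    rw [← LinearMap.ker_eq_bot, LinearMap.ker_eq_bot']
    intro q hq
    have h1 := DFunLike.congr_fun hc q
    have h2 : (mfderiv 𝓘(ℝ, E × ℝ) 𝓘(ℝ, E × ℝ) Q (T (y₀, 1))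
        (mfderiv 𝓘(ℝ, E × ℝ) 𝓘(ℝ, E × ℝ) T (y₀, 1) q) : E × ℝ) = 0 := by
      rw [← hL q, hq]
      exact map_zero _
    have h3 := h1.trans h2
    have h4 : q.1 = 0 := congrArg Prod.fst h3
    have h5 := congrArg Prod.snd h3
    simp only [one_smul, hm] at h5
    have h6 : m (fderiv ℝ N y₀ q.1) + q.2 = 0 := h5
    rw [h4, map_zero, map_zero, zero_add] at h6
    exact Prod.ext h4 h6
  have hbij : Function.Bijective L := ⟨hinj, LinearMap.injective_iff_surjective.1 hinj⟩
  rwa [show (L : E × ℝ → E × ℝ) = _ from funext hL] at hbij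

end Lift

section KernelOfTheCanonicalForm

universe u

set_option linter.unusedSectionVars false

variable {E : Type u} [NormedAddCommGroup E] [NormedSpace ℝ E] [FiniteDimensional ℝ E]
  {M : Type*} [TopologicalSpace M] [T2Space M] [ChartedSpace E M] [IsManifold 𝓘(ℝ, E) ∞ M]
  {n : ℕ} {C : ∀ x : M, Submodule ℝ (TangentSpace 𝓘(ℝ, E) x)}
  [ChartedSpace (E × ℝ) (Tilde n C)] [IsManifold 𝓘(ℝ, E × ℝ) ∞ (Tilde n C)]

theorem mem_pushforward_iff {α : Tilde n C} {σ : M → Tilde n C} (h : σ (tildeProj α) = α)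
    (η : E × ℝ) : (η : TangentSpace 𝓘(ℝ, E × ℝ) α) ∈ pushforward α σ ↔
      ∃ ζ ∈ characteristic C (tildeProj α),
        (mfderiv 𝓘(ℝ, E) 𝓘(ℝ, E × ℝ) σ (tildeProj α) ζ : E × ℝ) = η := by
  refine exists_congr fun ζ => and_congr_right fun _ => ⟨fun h1 => ?_, fun h1 => ?_⟩
  · exact congrArg (fun q : TangentBundle 𝓘(ℝ, E × ℝ) (Tilde n C) => (q.2 : E × ℝ)) h1
  · exact TotalSpace.ext h (heq_of_eq h1)

/-- The properties of the form underlying a flat section of `M̃`. -/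
theorem IsFlatSection.properties
    (hι : IsSmoothEmbedding 𝓘(ℝ, E × ℝ) (formModel 𝓘(ℝ, E) n) ∞ (tildeIncl n C))
    (hC : IsPreContact n C) {U : Set M} {A : Form 𝓘(ℝ, E) M n} {σ : M → Tilde n C}
    (hσ : IsFlatSection U A σ) {x : M} (hx : x ∈ U) :
    (∀ᶠ z in 𝓝 x, SmoothFormAt A z ∧ A z ≠ 0 ∧ AnnihilatesAt C A z) ∧
      ∀ ζ ∈ characteristic C x, ∀ v, extD A x (Matrix.vecCons ζ v) = 0 := by
  have h1 : ∀ z ∈ U, SmoothFormAt A z ∧ A z ≠ 0 ∧ AnnihilatesAt C A z := fun z hz => by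
    refine ⟨contMDiffAt_section_iff_smoothFormAt.1 ?_, ?_⟩
    · refine ((hι.contMDiff _).comp z (hσ.smooth.contMDiffAt
        (hσ.isOpen.mem_nhds hz))).congr_of_eventuallyEq ?_
      filter_upwards [hσ.isOpen.mem_nhds hz] with w hw using (hσ.eq_form w hw).symm
    · have h2 : (⟨z, A z⟩ : FormBundle 𝓘(ℝ, E) M n) ∈ tildeSet n C :=
        hσ.eq_form z hz ▸ (σ z).2
      exact h2
  have h2 := eventually_of_mem (hσ.isOpen.mem_nhds hx) h1
  refine ⟨h2, fun ζ hζ v => ?_⟩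
  obtain ⟨Z, hZ, rfl⟩ := hC.exists_isSection_characteristic h2 hζ
  have h3 := (lieDeriv_eq_insertion_extD (h2.mono fun z hz => hz.2.2)
    (Eventually.of_forall fun z => characteristic_le z (hZ.mem z))).symm.trans (hσ.flat Z hZ x hx)
  exact DFunLike.congr_fun h3 v

/-- The kernel of the restriction of the canonical form is the push-forward of the characteristic
distribution by any flat section. -/
theorem formKer_tildeForm
    (hι : IsSmoothEmbedding 𝓘(ℝ, E × ℝ) (formModel 𝓘(ℝ, E) n) ∞ (tildeIncl n C))
    (hC : IsPreContact n C) {α : Tilde n C} {σ : M → Tilde n C} (hσ : IsFlatSectionThrough α σ) :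
    ∃ L : TangentSpace 𝓘(ℝ, E) (tildeProj α) →ₗ[ℝ] TangentSpace 𝓘(ℝ, E × ℝ) α,
      Function.Injective L ∧
      formKer (tildeForm n C) α = (characteristic C (tildeProj α)).map L ∧
      (formKer (tildeForm n C) α : Set _) = pushforward α σ := by
  have : IsManifold 𝓘(ℝ, E) 1 M := .of_le (n := ∞) (by simp)
  obtain ⟨⟨U, A, hA, hxU⟩, hσα⟩ := hσ
  obtain ⟨hA1, hA2⟩ := hA.properties hι hC hxU
  have hx := mem_extChartAt_source (I := 𝓘(ℝ, E)) (tildeProj α)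
  have hαA : tildeIncl n C α = ⟨tildeProj α, A (tildeProj α)⟩ := by
    rw [← hA.eq_form _ hxU, hσα]
  have hαc : formCoord (tildeProj α) α.1 =
      inChart A (tildeProj α) (extChartAt 𝓘(ℝ, E) (tildeProj α) (tildeProj α)) := by
    rw [← formCoord_section A hx]
    exact congrArg _ hαA
  obtain ⟨T, hT0, hT, hbij⟩ := exists_coneParam_lift hι (eventually_isFrameAt hA1) hαc
  have hpar := parametricForm_tildeForm hι hT
  have hTσ : σ =ᶠ[𝓝 (tildeProj α)]
      T ∘ fun z => (extChartAt 𝓘(ℝ, E) (tildeProj α) z, (1 : ℝ)) := by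
    filter_upwards [hA.isOpen.mem_nhds hxU, extChartAt_source_mem_nhds (I := 𝓘(ℝ, E)) (tildeProj α),
      ((continuousAt_extChartAt (I := 𝓘(ℝ, E)) (tildeProj α)).prodMk
        continuousAt_const).eventually hT] with z hz hzs hz'
    refine hι.isEmbedding.injective ?_
    rw [hA.eq_form z hz, Function.comp_apply, hz'.2.2]
    refine (coneParam_eq (β := (⟨z, A z⟩ : FormBundle 𝓘(ℝ, E) M n)) hzs ?_).symm
    rw [one_smul, formCoord_section A hzs]
  have hj : HasMFDerivAt 𝓘(ℝ, E) 𝓘(ℝ, E × ℝ)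
      (fun z => (extChartAt 𝓘(ℝ, E) (tildeProj α) z, (1 : ℝ))) (tildeProj α)
      ((ContinuousLinearMap.inl ℝ E ℝ).comp
        (mfderiv 𝓘(ℝ, E) 𝓘(ℝ, E) (extChartAt 𝓘(ℝ, E) (tildeProj α)) (tildeProj α))) := by
    have h1 : HasFDerivAt (fun y : E => (y, (1 : ℝ))) (ContinuousLinearMap.inl ℝ E ℝ)
      (extChartAt 𝓘(ℝ, E) (tildeProj α) (tildeProj α)) := hasFDerivAt_prodMk_left _ _
    exact h1.hasMFDerivAt.comp (tildeProj α) (mdifferentiableAt_extChartAt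
      (I := 𝓘(ℝ, E)) (mem_chart_source E (tildeProj α))).hasMFDerivAt
  have hdσ := ((hT.self_of_nhds.2.1.mdifferentiableAt (by simp)).hasMFDerivAt.comp
    (tildeProj α) hj).congr_of_eventuallyEq hTσ
  set N := inChart A (tildeProj α)
  obtain ⟨y₀, hy₀⟩ : ∃ y₀ : E, y₀ = extChartAt 𝓘(ℝ, E) (tildeProj α) (tildeProj α) := ⟨_, rfl⟩
  obtain ⟨φ', hφ'⟩ : ∃ φ' : TangentSpace 𝓘(ℝ, E) (tildeProj α) →ₗ[ℝ] E, ∀ ζ, φ' ζ =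
      mfderiv 𝓘(ℝ, E) 𝓘(ℝ, E) (extChartAt 𝓘(ℝ, E) (tildeProj α)) (tildeProj α) ζ :=
    ⟨(mfderiv 𝓘(ℝ, E) 𝓘(ℝ, E) (extChartAt 𝓘(ℝ, E) (tildeProj α)) (tildeProj α)).toLinearMap,
      fun _ => rfl⟩
  obtain ⟨T', hT'⟩ : ∃ T' : E × ℝ →ₗ[ℝ] E × ℝ, ∀ q, T' q =
      mfderiv 𝓘(ℝ, E × ℝ) 𝓘(ℝ, E × ℝ) T (extChartAt 𝓘(ℝ, E) (tildeProj α) (tildeProj α), 1) q :=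
    ⟨(mfderiv 𝓘(ℝ, E × ℝ) 𝓘(ℝ, E × ℝ) T
      (extChartAt 𝓘(ℝ, E) (tildeProj α) (tildeProj α), 1)).toLinearMap, fun _ => rfl⟩
  have hφinj : Function.Injective φ' := by
    rw [show (φ' : TangentSpace 𝓘(ℝ, E) (tildeProj α) → E) = _ from funext hφ']
    exact mfderiv_extChartAt_injective hx
  have hφsurj : Function.Surjective φ' := by
    rw [show (φ' : TangentSpace 𝓘(ℝ, E) (tildeProj α) → E) = _ from funext hφ']
    exact mfderiv_extChartAt_surjective hx
  have hTbij : Function.Bijective T' := by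
    rw [show (T' : E × ℝ → E × ℝ) = _ from funext hT']
    exact hbij
  have hσd : ∀ ζ, (mfderiv 𝓘(ℝ, E) 𝓘(ℝ, E × ℝ) σ (tildeProj α) ζ : E × ℝ) = T' (φ' ζ, 0) :=
    fun ζ => by
    rw [hT', hφ']
    exact DFunLike.congr_fun hdσ.mfderiv ζ
  have hker : ∀ q : E × ℝ, (T' q : TangentSpace 𝓘(ℝ, E × ℝ) α) ∈ formKer (tildeForm n C) α ↔
      (∀ v i, v i = q.1 → N y₀ v = 0) ∧ (1 : ℝ) • (extDeriv N y₀).curryLeft q.1 = -q.2 • N y₀ :=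
    fun q => by
    rw [mem_formKer_congr _ hT0.symm, hT', hy₀]
    refine (mfderiv_mem_formKer_iff (tildeForm n C) hbij.surjective q).trans ?_
    rw [hpar]
    exact curryLeft_extDeriv_coneForm_eq_zero_iff
      ((eventually_contDiffAt_inChart (hA1.mono fun z hz => hz.1)).self_of_nhds.differentiableAt
        (by simp)) q.1 q.2
  have hchar := mem_characteristic_iff hC.toIsDistribution hx hA1.self_of_nhds.1
    (hA1.mono fun z hz => hz.2.2) hA1.self_of_nhds.2.1
  have hN0 : N y₀ ≠ 0 := by
    rw [hy₀]
    exact inChart_ne_zero hx hA1.self_of_nhds.2.1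
  have hflat : ∀ ζ ∈ characteristic C (tildeProj α), (extDeriv N y₀).curryLeft (φ' ζ) = 0 := by
    intro ζ hζ
    rw [curryLeft_eq_zero_iff]
    intro w
    choose v hv using fun i => hφsurj (w i)
    refine Eq.trans ?_ (hA2 ζ hζ v)
    rw [extD_apply_inChart hx hA1.self_of_nhds.1, hy₀]
    refine congrArg _ (funext fun i => ?_)
    refine Fin.cases ?_ (fun i => ?_) i
    · exact hφ' ζ
    · exact (hv i).symm.trans (hφ' _)
  have hker' : ∀ η : TangentSpace 𝓘(ℝ, E × ℝ) α, η ∈ formKer (tildeForm n C) α ↔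
      ∃ ζ ∈ characteristic C (tildeProj α), T' (φ' ζ, 0) = η := fun η => by
    constructor
    · intro hη
      obtain ⟨⟨ζ', s⟩, rfl⟩ := hTbij.surjective η
      obtain ⟨h1, h2⟩ := (hker _).1 hη
      obtain ⟨ζ, rfl⟩ := hφsurj ζ'
      rw [one_smul] at h2
      have hζ : ζ ∈ characteristic C (tildeProj α) := by
        rw [hchar, ← hφ', ← hy₀]
        exact ⟨h1, _, h2⟩
      refine ⟨ζ, hζ, ?_⟩
      rw [hflat ζ hζ] at h2
      have h3 := (smul_eq_zero.1 h2.symm).resolve_right hN0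
      have h4 : s = 0 := neg_eq_zero.1 h3
      rw [h4]
    · rintro ⟨ζ, hζ, rfl⟩
      refine (hker _).2 ⟨?_, ?_⟩
      · rw [hchar, ← hφ', ← hy₀] at hζ
        exact hζ.1
      · rw [hflat ζ hζ]
        simp
  refine ⟨T' ∘ₗ (LinearMap.inl ℝ E ℝ) ∘ₗ φ', ?_, ?_, ?_⟩
  · exact hTbij.injective.comp ((LinearMap.inl_injective).comp hφinj)
  · ext η
    rw [hker' η]
    rfl
  · ext η
    refine (hker' η).trans ((mem_pushforward_iff hσα η).trans ?_).symm
    simp only [hσd]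
    rfl

theorem exists_isFlatSectionThrough
    (hι : IsSmoothEmbedding 𝓘(ℝ, E × ℝ) (formModel 𝓘(ℝ, E) n) ∞ (tildeIncl n C))
    (hC : IsPreContact n C) (α : Tilde n C) : ∃ σ, IsFlatSectionThrough α σ := by
  classical
  obtain ⟨A, hAα, hA⟩ := hC.exists_flat_form α.2
  obtain ⟨U, hU, hUo, hxU⟩ := eventually_nhds_iff.1 hA
  have hmem : ∀ z ∈ U, (⟨z, A z⟩ : FormBundle 𝓘(ℝ, E) M n) ∈ tildeSet n C := fun z hz =>
    ⟨(hU z hz).2.1, (hU z hz).2.2.1⟩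
  let σ : M → Tilde n C := fun z => if h : z ∈ U then ⟨⟨z, A z⟩, hmem z h⟩ else α
  have hσ : ∀ z ∈ U, tildeIncl n C (σ z) = ⟨z, A z⟩ := fun z hz => by
    simp only [σ]
    rw [dif_pos hz]
    rfl
  refine ⟨σ, ⟨U, A, ⟨hUo, hσ, fun z hz => ?_, fun Z hZ z hz => ?_⟩, hxU⟩, ?_⟩
  · refine ContMDiffAt.contMDiffWithinAt ?_
    rw [contMDiffAt_tilde_iff hι]
    refine (contMDiffAt_section_iff_smoothFormAt.2 (hU z hz).1).congr_of_eventuallyEq ?_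
    filter_upwards [hUo.mem_nhds hz] with w hw using hσ w hw
  · rw [lieDeriv_eq_insertion_extD (C := C) (eventually_of_mem (hUo.mem_nhds hz)
      fun w hw => (hU w hw).2.2.1) (Eventually.of_forall fun w => characteristic_le w (hZ.mem w))]
    exact ContinuousAlternatingMap.ext fun v => (hU z hz).2.2.2 _ (hZ.mem z) v
  · refine hι.isEmbedding.injective ?_
    exact (hσ _ hxU).trans (congrArg (TotalSpace.mk (tildeProj α)) hAα)

theorem tildeDistribution_eq_formKer
    (hι : IsSmoothEmbedding 𝓘(ℝ, E × ℝ) (formModel 𝓘(ℝ, E) n) ∞ (tildeIncl n C))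
    (hC : IsPreContact n C) (α : Tilde n C) :
    tildeDistribution α = (formKer (tildeForm n C) α : Set _) := by
  ext η
  constructor
  · rintro ⟨σ, hσ, hη⟩
    obtain ⟨-, -, -, h⟩ := formKer_tildeForm hι hC hσ
    rwa [h]
  · intro hη
    obtain ⟨σ, hσ⟩ := exists_isFlatSectionThrough hι hC α
    obtain ⟨-, -, -, h⟩ := formKer_tildeForm hι hC hσ
    exact ⟨σ, hσ, h ▸ hη⟩

theorem isPrePlectic_tildeForm
    (hι : IsSmoothEmbedding 𝓘(ℝ, E × ℝ) (formModel 𝓘(ℝ, E) n) ∞ (tildeIncl n C))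
    (hC : IsPreContact n C) : IsPrePlectic n (tildeForm n C) where
  smooth := isSmoothForm_iff.2 fun α => smoothFormAt_formPullback hι.contMDiff
    (smoothFormAt_extD (Eventually.of_forall smoothFormAt_tautologicalForm))
  closed := extD_formPullback_extD hι.contMDiff smoothFormAt_tautologicalForm
  ker_const := by
    obtain ⟨r, hr⟩ := hC.char_const
    refine ⟨r, fun α => ?_⟩
    obtain ⟨σ, hσ⟩ := exists_isFlatSectionThrough hι hC α
    obtain ⟨L, hL, h, -⟩ := formKer_tildeForm hι hC hσ
    rw [h, ← hr (tildeProj α)]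
    exact (Submodule.equivMapOfInjective L hL _).finrank_eq.symm

theorem isPlectic_tildeForm_iff
    (hι : IsSmoothEmbedding 𝓘(ℝ, E × ℝ) (formModel 𝓘(ℝ, E) n) ∞ (tildeIncl n C))
    (hC : IsPreContact n C) : IsPlectic n (tildeForm n C) ↔ IsContact n C := by
  constructor
  · intro h
    refine ⟨hC, fun x => ?_⟩
    obtain ⟨α, hα, rfl⟩ := hC.exists_mem_tildeSet x
    obtain ⟨σ, hσ⟩ := exists_isFlatSectionThrough hι hC ⟨α, hα⟩
    obtain ⟨L, hL, h1, -⟩ := formKer_tildeForm hι hC hσ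
    rw [h.ker_eq_bot] at h1
    exact Submodule.map_injective_of_injective hL (h1.symm.trans (Submodule.map_bot L).symm)
  · intro h
    refine ⟨isPrePlectic_tildeForm hι hC, fun α => ?_⟩
    obtain ⟨σ, hσ⟩ := exists_isFlatSectionThrough hι hC α
    obtain ⟨L, hL, h1, -⟩ := formKer_tildeForm hι hC hσ
    rw [h1, h.char_eq_bot, Submodule.map_bot]

end KernelOfTheCanonicalForm

theorem exists_linear_splitting (E : Type*) [NormedAddCommGroup E] [NormedSpace ℝ E]
    [FiniteDimensional ℝ E] {W : Type*} [NormedAddCommGroup W] [NormedSpace ℝ W]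
    [FiniteDimensional ℝ W] {w : W} (hw : w ≠ 0) :
    ∃ e : ((E × ℝ) × (Fin (Module.finrank ℝ W - 1) → ℝ)) ≃L[ℝ] E × W,
      ∀ p, e (p, 0) = (p.1, p.2 • w) := by
  obtain ⟨m, hm⟩ := SeparatingDual.exists_eq_one (R := ℝ) hw
  let K : Submodule ℝ W := LinearMap.ker (m : W →ₗ[ℝ] ℝ)
  let e₀ : ((E × ℝ) × K) ≃ₗ[ℝ] E × W :=
    { toFun := fun p => (p.1.1, p.2 + p.1.2 • w)
      invFun := fun q => ((q.1, m q.2), ⟨q.2 - m q.2 • w, by simp [K, hm]⟩)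
      map_add' := fun p q => by
        refine Prod.ext rfl ?_
        simp only [Prod.fst_add, Prod.snd_add, Submodule.coe_add, add_smul]
        abel
      map_smul' := fun c p => by
        refine Prod.ext rfl ?_
        simp only [Prod.smul_fst, Prod.smul_snd, Submodule.coe_smul, smul_add, smul_smul,
          smul_eq_mul, RingHom.id_apply]
      left_inv := fun p => by
        have h0 : m (p.2 : W) = 0 := p.2.2
        have h1 : m ((p.2 : W) + p.1.2 • w) = p.1.2 := by simp [hm, h0]
        refine Prod.ext (Prod.ext rfl h1) (Subtype.ext ?_)
        dsimp only
        rw [h1, add_sub_cancel_right]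
      right_inv := fun q => Prod.ext rfl (sub_add_cancel _ _) }
  have h := e₀.finrank_eq
  rw [Module.finrank_prod, Module.finrank_prod, Module.finrank_prod, Module.finrank_self] at h
  let e₁ : (Fin (Module.finrank ℝ W - 1) → ℝ) ≃ₗ[ℝ] K :=
    LinearEquiv.ofFinrankEq _ _ (by rw [Module.finrank_fin_fun]; omega)
  refine ⟨(((LinearEquiv.refl ℝ (E × ℝ)).prodCongr e₁).trans e₀).toContinuousLinearEquiv,
    fun p => ?_⟩
  change ((p.1, (e₁ 0 : W) + p.2 • w) : E × W) = _
  rw [map_zero, Submodule.coe_zero, zero_add]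

section TildeManifold

set_option linter.unusedSectionVars false

variable {E : Type*} [NormedAddCommGroup E] [NormedSpace ℝ E] [FiniteDimensional ℝ E]
  {M : Type*} [TopologicalSpace M] [ChartedSpace E M] [IsManifold 𝓘(ℝ, E) ∞ M]
  {n : ℕ} {C : ∀ x : M, Submodule ℝ (TangentSpace 𝓘(ℝ, E) x)}

variable (n C) in
/-- A smooth local frame `N` of the line bundle `∧ⁿ C⁰`, in the preferred chart at the base point
of an element of `M̃`, normalised by a linear functional. -/
structure TildeFrame where
  base : Tilde n C
  frame : E → E [⋀^Fin n]→L[ℝ] ℝ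
  functional : (E [⋀^Fin n]→L[ℝ] ℝ) →L[ℝ] ℝ
  domain : Set E
  isOpen_domain : IsOpen domain
  isFrameAt : ∀ y ∈ domain, IsFrameAt C (tildeProj base) frame y
  functional_frame : ∀ y ∈ domain, functional (frame y) = 1
  mem_domain : extChartAt 𝓘(ℝ, E) (tildeProj base) (tildeProj base) ∈ domain

theorem IsDistribution.exists_tildeFrame (hC : IsDistribution n C) (α : Tilde n C) :
    ∃ F : TildeFrame n C, F.base = α := by
  obtain ⟨A, hAα, hA⟩ := exists_annihilating_form hC α.2
  have hx := mem_extChartAt_source (I := 𝓘(ℝ, E)) (tildeProj α)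
  have hfr := eventually_isFrameAt (x := tildeProj α) hA
  have hN0 : inChart A (tildeProj α) (extChartAt 𝓘(ℝ, E) (tildeProj α) (tildeProj α)) ≠ 0 :=
    inChart_ne_zero hx (Eventually.self_of_nhds (x := tildeProj α) hA).2.1
  obtain ⟨m, hm⟩ := SeparatingDual.exists_eq_one (R := ℝ) hN0
  have hm0 : ∀ᶠ y in 𝓝 (extChartAt 𝓘(ℝ, E) (tildeProj α) (tildeProj α)),
      m (inChart A (tildeProj α) y) ≠ 0 :=
    (m.continuous.continuousAt.comp hfr.self_of_nhds.contDiffAt.continuousAt).eventually_ne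
      (by rw [Function.comp_apply, hm]; exact one_ne_zero)
  obtain ⟨W, hW, hWo, hxW⟩ := eventually_nhds_iff.1 (hfr.and hm0)
  refine ⟨⟨α, fun y => (m (inChart A (tildeProj α) y))⁻¹ • inChart A (tildeProj α) y, m, W, hWo,
    fun y hy => ⟨(hW y hy).1.mem_target, ?_, ?_⟩, fun y hy => ?_, hxW⟩, rfl⟩
  · have h1 := (hW y hy).1.contDiffAt
    exact ((m.contDiff.contDiffAt.comp y h1).inv (hW y hy).2).smul h1
  · exact (hW y hy).1.coneParam_mem_tildeSet (p := (y, (m (inChart A (tildeProj α) y))⁻¹))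
      (inv_ne_zero (hW y hy).2)
  · rw [map_smul, smul_eq_mul, inv_mul_cancel₀ (hW y hy).2]

namespace TildeFrame

variable (F : TildeFrame n C)

/-- The coordinates on `∧ⁿ T*M` which restrict to the chart of `M̃` defined by a frame. -/
noncomputable def coord (β : FormBundle 𝓘(ℝ, E) M n) : E × ℝ :=
  (extChartAt 𝓘(ℝ, E) (tildeProj F.base) β.1, F.functional (formCoord (tildeProj F.base) β))

theorem contMDiffAt_coord {β : FormBundle 𝓘(ℝ, E) M n}
    (hβ : β.1 ∈ (extChartAt 𝓘(ℝ, E) (tildeProj F.base)).source) :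
    ContMDiffAt (formModel 𝓘(ℝ, E) n) 𝓘(ℝ, E × ℝ) ∞ F.coord β :=
  (contMDiffAt_extChartAt_proj hβ).prodMk_space
    (F.functional.contDiff.contMDiff.contMDiffAt.comp β (contMDiffAt_formCoord hβ))

theorem coord_coneParam {p : E × ℝ} (hp : p.1 ∈ F.domain) :
    F.coord (coneParam (tildeProj F.base) F.frame p) = p := by
  have hp' := (F.isFrameAt _ hp).mem_target
  refine Prod.ext (extChartAt_coneParam hp') ?_
  change F.functional (formCoord _ _) = _
  rw [formCoord_coneParam hp', map_smul, F.functional_frame _ hp, smul_eq_mul, mul_one]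

theorem formCoord_eq_smul_frame (hC : IsDistribution n C) {β : FormBundle 𝓘(ℝ, E) M n}
    (hβ : β ∈ tildeSet n C) (hβs : β.1 ∈ (extChartAt 𝓘(ℝ, E) (tildeProj F.base)).source)
    (hβd : (F.coord β).1 ∈ F.domain) : (F.coord β).2 ≠ 0 ∧
      formCoord (tildeProj F.base) β = (F.coord β).2 • F.frame (F.coord β).1 := by
  obtain ⟨b, hb, h⟩ := (F.isFrameAt _ hβd).exists_formCoord_eq_smul hC hβ hβs
  have h1 : (F.coord β).2 = b := by
    change F.functional (formCoord _ _) = _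
    rw [h, map_smul]
    exact (congrArg (b • ·) (F.functional_frame _ hβd)).trans (mul_one b)
  rw [h1]
  exact ⟨hb, h⟩

theorem coneParam_coord (hC : IsDistribution n C) {β : FormBundle 𝓘(ℝ, E) M n}
    (hβ : β ∈ tildeSet n C) (hβs : β.1 ∈ (extChartAt 𝓘(ℝ, E) (tildeProj F.base)).source)
    (hβd : (F.coord β).1 ∈ F.domain) :
    coneParam (tildeProj F.base) F.frame (F.coord β) = β :=
  coneParam_eq hβs (F.formCoord_eq_smul_frame hC hβ hβs hβd).2

theorem isOpen_source : IsOpen {β : FormBundle 𝓘(ℝ, E) M n |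
    β.1 ∈ (extChartAt 𝓘(ℝ, E) (tildeProj F.base)).source ∧
      extChartAt 𝓘(ℝ, E) (tildeProj F.base) β.1 ∈ F.domain} := by
  have h1 := (isOpen_extChartAt_source (I := 𝓘(ℝ, E)) (tildeProj F.base))
  have h2 := (continuousOn_extChartAt (I := 𝓘(ℝ, E)) (tildeProj F.base)).isOpen_inter_preimage h1
    F.isOpen_domain
  exact h2.preimage (FiberBundle.continuous_proj (E [⋀^Fin n]→L[ℝ] ℝ)
    (fun x : M => TangentSpace 𝓘(ℝ, E) x [⋀^Fin n]→L[ℝ] Bundle.Trivial M ℝ x))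

open Classical in
/-- The chart of `M̃` defined by a frame. -/
noncomputable def chart (hC : IsDistribution n C) : OpenPartialHomeomorph (Tilde n C) (E × ℝ) where
  toFun β := F.coord β.1
  invFun p := if h : coneParam (tildeProj F.base) F.frame p ∈ tildeSet n C then ⟨_, h⟩ else F.base
  source := {β | β.1.1 ∈ (extChartAt 𝓘(ℝ, E) (tildeProj F.base)).source ∧
    extChartAt 𝓘(ℝ, E) (tildeProj F.base) β.1.1 ∈ F.domain}
  target := {p | p.1 ∈ F.domain ∧ p.2 ≠ 0}
  map_source' β hβ := ⟨hβ.2, (F.formCoord_eq_smul_frame hC β.2 hβ.1 hβ.2).1⟩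
  map_target' p hp := by
    have h := (F.isFrameAt _ hp.1).coneParam_mem_tildeSet hp.2
    rw [dif_pos h]
    refine ⟨(extChartAt 𝓘(ℝ, E) (tildeProj F.base)).map_target (F.isFrameAt _ hp.1).mem_target, ?_⟩
    change extChartAt 𝓘(ℝ, E) (tildeProj F.base) (coneParam (tildeProj F.base) F.frame p).1 ∈ _
    rw [extChartAt_coneParam (F.isFrameAt _ hp.1).mem_target]
    exact hp.1
  left_inv' β hβ := by
    have h1 := F.coneParam_coord hC β.2 hβ.1 hβ.2
    have h : coneParam (tildeProj F.base) F.frame (F.coord β.1) ∈ tildeSet n C := by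
      rw [h1]; exact β.2
    rw [dif_pos h]
    exact Subtype.ext h1
  right_inv' p hp := by
    have h := (F.isFrameAt _ hp.1).coneParam_mem_tildeSet hp.2
    rw [dif_pos h]
    exact F.coord_coneParam hp.1
  open_source := F.isOpen_source.preimage continuous_subtype_val
  open_target := (F.isOpen_domain.preimage continuous_fst).inter
    (isOpen_ne.preimage continuous_snd)
  continuousOn_toFun := fun β hβ => ((F.contMDiffAt_coord hβ.1).continuousAt.comp
    continuous_subtype_val.continuousAt).continuousWithinAt
  continuousOn_invFun := by
    rw [IsEmbedding.subtypeVal.continuousOn_iff]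
    refine ContinuousOn.congr (f := coneParam (tildeProj F.base) F.frame) (fun p hp => ?_)
      fun p hp => ?_
    · exact (contMDiffAt_coneParam (F.isFrameAt _ hp.1).mem_target
        (F.isFrameAt _ hp.1).contDiffAt).continuousAt.continuousWithinAt
    · rw [Function.comp_apply, dif_pos ((F.isFrameAt _ hp.1).coneParam_mem_tildeSet hp.2)]

theorem tildeIncl_chart_symm (hC : IsDistribution n C) {p : E × ℝ}
    (hp : p ∈ (F.chart hC).target) :
    tildeIncl n C ((F.chart hC).symm p) = coneParam (tildeProj F.base) F.frame p := by
  exact congrArg (tildeIncl n C) (dif_pos ((F.isFrameAt _ hp.1).coneParam_mem_tildeSet hp.2))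

theorem base_mem_source (hC : IsDistribution n C) : F.base ∈ (F.chart hC).source :=
  ⟨mem_extChartAt_source (I := 𝓘(ℝ, E)) (tildeProj F.base), F.mem_domain⟩

/-- The vector `N(y) - N(y₀)` of the shear `(y, β) ↦ (y, β - m(β)(N(y) - N(y₀)))` straightening `M̃`. -/
noncomputable def shear (y : E) : (E [⋀^Fin n]→L[ℝ] ℝ) :=
  F.frame y - F.frame (extChartAt 𝓘(ℝ, E) (tildeProj F.base) (tildeProj F.base))

theorem functional_shear {y : E} (hy : y ∈ F.domain) : F.functional (F.shear y) = 0 := by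
  rw [shear, map_sub, F.functional_frame y hy, F.functional_frame _ F.mem_domain, sub_self]

theorem contDiffAt_shear {y : E} (hy : y ∈ F.domain) : ContDiffAt ℝ ∞ F.shear y :=
  (F.isFrameAt y hy).contDiffAt.sub contDiffAt_const

theorem contMDiffAt_sliceCoord {β : FormBundle 𝓘(ℝ, E) M n}
    (hβ : β.1 ∈ (extChartAt 𝓘(ℝ, E) (tildeProj F.base)).source)
    (hβd : extChartAt 𝓘(ℝ, E) (tildeProj F.base) β.1 ∈ F.domain) :
    ContMDiffAt (formModel 𝓘(ℝ, E) n) 𝓘(ℝ, E × (E [⋀^Fin n]→L[ℝ] ℝ)) ∞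
      (fun β : FormBundle 𝓘(ℝ, E) M n => (extChartAt 𝓘(ℝ, E) (tildeProj F.base) β.1,
        formCoord (tildeProj F.base) β - F.functional (formCoord (tildeProj F.base) β) •
          F.shear (extChartAt 𝓘(ℝ, E) (tildeProj F.base) β.1))) β := by
  have h1 := contMDiffAt_extChartAt_proj hβ
  have h2 := contMDiffAt_formCoord hβ
  have h3 : ContDiffAt ℝ ∞ (fun p : E × (E [⋀^Fin n]→L[ℝ] ℝ) =>
      (p.1, p.2 - F.functional p.2 • F.shear p.1))
      (extChartAt 𝓘(ℝ, E) (tildeProj F.base) β.1, formCoord (tildeProj F.base) β) :=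
    contDiffAt_fst.prodMk (contDiffAt_snd.sub
      ((F.functional.contDiff.contDiffAt.comp _ contDiffAt_snd).smul
        (ContDiffAt.comp (f := Prod.fst) _ (F.contDiffAt_shear hβd) contDiffAt_fst)))
  exact h3.contMDiffAt.comp β (h1.prodMk_space h2)

theorem contMDiffAt_sliceCoord_symm {p : E × (E [⋀^Fin n]→L[ℝ] ℝ)} (hp : p.1 ∈ F.domain) :
    ContMDiffAt 𝓘(ℝ, E × (E [⋀^Fin n]→L[ℝ] ℝ)) (formModel 𝓘(ℝ, E) n) ∞
      (fun p : E × (E [⋀^Fin n]→L[ℝ] ℝ) => (ofFormCoord (tildeProj F.base)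
        ((extChartAt 𝓘(ℝ, E) (tildeProj F.base)).symm p.1) (p.2 + F.functional p.2 • F.shear p.1) :
        FormBundle 𝓘(ℝ, E) M n)) p := by
  have h3 : ContDiffAt ℝ ∞ (fun p : E × (E [⋀^Fin n]→L[ℝ] ℝ) =>
      p.2 + F.functional p.2 • F.shear p.1) p :=
    contDiffAt_snd.add ((F.functional.contDiff.contDiffAt.comp p contDiffAt_snd).smul
      ((F.contDiffAt_shear hp).comp p contDiffAt_fst))
  exact contMDiffAt_ofFormCoord (f := Prod.fst) (F.isFrameAt _ hp).mem_target
    contDiffAt_fst.contMDiffAt h3.contMDiffAt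

/-- A slice chart of `∧ⁿ T*M` adapted to `M̃`. -/
noncomputable def sliceChart : OpenPartialHomeomorph (FormBundle 𝓘(ℝ, E) M n)
    (ModelProd E (E [⋀^Fin n]→L[ℝ] ℝ)) where
  toFun β := (extChartAt 𝓘(ℝ, E) (tildeProj F.base) β.1, formCoord (tildeProj F.base) β -
    F.functional (formCoord (tildeProj F.base) β) •
      F.shear (extChartAt 𝓘(ℝ, E) (tildeProj F.base) β.1))
  invFun p := ofFormCoord (tildeProj F.base)
    ((extChartAt 𝓘(ℝ, E) (tildeProj F.base)).symm p.1) (p.2 + F.functional p.2 • F.shear p.1)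
  source := {β | β.1 ∈ (extChartAt 𝓘(ℝ, E) (tildeProj F.base)).source ∧
    extChartAt 𝓘(ℝ, E) (tildeProj F.base) β.1 ∈ F.domain}
  target := {p | p.1 ∈ F.domain}
  map_source' β hβ := hβ.2
  map_target' p hp := by
    have h1 := (F.isFrameAt _ hp).mem_target
    refine ⟨(extChartAt 𝓘(ℝ, E) (tildeProj F.base)).map_target h1, ?_⟩
    change extChartAt 𝓘(ℝ, E) (tildeProj F.base)
      ((extChartAt 𝓘(ℝ, E) (tildeProj F.base)).symm p.1) ∈ _
    rw [(extChartAt 𝓘(ℝ, E) (tildeProj F.base)).right_inv h1]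
    exact hp
  left_inv' β hβ := by
    dsimp only
    rw [map_sub, map_smul, F.functional_shear hβ.2, smul_zero, sub_zero, sub_add_cancel,
      (extChartAt 𝓘(ℝ, E) (tildeProj F.base)).left_inv hβ.1, ofFormCoord_formCoord hβ.1]
  right_inv' p hp := by
    have h1 := (F.isFrameAt _ hp).mem_target
    have h2 := (extChartAt 𝓘(ℝ, E) (tildeProj F.base)).right_inv h1
    have h3 := formCoord_ofFormCoord (I := 𝓘(ℝ, E))
      ((extChartAt 𝓘(ℝ, E) (tildeProj F.base)).map_target h1)
      (p.2 + F.functional p.2 • F.shear p.1)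
    refine Prod.ext h2 ?_
    change formCoord _ _ - F.functional (formCoord _ _) • F.shear (extChartAt 𝓘(ℝ, E) _
      ((extChartAt 𝓘(ℝ, E) (tildeProj F.base)).symm p.1)) = _
    rw [h2, h3, map_add, map_smul, F.functional_shear hp, smul_zero, add_zero, add_sub_cancel_right]
  open_source := F.isOpen_source
  open_target := F.isOpen_domain.preimage continuous_fst
  continuousOn_toFun := fun β hβ => (F.contMDiffAt_sliceCoord hβ.1 hβ.2).continuousAt.continuousWithinAt
  continuousOn_invFun := fun _ hp =>
    (F.contMDiffAt_sliceCoord_symm hp).continuousAt.continuousWithinAt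

theorem sliceChart_mem_maximalAtlas :
    F.sliceChart ∈ IsManifold.maximalAtlas (formModel 𝓘(ℝ, E) n) ∞ (FormBundle 𝓘(ℝ, E) M n) := by
  refine F.sliceChart.mem_maximalAtlas_of_contMDiffOn (fun β hβ => ?_) (fun p hp => ?_)
  · have h := F.contMDiffAt_sliceCoord hβ.1 hβ.2
    rw [modelWithCornersSelf_prod] at h
    exact h.contMDiffWithinAt
  · have h := F.contMDiffAt_sliceCoord_symm (p := p) hp
    rw [modelWithCornersSelf_prod] at h
    exact h.contMDiffWithinAt

end TildeFrame

section Atlas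

variable (hC : IsDistribution n C)

/-- The frame of `∧ⁿ C⁰` chosen at a point of `M̃`. -/
noncomputable def tildeFrameAt (α : Tilde n C) : TildeFrame n C := (hC.exists_tildeFrame α).choose

theorem tildeFrameAt_base (α : Tilde n C) : (tildeFrameAt hC α).base = α :=
  (hC.exists_tildeFrame α).choose_spec

/-- The atlas of `M̃` given by the local frames of `∧ⁿ C⁰`. -/
noncomputable abbrev tildeChartedSpace : ChartedSpace (E × ℝ) (Tilde n C) where
  atlas := range fun α => (tildeFrameAt hC α).chart hC
  chartAt α := (tildeFrameAt hC α).chart hC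
  mem_chart_source α := by
    have h := (tildeFrameAt hC α).base_mem_source hC
    rwa [tildeFrameAt_base] at h
  chart_mem_atlas α := mem_range_self α

theorem isManifold_tilde :
    letI := tildeChartedSpace hC
    IsManifold 𝓘(ℝ, E × ℝ) ∞ (Tilde n C) := by
  let _ := tildeChartedSpace hC
  refine isManifold_of_contDiffOn 𝓘(ℝ, E × ℝ) ∞ (Tilde n C) ?_
  rintro _ _ ⟨α, rfl⟩ ⟨β, rfl⟩ p ⟨hp, -⟩
  refine ContDiffAt.contDiffWithinAt ?_
  set F := tildeFrameAt hC α
  set G := tildeFrameAt hC β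
  obtain ⟨hp1, hp2⟩ : p ∈ (F.chart hC).target ∧ (F.chart hC).symm p ∈ (G.chart hC).source := hp
  have h1 : (coneParam (tildeProj F.base) F.frame p).1 ∈
      (extChartAt 𝓘(ℝ, E) (tildeProj G.base)).source := by
    rw [← F.tildeIncl_chart_symm hC hp1]
    exact hp2.1
  have h2 := (G.contMDiffAt_coord h1).comp p (contMDiffAt_coneParam
    (F.isFrameAt _ hp1.1).mem_target (F.isFrameAt _ hp1.1).contDiffAt)
  refine h2.contDiffAt.congr_of_eventuallyEq ?_
  filter_upwards [(F.chart hC).open_target.mem_nhds hp1] with q hq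
  exact congrArg G.coord (F.tildeIncl_chart_symm hC hq)

theorem isSmoothEmbedding_tildeIncl :
    letI := tildeChartedSpace hC
    IsSmoothEmbedding 𝓘(ℝ, E × ℝ) (formModel 𝓘(ℝ, E) n) ∞ (tildeIncl n C) := by
  let _ := tildeChartedSpace hC
  have := isManifold_tilde hC
  refine ⟨IsImmersionOfComplement.isImmersion
    (F := Fin (Module.finrank ℝ (E [⋀^Fin n]→L[ℝ] ℝ) - 1) → ℝ) fun α => ?_, IsEmbedding.subtypeVal⟩
  set F := tildeFrameAt hC α with hF
  obtain ⟨e, he⟩ := exists_linear_splitting E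
    (w := F.frame (extChartAt 𝓘(ℝ, E) (tildeProj F.base) (tildeProj F.base))) fun h => by
      have h1 := F.functional_frame _ F.mem_domain
      rw [h, map_zero] at h1
      exact zero_ne_one h1
  have hα : α ∈ (F.chart hC).source := mem_chart_source (E × ℝ) α
  refine IsImmersionAtOfComplement.mk_of_charts
    e (F.chart hC) F.sliceChart hα hα (IsManifold.chart_mem_maximalAtlas α)
    F.sliceChart_mem_maximalAtlas (fun β hβ => hβ) ?_
  intro p hp
  have hp' : p ∈ (F.chart hC).target := by simpa using hp
  have hpt := (F.isFrameAt _ hp'.1).mem_target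
  change F.sliceChart (tildeIncl n C ((F.chart hC).symm p)) = e (p, 0)
  rw [F.tildeIncl_chart_symm hC hp', he]
  refine Prod.ext (extChartAt_coneParam hpt) ?_
  change formCoord _ _ - F.functional (formCoord _ _) • F.shear (extChartAt 𝓘(ℝ, E) _ _) =
    (_ • _ : E [⋀^Fin n]→L[ℝ] ℝ)
  rw [formCoord_coneParam hpt, extChartAt_coneParam hpt, map_smul, F.functional_frame _ hp'.1,
    smul_eq_mul, mul_one, TildeFrame.shear, smul_sub, sub_sub_cancel]

end Atlas

end TildeManifold

end Multicontact

theorem mainTheorem2 {E : Type*} [NormedAddCommGroup E] [NormedSpace ℝ E] [FiniteDimensional ℝ E]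
    {M : Type*} [TopologicalSpace M] [T2Space M] [ChartedSpace E M] [IsManifold 𝓘(ℝ, E) ∞ M]
    (n : ℕ) (C : ∀ x : M, Submodule ℝ (TangentSpace 𝓘(ℝ, E) x)) (hC : IsPreContact n C) :
    -- the set `M̃` is an embedded submanifold of `∧ⁿ T*M`, of dimension `dim M + 1`,
    (∃ _ : ChartedSpace (E × ℝ) (Tilde n C), IsManifold 𝓘(ℝ, E × ℝ) ∞ (Tilde n C) ∧
      IsSmoothEmbedding 𝓘(ℝ, E × ℝ) (formModel 𝓘(ℝ, E) n) ∞ (tildeIncl n C)) ∧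
    -- and, for its structure of embedded submanifold:
    ∀ [ChartedSpace (E × ℝ) (Tilde n C)] [IsManifold 𝓘(ℝ, E × ℝ) ∞ (Tilde n C)],
      IsSmoothEmbedding 𝓘(ℝ, E × ℝ) (formModel 𝓘(ℝ, E) n) ∞ (tildeIncl n C) →
        IsPrePlectic n (tildeForm n C) ∧
        -- `D̃` is well defined: there are `D`-flat sections through every point `α`, and
        -- `D̃_α` does not depend on the choice of one of them
        (∀ α : Tilde n C, (∃ σ, IsFlatSectionThrough α σ) ∧
          ∀ σ, IsFlatSectionThrough α σ → tildeDistribution α = pushforward α σ) ∧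
        (∀ α : Tilde n C, (formKer (tildeForm n C) α : Set _) = tildeDistribution α) ∧
        (IsPlectic n (tildeForm n C) ↔ IsContact n C) := by
  refine ⟨⟨tildeChartedSpace hC.toIsDistribution, isManifold_tilde hC.toIsDistribution,
    isSmoothEmbedding_tildeIncl hC.toIsDistribution⟩, fun hι => ⟨isPrePlectic_tildeForm hι hC,
    fun α => ⟨exists_isFlatSectionThrough hι hC α, fun σ hσ => ?_⟩,
    fun α => (tildeDistribution_eq_formKer hι hC α).symm, isPlectic_tildeForm_iff hι hC⟩⟩
  obtain ⟨-, -, -, h⟩ := formKer_tildeForm hι hC hσ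
  exact (tildeDistribution_eq_formKer hι hC α).trans h
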